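/- **Setting.** Let $n\ge 1$, $N>n$, $\sigma>0$, and $\theta^0=[\theta_1,\dots,\theta_n]^\top\in\mathbb{R}^n$ be such that $p(x)=x^n-\theta_1x^{n-1}-\dots-\theta_n$ is a Schur polynomial (all its complex roots lie in the open unit disc). Let $\{e_t\}_{t\in\mathbb{Z}}$ be i.i.d. $\mathcal{N}(0,\sigma^2)$ and let $\{y_t\}_{t\in\mathbb{Z}}$ be a stationary process with $$y_t=Y_{t-1}^\top\theta^0+e_t,\qquad Y_{t-1}=[y_{t-1},y_{t-2},\dots,y_{t-n}]^\top,\qquad t\in\mathbb{Z}.$$ Let $\hat\theta_N$ be a least squares estimator of $\theta^0$ from the data $y_1,\dots,y_N$, i.e. almost surely a minimizer over $\theta\in\mathbb{R}^n$ of $\sum_{t=n+1}^N (y_t-Y_{t-1}^\top\theta)^2$. Put $A=\begin{bmatrix}{\theta^0}^\top&0\\ I_n&0_{n\times1}\end{bmatrix}\in\mathbb{R}^{(n+1)\times(n+1)}$, $B=\begin{bmatrix}1\\0_{n\times1}\end{bmatrix}$, $\overline V=\sigma^2\sum_{i=0}^\infty A^iBB^\top(A^\top)^i$, and for $\epsilon>0$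 $$V_{\rm dn}=(N-n)\begin{bmatrix}I_n&0\end{bmatrix}\Big(\overline V-\epsilon\sigma^2\sum_{i=0}^\infty A^i(A^\top)^i\Big)\begin{bmatrix}I_n\\0\end{bmatrix},\qquad V_{\rm up}=(N-n)\begin{bmatrix}I_n&0\end{bmatrix}\Big(\overline V+\epsilon\sigma^2\sum_{i=0}^\infty A^i(A^\top)^i\Big)\begin{bmatrix}I_n\\0\end{bmatrix},$$ $$M_\Phi=\max_{\omega\in\mathbb{R}}\big|e^{j\omega n}-\theta_1e^{j\omega(n-1)}-\dots-\theta_n\big|^{-2},\qquad \tilde\beta=\frac{(n+1)N}{N-n}\left[\frac{\mathbb{E}\{y_1^2\}}{\epsilon\sigma^2}+\frac{2M_\Phi(1+\epsilon^{-1/2})}{N^{1/4}}\right],$$ $$\delta(\epsilon,N)=2\left\{\sqrt2\,e^{-\frac{(N-n)\sigma^2\epsilon}{24n\mathbb{E}\{y_1^2\}}}+e^{-\frac{N-n}{2}\left(1+\frac{\epsilon}{3}-\sqrt{1+\frac{2\epsilon}{3}}\right)}+e^{-\frac{(N-n)\epsilon}{72(\|\theta^0\|_2+1)^2\tilde\beta}}+e^{-\epsilon\sqrt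 N}\right\}.$$ **Theorem.** For every fixed $w\in\mathbb{R}^n$ with $\|w\|_2=1$ and every $\epsilon>0$ such that $V_{\rm dn}\succ0$, $$\mathbb{P}\left(|w^\top(\hat\theta_N-\theta^0)|>2\sigma\,\|w^\top V_{\rm dn}^{-1/2}\|_2\sqrt{\log\left(\frac{\det(V_{\rm up}V_{\rm dn}^{-1}+I_n)^{1/2}}{\delta(\epsilon,N)}\right)}\right)\le 2\,\delta(\epsilon,N).$$ (If the logarithm is negative, then $\delta(\epsilon,N)>1$ and the bound is trivial; the square root is then read as $0$.) -/

import Mathlib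

open MeasureTheory ProbabilityTheory
open scoped MatrixOrder

namespace ARProcess

/-- The regressor `Y_t = (y_t, y_{t-1}, …, y_{t-n+1})` of a two-sided real sequence `y`. -/
def regressor (n : ℕ) (y : ℤ → ℝ) (t : ℤ) : Fin n → ℝ := fun k => y (t - (k : ℕ))

/-- The value at `z` of `p(x) = x^n - θ_1 x^(n-1) - … - θ_(n-1) x - θ_n`.
The coordinate `θ k`, `k : Fin n`, is the coefficient usually written `θ_(k+1)`. -/
noncomputable def charPoly {n : ℕ} (θ : EuclideanSpace ℝ (Fin n)) (z : ℂ) : ℂ :=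
  z ^ n - ∑ k : Fin n, (θ k : ℂ) * z ^ (n - 1 - (k : ℕ))

/-- `θ` yields an asymptotically stationary AR(`n`) process: the polynomial `charPoly θ` is Schur,
i.e. all its complex roots lie in the open unit disc. -/
def IsSchur {n : ℕ} (θ : EuclideanSpace ℝ (Fin n)) : Prop :=
  ∀ z : ℂ, charPoly θ z = 0 → ‖z‖ < 1

/-- A real process indexed by `ℤ` is (strictly) stationary: the law of its trajectory is invariant
under time shifts. -/
def IsStationary {Ω : Type*} [MeasurableSpace Ω] (μ : Measure Ω) (y : ℤ → Ω → ℝ) : Prop :=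
  ∀ h : ℤ, μ.map (fun ω t => y (t + h) ω) = μ.map (fun ω t => y t ω)

/-- `y` is a stationary AR(`n`) process with parameter `θ`, driven by the i.i.d. zero-mean Gaussian
noise `e` of variance `σ²`: `y_t = Y_{t-1}ᵀ θ + e_t`. -/
structure IsStationaryAR {Ω : Type*} [MeasurableSpace Ω] (μ : Measure Ω) {n : ℕ}
    (θ : EuclideanSpace ℝ (Fin n)) (σ : ℝ) (e y : ℤ → Ω → ℝ) : Prop where
  measurable_noise : ∀ t, Measurable (e t)
  measurable_output : ∀ t, Measurable (y t)
  indep_noise : iIndepFun e μ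
  gaussian_noise : ∀ t, μ.map (e t) = gaussianReal 0 (Real.toNNReal (σ ^ 2))
  recursion : ∀ t, ∀ᵐ ω ∂μ,
    y t ω = (∑ k : Fin n, regressor n (fun s => y s ω) (t - 1) k * θ k) + e t ω
  stationary : IsStationary μ y

/-- `ϑ` is a least squares estimate of the AR(`n`) parameter from the data `y_1, …, y_N`:
it minimizes `∑_{t=n+1}^N (y_t - Y_{t-1}ᵀ ϑ)²`. -/
def IsLeastSquares (n N : ℕ) (y : ℤ → ℝ) (ϑ : EuclideanSpace ℝ (Fin n)) : Prop :=
  ∀ η : EuclideanSpace ℝ (Fin n),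
    ∑ t ∈ Finset.Icc (n + 1) N,
        (y (t : ℤ) - ∑ k : Fin n, regressor n y ((t : ℤ) - 1) k * ϑ k) ^ 2 ≤
      ∑ t ∈ Finset.Icc (n + 1) N,
        (y (t : ℤ) - ∑ k : Fin n, regressor n y ((t : ℤ) - 1) k * η k) ^ 2

/-- The `(n+1) × (n+1)` transition matrix `A = [θᵀ 0; I_n 0_{n×1}]`. -/
noncomputable def transition {n : ℕ} (θ : EuclideanSpace ℝ (Fin n)) :
    Matrix (Fin (n + 1)) (Fin (n + 1)) ℝ :=
  Matrix.of (Fin.cons (Fin.snoc (fun k => θ k) 0) (fun k : Fin n => Pi.single k.castSucc 1))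

/-- The input vector `B = [1; 0_{n×1}]`. -/
def input (n : ℕ) : Fin (n + 1) → ℝ := Pi.single 0 1

/-- `V̄ = σ² ∑_{i≥0} Aⁱ B Bᵀ (Aᵀ)ⁱ`. -/
noncomputable def Vbar {n : ℕ} (θ : EuclideanSpace ℝ (Fin n)) (σ : ℝ) :
    Matrix (Fin (n + 1)) (Fin (n + 1)) ℝ :=
  σ ^ 2 • ∑' i : ℕ, transition θ ^ i * Matrix.vecMulVec (input n) (input n) *
    (transition θ).transpose ^ i

/-- The Gramian `∑_{i≥0} Aⁱ (Aᵀ)ⁱ`. -/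
noncomputable def gramian {n : ℕ} (θ : EuclideanSpace ℝ (Fin n)) :
    Matrix (Fin (n + 1)) (Fin (n + 1)) ℝ :=
  ∑' i : ℕ, transition θ ^ i * (transition θ).transpose ^ i

/-- The compression `[I_n 0] M [I_n 0]ᵀ`: the leading `n × n` block of `M`. -/
def topBlock {n : ℕ} (M : Matrix (Fin (n + 1)) (Fin (n + 1)) ℝ) : Matrix (Fin n) (Fin n) ℝ :=
  M.submatrix Fin.castSucc Fin.castSucc

/-- `V_dn = (N - n) [I_n 0] (V̄ - ε σ² ∑ Aⁱ (Aᵀ)ⁱ) [I_n 0]ᵀ`. -/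
noncomputable def Vdn {n : ℕ} (θ : EuclideanSpace ℝ (Fin n)) (σ ε : ℝ) (N : ℕ) :
    Matrix (Fin n) (Fin n) ℝ :=
  ((N : ℝ) - n) • topBlock (Vbar θ σ - (ε * σ ^ 2) • gramian θ)

/-- `V_up = (N - n) [I_n 0] (V̄ + ε σ² ∑ Aⁱ (Aᵀ)ⁱ) [I_n 0]ᵀ`. -/
noncomputable def Vup {n : ℕ} (θ : EuclideanSpace ℝ (Fin n)) (σ ε : ℝ) (N : ℕ) :
    Matrix (Fin n) (Fin n) ℝ :=
  ((N : ℝ) - n) • topBlock (Vbar θ σ + (ε * σ ^ 2) • gramian θ)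

/-- `M_Φ = max_ω |e^{jωn} - θ_1 e^{jω(n-1)} - … - θ_n|⁻²`. -/
noncomputable def MPhi {n : ℕ} (θ : EuclideanSpace ℝ (Fin n)) : ℝ :=
  ⨆ ω : ℝ, (‖charPoly θ (Complex.exp (Complex.I * ω))‖ ^ 2)⁻¹

/-- `β̃ = (n+1)N/(N-n) · [E{y_1²}/(εσ²) + 2 M_Φ (1 + ε^{-1/2}) / N^{1/4}]`;
the argument `v` stands for `E{y_1²}`. -/
noncomputable def betaTilde {n : ℕ} (θ : EuclideanSpace ℝ (Fin n)) (σ v ε : ℝ) (N : ℕ) : ℝ :=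
  ((n : ℝ) + 1) * N / ((N : ℝ) - n) *
    (v / (ε * σ ^ 2) + 2 * MPhi θ * (1 + ε ^ (-(1 / 2) : ℝ)) / (N : ℝ) ^ (1 / 4 : ℝ))

/-- The failure probability `δ(ε, N)`; the argument `v` stands for `E{y_1²}`. -/
noncomputable def delta {n : ℕ} (θ : EuclideanSpace ℝ (Fin n)) (σ v ε : ℝ) (N : ℕ) : ℝ :=
  2 * (Real.sqrt 2 * Real.exp (-(((N : ℝ) - n) * σ ^ 2 * ε) / (24 * n * v)) +
    Real.exp (-(((N : ℝ) - n) / 2 * (1 + ε / 3 - Real.sqrt (1 + 2 * ε / 3)))) +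
    Real.exp (-(((N : ℝ) - n) * ε / (72 * (‖θ‖ + 1) ^ 2 * betaTilde θ σ v ε N))) +
    Real.exp (-(ε * Real.sqrt N)))

/-- `‖wᵀ V^{-1/2}‖₂`, where `V^{1/2}` is the positive semidefinite square root of `V`. -/
noncomputable def weightNorm {n : ℕ} (w : EuclideanSpace ℝ (Fin n))
    (V : Matrix (Fin n) (Fin n) ℝ) : ℝ :=
  ‖WithLp.toLp 2 (Matrix.vecMul (fun k => w k) (CFC.sqrt V)⁻¹)‖

end ARProcess

/-! ### Schur stability: geometric decay of the powers of the transition matrix. -/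

namespace ARProcess

/-! Write `I` for the information matrix, `S = ∑ e_t Y_{t-1}` for the score, `d` for the estimation
error, and `V`, `U` for `Vdn`, `Vup`. The bound `2δ` is the sum of two failure probabilities, each
at most `δ`.

Self-normalised estimate. For fixed `a`, the variable `exp (a·S/σ - aᵀIa/2)` has mean at most `1`,
because each `e_t` is Gaussian and independent of the past. Integrating it against the weight `exp
(-aᵀVa/2)` gives `mixture`, of mean at most `gaussianMass V`. The normal equations give `d·S =
dᵀId`. If `V ≤ I ≤ U` and `|w·d|` exceeds its threshold with logarithm `L`, Cauchy-Schwarz in the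
`V`-norm gives `dᵀVd > 4σ²L`, and evaluating the exponent at `a = d/(2σ)` shows that the mixture is
at least `exp L * gaussianMass (U + V)` (`mixture_ge_of_weightNorm_lt`). A ratio of Gaussian masses
is a ratio of square roots of determinants, so Markov's inequality (`measure_mixture_ge_le`) gives
`δ`.

Sandwich `V ≤ I ≤ U`. The state `X_t = (y_t, …, y_{t-n})` satisfies `X_t = A X_{t-1} + B e_t`.
Expanding `(u·X_t)²` and telescoping gives a Lyapunov identity `E(u) = E(Aᵀu) + defect(u)` for the
energy in direction `u` (`stateEnergy_eq`). Since `Aⁱ → 0`, iteration gives `E(u) = ∑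
defect((Aᵀ)ⁱu)`. Each defect is `(N-n)σ²u₀²` up to a multiple of `|u|²`; the main terms sum to the
form of `Vbar` and the errors to that of `gramian` (`information_between`).

The errors are two boundary states, the fluctuation of `∑ e_t²`, and the score. The first two kinds
have chi-square type tails. The score is controlled by Pinelis' `cosh` supermartingale on the event
that `∑ y_s²` is moderate, and that sum by a quadratic-form tail bound whose operator norm is at
most `σ²·MPhi`, by a Fourier multiplier estimate. Stationarity enters through the causal expansion
`y_t = ∑ impulse (t-j) e_j` (`ae_hasSum`), which gives independence from future noise and makes
every quantity a limit of Gaussian ones. -/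

theorem transition_mulVec_zero {n : ℕ} (θ : EuclideanSpace ℝ (Fin n)) (u : Fin (n + 1) → ℝ) :
    (transition θ).mulVec u 0 = ∑ k : Fin n, θ k * u k.castSucc := by
  simp [transition, Matrix.mulVec, dotProduct, Fin.sum_univ_castSucc]

theorem transition_mulVec_succ {n : ℕ} (θ : EuclideanSpace ℝ (Fin n)) (u : Fin (n + 1) → ℝ)
    (k : Fin n) : (transition θ).mulVec u k.succ = u k.castSucc := by
  simp [transition, Matrix.mulVec, Matrix.of_apply]

theorem map_transition_mulVec_zero {n : ℕ} (θ : EuclideanSpace ℝ (Fin n)) (u : Fin (n + 1) → ℂ) :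
    ((transition θ).map (algebraMap ℝ ℂ)).mulVec u 0 = ∑ k : Fin n, (θ k : ℂ) * u k.castSucc := by
  simp [transition, Matrix.mulVec, dotProduct, Fin.sum_univ_castSucc]

theorem map_transition_mulVec_succ {n : ℕ} (θ : EuclideanSpace ℝ (Fin n)) (u : Fin (n + 1) → ℂ)
    (k : Fin n) : ((transition θ).map (algebraMap ℝ ℂ)).mulVec u k.succ = u k.castSucc := by
  simp only [transition, Matrix.mulVec, dotProduct, Matrix.map_apply, Matrix.of_apply,
    Fin.cons_succ, Pi.single_apply]
  simp

/-- A chain `u_k = z u_{k+1}` is geometric. -/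
theorem eq_pow_mul_last {n : ℕ} {u : Fin (n + 1) → ℂ} {z : ℂ}
    (h : ∀ k : Fin n, u k.castSucc = z * u k.succ) (k : Fin (n + 1)) :
    u k = z ^ (n - (k : ℕ)) * u (Fin.last n) := by
  induction k using Fin.reverseInduction with
  | last => simp
  | cast k ih =>
    rw [h, ih, ← mul_assoc, ← pow_succ']
    congr 2
    simp only [Fin.val_succ, Fin.val_castSucc]
    omega

/-- An eigenvector for `z ≠ 0` is geometric along the shift rows, and the first row then says `p(z)
= 0`. The eigenvalue `0`, coming from the zero last column, is treated apart because it need not be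
a root of `p`. -/
theorem norm_lt_one_of_mem_spectrum {n : ℕ} {θ : EuclideanSpace ℝ (Fin n)} (hθ : IsSchur θ) {z : ℂ}
    (hz : z ∈ spectrum ℂ ((transition θ).map (algebraMap ℝ ℂ))) : ‖z‖ < 1 := by
  by_cases hz0 : z = 0
  · simp [hz0]
  rw [spectrum.mem_iff, Matrix.isUnit_iff_isUnit_det, isUnit_iff_ne_zero, not_not,
    ← Matrix.exists_mulVec_eq_zero_iff] at hz
  obtain ⟨u, hu0, hu⟩ := hz
  have key : ∀ k, ((transition θ).map (algebraMap ℝ ℂ)).mulVec u k = z * u k := by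
    intro k
    have := congrFun hu k
    rw [Matrix.sub_mulVec, Algebra.algebraMap_eq_smul_one, Matrix.smul_mulVec, Matrix.one_mulVec] at this
    simp only [Pi.sub_apply, Pi.smul_apply, smul_eq_mul, Pi.zero_apply] at this
    exact (sub_eq_zero.1 this).symm
  have hchain : ∀ k : Fin n, u k.castSucc = z * u k.succ := fun k => by
    rw [← key, map_transition_mulVec_succ]
  have hpow := eq_pow_mul_last hchain
  have hlast : u (Fin.last n) ≠ 0 := by
    intro h0
    exact hu0 (funext fun k => by rw [hpow k, h0, mul_zero, Pi.zero_apply])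
  apply hθ
  have h0 := key 0
  rw [map_transition_mulVec_zero, hpow 0] at h0
  have h1 : z * u (Fin.last n) * charPoly θ z = 0 := by
    have h2 : ∑ k : Fin n, (θ k : ℂ) * u k.castSucc =
        z * u (Fin.last n) * ∑ k : Fin n, (θ k : ℂ) * z ^ (n - 1 - (k : ℕ)) := by
      rw [Finset.mul_sum]
      refine Finset.sum_congr rfl fun k _ => ?_
      rw [hpow, Fin.val_castSucc, show n - (k : ℕ) = n - 1 - k + 1 by omega, pow_succ]
      ring
    rw [charPoly, mul_sub, ← h2, h0]
    simp
    ring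
  simpa [hz0, hlast] using h1

section
attribute [local instance] Matrix.linftyOpNormedRing Matrix.linftyOpNormedAlgebra

/-- Gelfand's formula over `ℂ`: for `r` strictly between the spectral radius and `1`, eventually
`‖Tᵏ‖ ≤ rᵏ`. Positivity of `r` lets a constant absorb the finitely many exceptions. -/
theorem exists_abs_transition_pow_le {n : ℕ} {θ : EuclideanSpace ℝ (Fin n)} (hθ : IsSchur θ) :
    ∃ C ρ : ℝ, 0 < C ∧ 0 < ρ ∧ ρ < 1 ∧ ∀ k i j, |(transition θ ^ k) i j| ≤ C * ρ ^ k := by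
  set T := (transition θ).map (algebraMap ℝ ℂ) with hT
  have hrad : spectralRadius ℂ T < (1 : NNReal) := by
    refine spectrum.spectralRadius_lt_of_forall_lt T fun z hz => ?_
    exact_mod_cast norm_lt_one_of_mem_spectrum hθ hz
  obtain ⟨r, hr1, hr2⟩ := ENNReal.lt_iff_exists_nnreal_btwn.1 hrad
  have hr : 0 < r := pos_iff_ne_zero.2 (by rintro rfl; simp at hr1)
  have hev := (spectrum.pow_nnnorm_pow_one_div_tendsto_nhds_spectralRadius T).eventually_lt_const hr1
  have hO : (fun k : ℕ => T ^ k) =O[Filter.atTop] fun k : ℕ => (r : ℝ) ^ k := by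
    refine Asymptotics.IsBigO.of_bound 1 ?_
    filter_upwards [hev, Filter.eventually_gt_atTop 0] with k hk hk0
    have h1 : (‖T ^ k‖₊ : ENNReal) < (r : ENNReal) ^ (k : ℝ) := by
      have := ENNReal.rpow_lt_rpow hk (z := (k : ℝ)) (by positivity)
      rwa [← ENNReal.rpow_mul, one_div, inv_mul_cancel₀ (by positivity), ENNReal.rpow_one] at this
    rw [ENNReal.rpow_natCast] at h1
    have h2 : ‖T ^ k‖₊ < r ^ k := by exact_mod_cast h1
    rw [one_mul, Real.norm_of_nonneg (by positivity)]
    exact_mod_cast h2.le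
  obtain ⟨C, hC, hb⟩ := Asymptotics.bound_of_isBigO_nat_atTop hO
  refine ⟨C, r, hC, hr, by exact_mod_cast hr2, fun k i j => ?_⟩
  have h1 := hb (pow_ne_zero k (ne_of_gt (by exact_mod_cast hr : (0 : ℝ) < r)) : (r : ℝ) ^ k ≠ 0)
  rw [Real.norm_of_nonneg (by positivity)] at h1
  refine le_trans ?_ h1
  have h2 : T ^ k = (transition θ ^ k).map (algebraMap ℝ ℂ) := by
    rw [hT, Matrix.map_pow]
  have h3 : |(transition θ ^ k) i j| = ‖(T ^ k) i j‖ := by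
    rw [h2]; simp
  rw [h3, Matrix.linfty_opNorm_def]
  have h4 : ‖(T ^ k) i j‖₊ ≤ ∑ j, ‖(T ^ k) i j‖₊ :=
    Finset.single_le_sum (f := fun j => ‖(T ^ k) i j‖₊) (fun _ _ => zero_le) (Finset.mem_univ j)
  have h5 : ∑ j, ‖(T ^ k) i j‖₊ ≤ Finset.univ.sup fun i => ∑ j, ‖(T ^ k) i j‖₊ :=
    Finset.le_sup (f := fun i => ∑ j, ‖(T ^ k) i j‖₊) (Finset.mem_univ i)
  exact_mod_cast h4.trans h5
end

theorem summable_transition_pow_apply {n : ℕ} {θ : EuclideanSpace ℝ (Fin n)} (hθ : IsSchur θ)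
    (i j : Fin (n + 1)) : Summable fun k => |(transition θ ^ k) i j| := by
  obtain ⟨C, ρ, hC, h0, h1, hb⟩ := exists_abs_transition_pow_le hθ
  exact Summable.of_nonneg_of_le (fun _ => abs_nonneg _) (fun k => hb k i j)
    ((summable_geometric_of_lt_one h0.le h1).mul_left C)

end ARProcess

/-! ### Impulse response, transfer function and the Fourier multiplier bound. -/

namespace ARProcess

/-- The impulse response `h_k = (A^k)_{00}` of the recursion, extended by zero to `k < 0`. -/
noncomputable def impulse {n : ℕ} (θ : EuclideanSpace ℝ (Fin n)) (k : ℤ) : ℝ :=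
  if 0 ≤ k then (transition θ ^ k.toNat) 0 0 else 0

theorem impulse_natCast {n : ℕ} (θ : EuclideanSpace ℝ (Fin n)) (k : ℕ) :
    impulse θ k = (transition θ ^ k) 0 0 := by
  simp [impulse]

theorem impulse_of_neg {n : ℕ} (θ : EuclideanSpace ℝ (Fin n)) {k : ℤ} (hk : k < 0) :
    impulse θ k = 0 := by
  simp [impulse, hk]

theorem impulse_zero {n : ℕ} (θ : EuclideanSpace ℝ (Fin n)) : impulse θ 0 = 1 := by
  simp [impulse]

theorem impulse_eq_zero_of_notMem_range {n : ℕ} (θ : EuclideanSpace ℝ (Fin n)) (k : ℤ)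
    (hk : k ∉ Set.range ((↑) : ℕ → ℤ)) : impulse θ k = 0 := by
  refine impulse_of_neg θ ?_
  by_contra! h
  exact hk ⟨k.toNat, by simp [h]⟩

theorem summable_abs_impulse {n : ℕ} {θ : EuclideanSpace ℝ (Fin n)} (hθ : IsSchur θ) :
    Summable fun k => |impulse θ k| := by
  refine (Function.Injective.summable_iff Nat.cast_injective fun k hk => ?_).1 ?_
  · simp [impulse_eq_zero_of_notMem_range θ k hk]
  · simpa [Function.comp_def, impulse_natCast] using summable_transition_pow_apply hθ 0 0

/-- The transfer function of the recursion is `z^n / p(z)` on the unit circle. -/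
theorem tsum_impulse_mul_charPoly {n : ℕ} {θ : EuclideanSpace ℝ (Fin n)} (hθ : IsSchur θ) {z : ℂ}
    (hz : ‖z‖ = 1) :
    (∑' k : ℕ, ((transition θ ^ k) 0 0 : ℂ) * z⁻¹ ^ k) * charPoly θ z = z ^ n := by
  have hz0 : z ≠ 0 := by rintro rfl; simp at hz
  -- `x` is the first column of the resolvent `(1 - z⁻¹A)⁻¹`, so it solves `x = e₀ + z⁻¹Ax`; `hsucc`
  -- and `hzero` are the rows of this system.
  set x : Fin (n + 1) → ℂ := fun i => ∑' k : ℕ, ((transition θ ^ k) i 0 : ℂ) * z⁻¹ ^ k with hx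
  have hs : ∀ i, Summable fun k : ℕ => ((transition θ ^ k) i 0 : ℂ) * z⁻¹ ^ k := fun i => by
    refine Summable.of_norm ?_
    simpa [hz] using summable_transition_pow_apply hθ i 0
  have hpow : ∀ (k : ℕ) i, (transition θ ^ (k + 1)) i 0 =
      (transition θ).mulVec (fun j => (transition θ ^ k) j 0) i := fun k i => by
    rw [pow_succ']; rfl
  have hsucc : ∀ k : Fin n, x k.succ = z⁻¹ * x k.castSucc := fun k => by
    simp only [hx]
    rw [(hs k.succ).tsum_eq_zero_add, ← tsum_mul_left]
    simp only [hpow, transition_mulVec_succ, pow_zero, Matrix.one_apply_ne (Fin.succ_ne_zero k),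
      Complex.ofReal_zero, zero_mul, zero_add]
    exact tsum_congr fun b => by ring
  have hzero : x 0 = 1 + z⁻¹ * ∑ k : Fin n, (θ k : ℂ) * x k.castSucc := by
    have h1 : ∑ k : Fin n, (θ k : ℂ) * x k.castSucc =
        ∑' i : ℕ, ∑ k : Fin n, (θ k : ℂ) * (((transition θ ^ i) k.castSucc 0 : ℂ) * z⁻¹ ^ i) := by
      rw [Summable.tsum_finsetSum fun k _ => (hs k.castSucc).mul_left (θ k : ℂ)]
      exact Finset.sum_congr rfl fun k _ => tsum_mul_left.symm
    rw [h1, ← tsum_mul_left]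
    simp only [hx]
    rw [(hs 0).tsum_eq_zero_add]
    simp only [hpow, transition_mulVec_zero, pow_zero, Matrix.one_apply_eq, Complex.ofReal_one,
      mul_one]
    congr 1
    refine tsum_congr fun b => ?_
    push_cast
    rw [Finset.sum_mul, Finset.mul_sum]
    exact Finset.sum_congr rfl fun k _ => by ring
  have hgeo : ∀ k : Fin (n + 1), x k = z⁻¹ ^ (k : ℕ) * x 0 := fun k => by
    induction k using Fin.induction with
    | zero => simp
    | succ k ih => rw [hsucc, ih, Fin.val_succ, Fin.val_castSucc, pow_succ']; ring
  change x 0 * charPoly θ z = z ^ n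
  have h2 : z⁻¹ * ∑ k : Fin n, (θ k : ℂ) * x k.castSucc =
      x 0 * ∑ k : Fin n, (θ k : ℂ) * z⁻¹ ^ ((k : ℕ) + 1) := by
    rw [Finset.mul_sum, Finset.mul_sum]
    refine Finset.sum_congr rfl fun k _ => ?_
    rw [hgeo, Fin.val_castSucc]; ring
  have h3 : ∑ k : Fin n, (θ k : ℂ) * z ^ (n - 1 - (k : ℕ)) =
      z ^ n * ∑ k : Fin n, (θ k : ℂ) * z⁻¹ ^ ((k : ℕ) + 1) := by
    rw [Finset.mul_sum]
    refine Finset.sum_congr rfl fun k _ => ?_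
    have : z ^ n = z ^ (n - 1 - (k : ℕ)) * z ^ ((k : ℕ) + 1) := by
      rw [← pow_add]; congr 1; omega
    rw [this, inv_pow]
    field_simp
  rw [charPoly, h3]
  rw [h2] at hzero
  linear_combination z ^ n * hzero

theorem tsum_impulse_mul_pow {n : ℕ} (θ : EuclideanSpace ℝ (Fin n)) (z : ℂ) :
    ∑' k : ℤ, (impulse θ k : ℂ) * z ^ (-k) = ∑' k : ℕ, ((transition θ ^ k) 0 0 : ℂ) * z⁻¹ ^ k := by
  rw [← Function.Injective.tsum_eq (f := fun k : ℤ => (impulse θ k : ℂ) * z ^ (-k))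
    (g := ((↑) : ℕ → ℤ)) Nat.cast_injective]
  · simp [impulse_natCast]
  · intro k hk
    by_contra h
    exact hk (by simp [impulse_eq_zero_of_notMem_range θ k h])

theorem norm_sq_tsum_impulse_le_MPhi {n : ℕ} {θ : EuclideanSpace ℝ (Fin n)} (hθ : IsSchur θ)
    (ω : ℝ) : ‖∑' k : ℤ, (impulse θ k : ℂ) * Complex.exp (Complex.I * ω) ^ (-k)‖ ^ 2 ≤ MPhi θ := by
  have hnorm : ∀ ω : ℝ, ‖Complex.exp (Complex.I * ω)‖ = 1 := fun ω => by
    rw [mul_comm]; exact Complex.norm_exp_ofReal_mul_I ω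
  have heq : ∀ ω : ℝ, (‖charPoly θ (Complex.exp (Complex.I * ω))‖ ^ 2)⁻¹ =
      ‖∑' k : ℤ, (impulse θ k : ℂ) * Complex.exp (Complex.I * ω) ^ (-k)‖ ^ 2 := fun ω => by
    have h := congrArg norm (tsum_impulse_mul_charPoly hθ (hnorm ω))
    rw [norm_mul, norm_pow, hnorm, one_pow, ← tsum_impulse_mul_pow] at h
    rw [← inv_pow, eq_inv_of_mul_eq_one_left h]
  rw [← heq]
  -- The family must be shown bounded, since a real supremum over an unbounded family is `0` by
  -- convention; `(∑|h_k|)²` is a bound.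
  refine le_ciSup (f := fun ω : ℝ => (‖charPoly θ (Complex.exp (Complex.I * ω))‖ ^ 2)⁻¹)
    ⟨(∑' k, |impulse θ k|) ^ 2, ?_⟩ ω
  rintro _ ⟨ω, rfl⟩
  simp only [heq]
  gcongr
  have hn : ∀ k : ℤ, ‖(impulse θ k : ℂ) * Complex.exp (Complex.I * ω) ^ (-k)‖ = |impulse θ k| :=
    fun k => by simp [hnorm]
  refine (norm_tsum_le_tsum_norm ?_).trans_eq ?_
  · simpa only [hn] using summable_abs_impulse hθ
  · simp only [hn]

/-- Young's inequality in frequency domain: convolution with `h` is bounded on `ℓ²` by the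
supremum of its Fourier transform. -/
theorem sum_sq_conv_le {h : ℤ → ℝ} (hs : Summable fun k => |h k|) {M : ℝ}
    (hM : ∀ ω : ℝ, ‖∑' k : ℤ, (h k : ℂ) * Complex.exp (Complex.I * ω) ^ (-k)‖ ^ 2 ≤ M)
    (S J : Finset ℤ) (a : ℤ → ℝ) :
    ∑ j ∈ J, (∑ s ∈ S, a s * h (s - j)) ^ 2 ≤ M * ∑ s ∈ S, a s ^ 2 := by
  have : Fact (0 < 2 * Real.pi) := ⟨by positivity⟩
  have hM0 : 0 ≤ M := le_trans (by positivity) (hM 0)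
  let E : ℤ → Lp ℂ 2 (@AddCircle.haarAddCircle (2 * Real.pi) _) := fun k => fourierLp 2 k
  have hE : Orthonormal ℂ E := orthonormal_fourier
  let Φ := ContinuousMap.toLp (E := ℂ) 2 (@AddCircle.haarAddCircle (2 * Real.pi) _) ℂ
  let g : C(AddCircle (2 * Real.pi), ℂ) := ∑ s ∈ S, (a s : ℂ) • fourier s
  have hsum : Summable fun k : ℤ => (h k : ℂ) • (fourier (-k) : C(AddCircle (2 * Real.pi), ℂ)) := by
    refine Summable.of_norm ?_
    simpa [norm_smul, fourier_norm] using hs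
  -- Multiplication by the transfer function is convolution on coefficients: the `j`-th Fourier
  -- coefficient of `F` is the inner sum on the left (`hinner`). Bessel's inequality and the
  -- pointwise bound `|F| ≤ √M |g|` then conclude.
  let F : C(AddCircle (2 * Real.pi), ℂ) := (∑' k : ℤ, (h k : ℂ) • fourier (-k)) * g
  have hpt : ∀ x, ‖F x‖ ≤ Real.sqrt M * ‖g x‖ := fun x => by
    simp only [F, ContinuousMap.mul_apply, norm_mul]
    gcongr
    refine Real.le_sqrt_of_sq_le ?_
    rw [← ContinuousMap.tsum_apply hsum]
    induction x using QuotientAddGroup.induction_on with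
    | H t =>
      refine le_trans (le_of_eq ?_) (hM t)
      congr 2
      refine tsum_congr fun k => ?_
      simp only [ContinuousMap.smul_apply, smul_eq_mul]
      congr 1
      rw [← Complex.exp_int_mul]
      refine (fourier_coe_apply (T := 2 * Real.pi) (n := -k) (x := t)).trans ?_
      congr 1
      have : (Real.pi : ℂ) ≠ 0 := by exact_mod_cast Real.pi_ne_zero
      push_cast
      field_simp
  have hΦE : ∀ k, Φ (fourier k) = E k := fun k => rfl
  have hnorm : ‖Φ F‖ ≤ Real.sqrt M * ‖Φ g‖ := by
    refine Lp.norm_le_mul_norm_of_ae_le_mul ?_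
    filter_upwards [ContinuousMap.coeFn_toLp (p := 2) (𝕜 := ℂ) AddCircle.haarAddCircle F,
      ContinuousMap.coeFn_toLp (p := 2) (𝕜 := ℂ) AddCircle.haarAddCircle g] with x h1 h2
    rw [h1, h2]
    exact hpt x
  have hg : ‖Φ g‖ ^ 2 = ∑ s ∈ S, a s ^ 2 := by
    have h1 : Φ g = ∑ s ∈ S, (a s : ℂ) • E s := by
      simp only [g, map_sum, map_smul, hΦE]
    have h2 : ((‖Φ g‖ ^ 2 : ℝ) : ℂ) = ((∑ s ∈ S, a s ^ 2 : ℝ) : ℂ) := by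
      have := inner_self_eq_norm_sq_to_K (𝕜 := ℂ) (Φ g)
      push_cast
      rw [← Complex.coe_algebraMap, ← this, h1, hE.inner_sum]
      simp [sq]
    exact_mod_cast h2
  have hF : HasSum (fun k : ℤ => (h k : ℂ) • ∑ s ∈ S, (a s : ℂ) • E (s - k)) (Φ F) := by
    have h1 := (hsum.hasSum.mul_right g).mapL Φ
    convert h1 using 2 with k
    rw [smul_mul_assoc, map_smul]
    congr 1
    simp only [g, Finset.mul_sum, map_sum]
    refine Finset.sum_congr rfl fun s _ => ?_
    rw [mul_smul_comm, map_smul, ← hΦE]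
    congr 2
    ext x
    rw [ContinuousMap.mul_apply, ← fourier_add]
    congr 1
    ring_nf
  have hinner : ∀ j, inner ℂ (E j) (Φ F) = ((∑ s ∈ S, a s * h (s - j) : ℝ) : ℂ) := fun j => by
    have h1 := hF.mapL (innerSL ℂ (E j))
    refine h1.unique ?_
    push_cast
    have h2 : ∀ s ∈ S, HasSum (fun k : ℤ => (h k : ℂ) * ((a s : ℂ) * if j = s - k then 1 else 0))
        (a s * h (s - j)) := fun s _ => by
      convert! hasSum_single (f := fun k : ℤ => (h k : ℂ) * ((a s : ℂ) * if j = s - k then 1 else 0))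
        (s - j) (fun k hk => ?_) using 1
      · simp [mul_comm]
      · rw [if_neg (by omega)]; simp
    convert! hasSum_sum h2 using 2 with k
    simp only [innerSL_apply_apply, inner_smul_right, inner_sum, orthonormal_iff_ite.1 hE,
      Finset.mul_sum]
  calc ∑ j ∈ J, (∑ s ∈ S, a s * h (s - j)) ^ 2 = ∑ j ∈ J, ‖inner ℂ (E j) (Φ F)‖ ^ 2 := by
        simp only [hinner, Complex.norm_real, Real.norm_eq_abs, sq_abs]
    _ ≤ ‖Φ F‖ ^ 2 := hE.sum_inner_products_le _
    _ ≤ (Real.sqrt M * ‖Φ g‖) ^ 2 := by gcongr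
    _ = M * ∑ s ∈ S, a s ^ 2 := by rw [mul_pow, Real.sq_sqrt hM0, hg]

theorem sum_sq_impulse_conv_le {n : ℕ} {θ : EuclideanSpace ℝ (Fin n)} (hθ : IsSchur θ)
    (S J : Finset ℤ) (a : ℤ → ℝ) :
    ∑ j ∈ J, (∑ s ∈ S, a s * impulse θ (s - j)) ^ 2 ≤ MPhi θ * ∑ s ∈ S, a s ^ 2 :=
  sum_sq_conv_le (summable_abs_impulse hθ) (norm_sq_tsum_impulse_le_MPhi hθ) S J a

end ARProcess

/-! ### Exponential moments of Gaussian quadratic forms. -/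

namespace ARProcess

theorem lintegral_exp_mul_sq_gaussianReal {c : ℝ} (hc : 2 * c < 1) :
    ∫⁻ x, ENNReal.ofReal (Real.exp (c * x ^ 2)) ∂(gaussianReal 0 1) =
      ENNReal.ofReal (Real.sqrt (1 - 2 * c))⁻¹ := by
  have hb : 0 < 1 / 2 - c := by linarith
  rw [gaussianReal_of_var_ne_zero _ one_ne_zero,
    lintegral_withDensity_eq_lintegral_mul _ (measurable_gaussianPDF 0 1) (by fun_prop)]
  have h1 : ∀ x : ℝ, (gaussianPDF 0 1 * fun x => ENNReal.ofReal (Real.exp (c * x ^ 2))) x =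
      ENNReal.ofReal ((Real.sqrt (2 * Real.pi))⁻¹ * Real.exp (-(1 / 2 - c) * x ^ 2)) := fun x => by
    simp only [Pi.mul_apply, gaussianPDF, gaussianPDFReal_def]
    rw [← ENNReal.ofReal_mul (by positivity), mul_assoc, ← Real.exp_add]
    simp only [NNReal.coe_one, mul_one, sub_zero]
    congr 3
    ring
  simp_rw [h1]
  rw [← ofReal_integral_eq_lintegral_ofReal
    ((integrable_exp_neg_mul_sq hb).const_mul _) (ae_of_all _ fun x => by positivity),
    integral_const_mul, integral_gaussian, ← Real.sqrt_inv, ← Real.sqrt_inv, ← Real.sqrt_mul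
    (by positivity)]
  congr 2
  have := Real.pi_pos
  have h2 : 1 - 2 * c ≠ 0 := by linarith
  field_simp

theorem lintegral_pi_prod {ι : Type*} [Fintype ι] (ν : Measure ℝ) [IsProbabilityMeasure ν]
    {f : ι → ℝ → ENNReal} (hf : ∀ i, Measurable (f i)) :
    ∫⁻ x, ∏ i, f i (x i) ∂(Measure.pi fun _ : ι => ν) = ∏ i, ∫⁻ x, f i x ∂ν := by
  have hind : iIndepFun (fun i (x : ι → ℝ) => f i (x i)) (Measure.pi fun _ : ι => ν) :=
    iIndepFun_pi fun i => (hf i).aemeasurable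
  have h := lintegral_prod_eq_prod_lintegral_of_indepFun Finset.univ _ hind
    (fun i => (hf i).comp (measurable_pi_apply i))
  rw [h]
  refine Finset.prod_congr rfl fun i _ => ?_
  exact (measurePreserving_eval (fun _ : ι => ν) i).lintegral_comp (hf i)

/-- Moment generating function of a Gaussian quadratic form. -/
theorem lintegral_exp_quadratic {J : Type*} [Fintype J] [DecidableEq J] {P : Matrix J J ℝ}
    (hP : P.IsHermitian) {l : ℝ} (hl : ∀ j, 2 * (l * hP.eigenvalues j) < 1) :
    ∫⁻ x : J → ℝ, ENNReal.ofReal (Real.exp (l * (x ⬝ᵥ P.mulVec x)))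
        ∂(Measure.pi fun _ => gaussianReal 0 1) =
      ∏ j, ENNReal.ofReal (Real.sqrt (1 - 2 * (l * hP.eigenvalues j)))⁻¹ := by
  set b := hP.eigenvectorBasis
  set f : EuclideanSpace ℝ J → ENNReal := fun x =>
    ENNReal.ofReal (Real.exp (l * (x.ofLp ⬝ᵥ P.mulVec x.ofLp))) with hf
  have hfm : Measurable f := by
    simp only [hf, dotProduct, Matrix.mulVec]
    fun_prop
  have h1 : ∫⁻ x : J → ℝ, ENNReal.ofReal (Real.exp (l * (x ⬝ᵥ P.mulVec x)))
        ∂(Measure.pi fun _ => gaussianReal 0 1) = ∫⁻ x, f x ∂(stdGaussian (EuclideanSpace ℝ J)) := by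
    rw [← map_pi_eq_stdGaussian, lintegral_map hfm (by fun_prop)]
  have hquad : ∀ c : J → ℝ, f (∑ i, c i • b i) =
      ∏ j, ENNReal.ofReal (Real.exp (l * hP.eigenvalues j * c j ^ 2)) := fun c => by
    have h2 : P.mulVec (∑ i, c i • b i : EuclideanSpace ℝ J).ofLp =
        (∑ i, (c i * hP.eigenvalues i) • b i : EuclideanSpace ℝ J).ofLp := by
      simp only [WithLp.ofLp_sum, WithLp.ofLp_smul, Matrix.mulVec_sum, Matrix.mulVec_smul, b,
        hP.mulVec_eigenvectorBasis, smul_smul]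
    have h3 : (∑ i, c i • b i : EuclideanSpace ℝ J).ofLp ⬝ᵥ
        (∑ i, (c i * hP.eigenvalues i) • b i : EuclideanSpace ℝ J).ofLp =
        ∑ j, hP.eigenvalues j * c j ^ 2 := by
      have h4 := EuclideanSpace.inner_eq_star_dotProduct (𝕜 := ℝ)
        (∑ i, (c i * hP.eigenvalues i) • b i : EuclideanSpace ℝ J) (∑ i, c i • b i)
      rw [star_trivial] at h4
      rw [← h4, b.orthonormal.inner_sum]
      refine Finset.sum_congr rfl fun j _ => ?_
      simp; ring
    simp only [hf]
    rw [h2, h3, Finset.mul_sum, Real.exp_sum, ENNReal.ofReal_prod_of_nonneg fun _ _ => by positivity]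
    simp only [mul_assoc]
  -- By rotation invariance, the coordinates in the eigenbasis of `P` are again independent standard
  -- Gaussians.
  rw [h1, stdGaussian_eq_map_pi_orthonormalBasis b, lintegral_map hfm (by fun_prop)]
  simp_rw [hquad]
  rw [lintegral_pi_prod (gaussianReal 0 1)
    (f := fun j t => ENNReal.ofReal (Real.exp (l * hP.eigenvalues j * t ^ 2))) fun i => by fun_prop]
  exact Finset.prod_congr rfl fun j _ => lintegral_exp_mul_sq_gaussianReal (hl j)

theorem one_sub_sum_le_prod {ι : Type*} (s : Finset ι) {x : ι → ℝ} (h0 : ∀ i ∈ s, 0 ≤ x i)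
    (h1 : ∀ i ∈ s, x i ≤ 1) : 1 - ∑ i ∈ s, x i ≤ ∏ i ∈ s, (1 - x i) := by
  classical
  induction s using Finset.induction_on with
  | empty => simp
  | insert a s ha ih =>
    rw [Finset.sum_insert ha, Finset.prod_insert ha]
    have h2 := ih (fun i hi => h0 i (Finset.mem_insert_of_mem hi))
      fun i hi => h1 i (Finset.mem_insert_of_mem hi)
    have h3 := h0 a (Finset.mem_insert_self _ _)
    have h4 := h1 a (Finset.mem_insert_self _ _)
    have h5 : 0 ≤ ∑ i ∈ s, x i := Finset.sum_nonneg fun i hi => h0 i (Finset.mem_insert_of_mem hi)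
    nlinarith [mul_le_mul_of_nonneg_left h2 (sub_nonneg.2 h4), mul_nonneg h3 h5]

/-- This is `x ≤ sinh x` at `x = -log (1 - u)`. -/
theorem neg_log_one_sub_le {u : ℝ} (h0 : 0 ≤ u) (h1 : u < 1) :
    -Real.log (1 - u) ≤ u + u ^ 2 / (2 * (1 - u)) := by
  have h2 : 0 < 1 - u := by linarith
  have h3 : 0 ≤ -Real.log (1 - u) := by
    have := Real.log_nonpos h2.le (by linarith); linarith
  have h4 := Real.self_le_sinh_iff.2 h3
  rw [Real.sinh_eq, neg_neg, Real.exp_neg, Real.exp_log h2] at h4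
  refine h4.trans (le_of_eq ?_)
  field_simp
  ring

theorem inv_sqrt_one_sub_le_exp {u : ℝ} (h0 : 0 ≤ u) (h1 : u < 1) :
    (Real.sqrt (1 - u))⁻¹ ≤ Real.exp (u / 2 + u ^ 2 / (4 * (1 - u))) := by
  have h2 : 0 < 1 - u := by linarith
  rw [← Real.log_le_log_iff (by positivity) (Real.exp_pos _), Real.log_exp, Real.log_inv,
    Real.log_sqrt h2.le]
  have h3 := neg_log_one_sub_le h0 h1
  have h4 : u ^ 2 / (4 * (1 - u)) = u ^ 2 / (2 * (1 - u)) / 2 := by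
    field_simp; norm_num
  rw [h4]
  linarith

theorem inv_sqrt_one_add_le_exp {u : ℝ} (h0 : 0 ≤ u) :
    (Real.sqrt (1 + u))⁻¹ ≤ Real.exp (-(u / 2) + u ^ 2 / 4) := by
  have h2 : 0 < 1 + u := by linarith
  rw [← Real.log_le_log_iff (by positivity) (Real.exp_pos _), Real.log_exp, Real.log_inv,
    Real.log_sqrt h2.le]
  have h3 : u - u ^ 2 / 2 ≤ Real.log (1 + u) := by
    have := Real.le_log_one_add_of_nonneg h0
    refine le_trans ?_ this
    rw [le_div_iff₀ (by linarith)]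
    nlinarith [pow_nonneg h0 3]
  linarith

section rows
variable {ι J : Type*} [Fintype ι] [Fintype J]

theorem dotProduct_transpose_mul_mulVec (H : Matrix ι J ℝ) (x : J → ℝ) :
    x ⬝ᵥ (H.transpose * H).mulVec x = ∑ i, H.mulVec x i ^ 2 := by
  rw [← Matrix.mulVec_mulVec, Matrix.dotProduct_mulVec, Matrix.vecMul_transpose]
  simp [dotProduct, sq]

theorem isHermitian_gram {ι J : Type*} [Fintype ι] (H : Matrix ι J ℝ) :
    (H.transpose * H).IsHermitian := by
  simpa using Matrix.isHermitian_conjTranspose_mul_self H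

variable [DecidableEq J] (H : Matrix ι J ℝ)

theorem eigenvalues_gram_nonneg (j : J) : 0 ≤ (isHermitian_gram H).eigenvalues j := by
  have h : (H.transpose * H).PosSemidef := by
    simpa using Matrix.posSemidef_conjTranspose_mul_self H
  exact h.eigenvalues_nonneg j

theorem sum_eigenvalues_gram : ∑ j, (isHermitian_gram H).eigenvalues j = ∑ i, ∑ j, H i j ^ 2 := by
  have h := (isHermitian_gram H).trace_eq_sum_eigenvalues
  simp only [RCLike.ofReal_real_eq_id, id_eq] at h
  rw [← h, Finset.sum_comm]
  simp [Matrix.trace, Matrix.mul_apply, sq]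

theorem eigenvalues_gram_le {p : ℝ} (hp : ∀ x : J → ℝ, ∑ i, H.mulVec x i ^ 2 ≤ p * ∑ j, x j ^ 2)
    (j : J) : (isHermitian_gram H).eigenvalues j ≤ p := by
  set b := (isHermitian_gram H).eigenvectorBasis
  have h1 : (b j).ofLp ⬝ᵥ (b j).ofLp = 1 := by
    have h4 := EuclideanSpace.inner_eq_star_dotProduct (𝕜 := ℝ) (b j) (b j)
    rw [star_trivial] at h4
    rw [← h4, real_inner_self_eq_norm_sq, b.orthonormal.1 j, one_pow]
  have h2 := hp (b j).ofLp
  rw [← dotProduct_transpose_mul_mulVec, Matrix.IsHermitian.mulVec_eigenvectorBasis,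
    dotProduct_smul, h1] at h2
  have h3 : ∑ k, (b j).ofLp k ^ 2 = 1 := by
    rw [← h1]; simp [dotProduct, sq]
  rw [h3] at h2
  simpa using h2

/-- By Weierstrass' product inequality, `∏ (1 - 2lλ_j) ≥ 1 - 2l ∑ λ_j`, so the trace of `HᵀH` alone
controls the moment generating function. -/
theorem lintegral_exp_sum_sq_le_of_trace {τ l : ℝ} (hτ : ∑ i, ∑ j, H i j ^ 2 ≤ τ) (hl : 0 ≤ l)
    (h : 2 * (l * τ) < 1) :
    ∫⁻ x : J → ℝ, ENNReal.ofReal (Real.exp (l * ∑ i, H.mulVec x i ^ 2))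
        ∂(Measure.pi fun _ => gaussianReal 0 1) ≤ ENNReal.ofReal (Real.sqrt (1 - 2 * (l * τ)))⁻¹ := by
  have hP := isHermitian_gram H
  have hp0 := eigenvalues_gram_nonneg H
  have hsum : ∑ j, 2 * (l * hP.eigenvalues j) ≤ 2 * (l * τ) := by
    rw [← Finset.mul_sum, ← Finset.mul_sum, sum_eigenvalues_gram]
    gcongr
  have hu0 : ∀ j ∈ Finset.univ, 0 ≤ 2 * (l * hP.eigenvalues j) := fun j _ => by
    have := hp0 j; positivity
  have hu1 : ∀ j, 2 * (l * hP.eigenvalues j) < 1 := fun j =>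
    ((Finset.single_le_sum hu0 (Finset.mem_univ j)).trans hsum).trans_lt h
  simp_rw [← dotProduct_transpose_mul_mulVec]
  rw [lintegral_exp_quadratic hP hu1, ← ENNReal.ofReal_prod_of_nonneg fun _ _ => by positivity]
  refine ENNReal.ofReal_le_ofReal ?_
  rw [Finset.prod_inv_distrib, ← Real.sqrt_prod _ fun j _ => by linarith [hu1 j]]
  refine inv_anti₀ (Real.sqrt_pos.2 (by linarith)) (Real.sqrt_le_sqrt ?_)
  exact (sub_le_sub_left hsum 1).trans (one_sub_sum_le_prod _ hu0 fun j _ => (hu1 j).le)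

/-- Each eigenvalue `λ ≤ p` contributes the exponent `lλ + l²λ²/(1 - 2lλ)`. Replacing one factor `λ`
and the denominator by their values at `p` makes this linear in `λ`, so it sums to the trace. The
result is the sub-gamma form needed for sharp tails. -/
theorem lintegral_exp_sum_sq_le_of_norm {T p l : ℝ} (hT : ∑ i, ∑ j, H i j ^ 2 ≤ T)
    (hp : ∀ x : J → ℝ, ∑ i, H.mulVec x i ^ 2 ≤ p * ∑ j, x j ^ 2) (hp0 : 0 ≤ p) (hl : 0 ≤ l)
    (h : 2 * (l * p) < 1) :
    ∫⁻ x : J → ℝ, ENNReal.ofReal (Real.exp (l * ∑ i, H.mulVec x i ^ 2))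
        ∂(Measure.pi fun _ => gaussianReal 0 1) ≤
      ENNReal.ofReal (Real.exp (l * T + l ^ 2 * p * T / (1 - 2 * (l * p)))) := by
  have hP := isHermitian_gram H
  have he0 := eigenvalues_gram_nonneg H
  have he1 := eigenvalues_gram_le H hp
  have hu : ∀ j, 2 * (l * hP.eigenvalues j) ≤ 2 * (l * p) := fun j => by
    have := he1 j; gcongr
  have hu1 : ∀ j, 2 * (l * hP.eigenvalues j) < 1 := fun j => (hu j).trans_lt h
  have hq : 0 < 1 - 2 * (l * p) := by linarith
  simp_rw [← dotProduct_transpose_mul_mulVec]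
  rw [lintegral_exp_quadratic hP hu1, ← ENNReal.ofReal_prod_of_nonneg fun _ _ => by positivity]
  refine ENNReal.ofReal_le_ofReal ?_
  have hterm : ∀ j ∈ Finset.univ, (Real.sqrt (1 - 2 * (l * hP.eigenvalues j)))⁻¹ ≤
      Real.exp ((l + l ^ 2 * p / (1 - 2 * (l * p))) * hP.eigenvalues j) := fun j _ => by
    have h0 := he0 j
    refine (inv_sqrt_one_sub_le_exp (by positivity) (hu1 j)).trans (Real.exp_le_exp.2 ?_)
    have h5 : (2 * (l * hP.eigenvalues j)) ^ 2 / (4 * (1 - 2 * (l * hP.eigenvalues j))) ≤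
        l ^ 2 * p / (1 - 2 * (l * p)) * hP.eigenvalues j := by
      have h6 : (2 * (l * hP.eigenvalues j)) ^ 2 / (4 * (1 - 2 * (l * hP.eigenvalues j))) =
          l ^ 2 * hP.eigenvalues j * hP.eigenvalues j / (1 - 2 * (l * hP.eigenvalues j)) := by
        have := hu1 j
        field_simp
        ring
      rw [h6, div_mul_eq_mul_div]
      have h7 := hu j
      have h8 := he1 j
      gcongr
    linarith
  refine (Finset.prod_le_prod (fun _ _ => by positivity) hterm).trans ?_
  rw [← Real.exp_sum, ← Finset.mul_sum, sum_eigenvalues_gram, Real.exp_le_exp]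
  calc _ ≤ (l + l ^ 2 * p / (1 - 2 * (l * p))) * T := by gcongr
    _ = _ := by ring

end rows

theorem lintegral_exp_neg_sum_sq_le {J : Type*} [Fintype J] {l : ℝ} (hl : 0 ≤ l) :
    ∫⁻ x : J → ℝ, ENNReal.ofReal (Real.exp (-l * ∑ j, x j ^ 2))
        ∂(Measure.pi fun _ => gaussianReal 0 1) ≤
      ENNReal.ofReal (Real.exp ((-l + l ^ 2) * Fintype.card J)) := by
  have h1 : ∀ x : J → ℝ, ENNReal.ofReal (Real.exp (-l * ∑ j, x j ^ 2)) =
      ∏ j, ENNReal.ofReal (Real.exp (-l * x j ^ 2)) := fun x => by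
    rw [Finset.mul_sum, Real.exp_sum, ENNReal.ofReal_prod_of_nonneg fun _ _ => by positivity]
  simp_rw [h1]
  rw [lintegral_pi_prod (gaussianReal 0 1)
    (f := fun _ t => ENNReal.ofReal (Real.exp (-l * t ^ 2))) fun i => by fun_prop]
  simp_rw [lintegral_exp_mul_sq_gaussianReal (show 2 * -l < 1 by linarith)]
  rw [Finset.prod_const, ← ENNReal.ofReal_pow (by positivity), Finset.card_univ,
    mul_comm (-l + l ^ 2), Real.exp_nat_mul]
  gcongr
  have := inv_sqrt_one_add_le_exp (u := 2 * l) (by positivity)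
  refine le_trans (le_of_eq ?_) (this.trans (le_of_eq ?_))
  · congr 2; ring
  · congr 1; ring

end ARProcess

/-! ### The causal moving-average representation. -/

namespace ARProcess

theorem regressor_succ_eq {n : ℕ} (θ : EuclideanSpace ℝ (Fin n)) {y e : ℤ → ℝ} {t : ℤ}
    (h : y t = (∑ k : Fin n, regressor n y (t - 1) k * θ k) + e t) :
    regressor (n + 1) y t =
      (transition θ).mulVec (regressor (n + 1) y (t - 1)) + e t • input n := by
  funext k
  induction k using Fin.cases with
  | zero =>
    simp only [Pi.add_apply, Pi.smul_apply, transition_mulVec_zero, input, Pi.single_eq_same,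
      smul_eq_mul, mul_one]
    simp only [regressor, Fin.val_zero, Nat.cast_zero, sub_zero, Fin.val_castSucc] at h ⊢
    rw [h]
    congr 1
    exact Finset.sum_congr rfl fun k _ => mul_comm _ _
  | succ k =>
    simp only [Pi.add_apply, Pi.smul_apply, transition_mulVec_succ, input,
      Pi.single_eq_of_ne (Fin.succ_ne_zero k), smul_zero, add_zero]
    simp only [regressor, Fin.val_succ, Fin.val_castSucc]
    congr 1
    push_cast
    ring

theorem output_eq_sum {n : ℕ} (θ : EuclideanSpace ℝ (Fin n)) {y e : ℤ → ℝ}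
    (h : ∀ t, y t = (∑ k : Fin n, regressor n y (t - 1) k * θ k) + e t) (t : ℤ) (k : ℕ) :
    y t = (∑ j, (transition θ ^ k) 0 j * regressor (n + 1) y (t - k) j) +
      ∑ i ∈ Finset.range k, impulse θ i * e (t - i) := by
  have key : regressor (n + 1) y t = (transition θ ^ k).mulVec (regressor (n + 1) y (t - k)) +
      ∑ i ∈ Finset.range k, e (t - i) • (transition θ ^ i).mulVec (input n) := by
    induction k with
    | zero => simp
    | succ k ih =>
      rw [ih, regressor_succ_eq θ (h (t - k)), Matrix.mulVec_add, Matrix.mulVec_mulVec, ← pow_succ,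
        Matrix.mulVec_smul, Finset.sum_range_succ, add_assoc]
      push_cast
      rw [sub_sub]
      congr 1
      exact add_comm _ _
  have h0 := congrFun key 0
  simp only [Pi.add_apply, Finset.sum_apply, Pi.smul_apply, input, Matrix.mulVec_single_one,
    Matrix.col_apply, smul_eq_mul] at h0
  have h1 : regressor (n + 1) y t 0 = y t := by simp [regressor]
  rw [← h1, h0]
  congr 1
  exact Finset.sum_congr rfl fun i _ => by rw [impulse_natCast, mul_comm]

variable {Ω : Type*} [MeasurableSpace Ω] {μ : Measure Ω}

theorem IsStationary.measure_preimage {y : ℤ → Ω → ℝ} (hs : IsStationary μ y)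
    (hm : ∀ t, Measurable (y t)) (h : ℤ) {B : Set (ℤ → ℝ)} (hB : MeasurableSet B) :
    μ {ω | (fun t => y (t + h) ω) ∈ B} = μ {ω | (fun t => y t ω) ∈ B} := by
  have h1 := congrArg (fun ν => ν B) (hs h)
  rwa [Measure.map_apply (measurable_pi_lambda _ fun t => hm _) hB,
    Measure.map_apply (measurable_pi_lambda _ fun t => hm _) hB] at h1

/-- By stationarity the `k`-th combination has the same law as the one at time `0`, where the
regressor is fixed and the coefficients tend to `0`. Only convergence in measure survives the change
of time. -/
theorem tendsto_zero_of_stationary [IsProbabilityMeasure μ] {n : ℕ} {y : ℤ → Ω → ℝ}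
    (hs : IsStationary μ y) (hm : ∀ t, Measurable (y t)) {c : ℕ → Fin n → ℝ}
    (hc : ∀ j, Filter.Tendsto (fun k => c k j) Filter.atTop (nhds 0)) (s : ℕ → ℤ) :
    TendstoInMeasure μ (fun k ω => ∑ j, c k j * regressor n (fun t => y t ω) (s k) j)
      Filter.atTop (fun _ => 0) := by
  have h0 : TendstoInMeasure μ (fun k ω => ∑ j, c k j * regressor n (fun t => y t ω) 0 j)
      Filter.atTop (fun _ => 0) := by
    refine tendstoInMeasure_of_tendsto_ae (fun k => ?_) (ae_of_all _ fun ω => ?_)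
    · refine Measurable.aestronglyMeasurable ?_
      simp only [regressor]
      fun_prop
    · rw [show (0 : ℝ) = ∑ j : Fin n, 0 * regressor n (fun t => y t ω) 0 j by simp]
      exact tendsto_finsetSum _ fun j _ => (hc j).mul_const _
  intro η hη
  refine (h0 η hη).congr fun k => ?_
  have h1 := hs.measure_preimage hm (s k)
    (B := {x | η ≤ edist (∑ j, c k j * regressor n x 0 j) 0}) (by
      refine measurableSet_le measurable_const ?_
      simp only [regressor]
      fun_prop)
  simp only [Set.mem_ofPred_eq, regressor] at h1 ⊢
  rw [← h1]
  congr 1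
  ext ω
  simp [sub_eq_add_neg, add_comm]

/-- A series with absolutely summable coefficients and uniformly `L¹`-bounded terms converges
absolutely almost surely, to an integrable limit. -/
theorem ae_summable_mul {ι : Type*} [Countable ι] {c : ι → ℝ} (hc : Summable fun i => |c i|)
    {f : ι → Ω → ℝ} (hf : ∀ i, Measurable (f i)) {C : ENNReal} (hC : C ≠ ⊤)
    (hb : ∀ i, ∫⁻ ω, ‖f i ω‖ₑ ∂μ ≤ C) :
    (∀ᵐ ω ∂μ, Summable fun i => |c i * f i ω|) ∧
      Integrable (fun ω => ∑' i, |c i * f i ω|) μ := by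
  have h1 : ∫⁻ ω, ∑' i, ‖c i * f i ω‖ₑ ∂μ ≠ ⊤ := by
    rw [lintegral_tsum fun i => (by fun_prop)]
    simp_rw [enorm_mul]
    have h2 : ∀ i, ∫⁻ ω, ‖c i‖ₑ * ‖f i ω‖ₑ ∂μ ≤ ‖c i‖ₑ * C := fun i => by
      rw [lintegral_const_mul _ (by fun_prop)]
      gcongr
      exact hb i
    refine ne_top_of_le_ne_top ?_ (ENNReal.tsum_le_tsum h2)
    rw [ENNReal.tsum_mul_right]
    refine ENNReal.mul_ne_top ?_ hC
    simp only [enorm_eq_nnnorm]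
    rw [ENNReal.tsum_coe_ne_top_iff_summable, ← NNReal.summable_coe]
    simpa using hc
  have h3 : ∀ᵐ ω ∂μ, Summable fun i => |c i * f i ω| := by
    filter_upwards [ae_lt_top (by fun_prop) h1] with ω hω
    have h4 := hω.ne
    simp only [enorm_eq_nnnorm] at h4
    rw [ENNReal.tsum_coe_ne_top_iff_summable, ← NNReal.summable_coe] at h4
    simpa using h4
  refine ⟨h3, ?_⟩
  have h5 : AEMeasurable (fun ω => (∑' i, ‖c i * f i ω‖ₑ).toReal) μ := by fun_prop
  have h6 : (fun ω => (∑' i, ‖c i * f i ω‖ₑ).toReal) =ᵐ[μ] fun ω => ∑' i, |c i * f i ω| := by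
    filter_upwards [h3] with ω hω
    rw [ENNReal.tsum_toReal_eq fun i => enorm_ne_top]
    simp
  refine Integrable.congr ?_ h6
  exact integrable_toReal_of_lintegral_ne_top (by fun_prop) h1

variable {n : ℕ} {θ : EuclideanSpace ℝ (Fin n)} {σ : ℝ} {e y : ℤ → Ω → ℝ}

theorem IsStationaryAR.lintegral_comp_noise (hy : IsStationaryAR μ θ σ e y) (t : ℤ)
    {f : ℝ → ENNReal} (hf : Measurable f) :
    ∫⁻ ω, f (e t ω) ∂μ = ∫⁻ x, f x ∂(gaussianReal 0 (Real.toNNReal (σ ^ 2))) := by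
  rw [← hy.gaussian_noise t, lintegral_map hf (hy.measurable_noise t)]

theorem IsStationaryAR.indepFun_noise_past (hy : IsStationaryAR μ θ σ e y) (r : ℤ) :
    IndepFun (fun ω (j : Set.Iio r) => e j ω) (e r) μ := by
  have h1 := indep_iSup_of_disjoint (fun i => (hy.measurable_noise i).comap_le)
    hy.indep_noise (S := Set.Iio r) (T := {r}) (by simp)
  refine indep_of_indep_of_le_left (indep_of_indep_of_le_right h1 ?_) ?_
  · simp
  · rw [MeasurableSpace.pi, MeasurableSpace.comap_iSup]
    refine iSup_le fun j => ?_
    rw [MeasurableSpace.comap_comp]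
    exact le_iSup₂_of_le (f := fun i (_ : i ∈ Set.Iio r) => MeasurableSpace.comap (e i) _)
      j.1 j.2 le_rfl

variable [IsProbabilityMeasure μ]

/-- A stationary autoregressive process is the causal moving average of its noise. -/
theorem IsStationaryAR.ae_hasSum (hy : IsStationaryAR μ θ σ e y) (hθ : IsSchur θ) (t : ℤ) :
    ∀ᵐ ω ∂μ, HasSum (fun j : ℤ => impulse θ (t - j) * e j ω) (y t ω) := by
  have hcs : Summable fun j : ℤ => |impulse θ (t - j)| :=
    (Equiv.subLeft t).summable_iff.2 (summable_abs_impulse hθ)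
  have hsum := (ae_summable_mul (μ := μ) hcs hy.measurable_noise
    (C := ∫⁻ x, ‖x‖ₑ ∂(gaussianReal 0 (Real.toNNReal (σ ^ 2))))
    (IsGaussian.integrable_id (μ := gaussianReal 0 _)).2.ne fun j =>
      (hy.lintegral_comp_noise j (f := fun x => ‖x‖ₑ) (by fun_prop)).le).1
  have hrec : ∀ᵐ ω ∂μ, ∀ t, y t ω =
      (∑ k : Fin n, regressor n (fun s => y s ω) (t - 1) k * θ k) + e t ω :=
    ae_all_iff.2 hy.recursion
  -- `R k` is the contribution of the state `k` steps back. It tends almost surely to `y_t` minus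
  -- the series, and in measure to `0`; uniqueness of limits in measure identifies the two.
  set R : ℕ → Ω → ℝ := fun k ω =>
    ∑ j, (transition θ ^ k) 0 j * regressor (n + 1) (fun s => y s ω) (t - k) j with hR
  have hRm : ∀ k, Measurable (R k) := fun k => by
    have := hy.measurable_output
    simp only [hR, regressor]
    fun_prop
  have hRlim : ∀ᵐ ω ∂μ, Filter.Tendsto (fun k => R k ω) Filter.atTop
      (nhds (y t ω - ∑' j : ℤ, impulse θ (t - j) * e j ω)) := by
    filter_upwards [hsum, hrec] with ω h1 h2
    have h3 : HasSum (fun j : ℤ => impulse θ j * e (t - j) ω)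
        (∑' j : ℤ, impulse θ (t - j) * e j ω) := by
      refine (Equiv.subLeft t).hasSum_iff.1 ?_
      simpa [Function.comp_def] using h1.of_abs.hasSum
    have h4 : HasSum (fun i : ℕ => impulse θ i * e (t - i) ω)
        (∑' j : ℤ, impulse θ (t - j) * e j ω) :=
      (Function.Injective.hasSum_iff (g := ((↑) : ℕ → ℤ)) Nat.cast_injective fun k hk => by
        rw [impulse_eq_zero_of_notMem_range θ k hk, zero_mul]).2 h3
    refine (h4.tendsto_sum_nat.const_sub (y t ω)).congr fun k => ?_
    simp only [hR]
    rw [sub_eq_iff_eq_add]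
    exact output_eq_sum θ h2 t k
  have hlim1 := tendstoInMeasure_of_tendsto_ae (fun k => (hRm k).aestronglyMeasurable) hRlim
  have hlim2 : TendstoInMeasure μ R Filter.atTop (fun _ => 0) :=
    tendsto_zero_of_stationary hy.stationary hy.measurable_output
      (fun j => (summable_abs_iff.1 (summable_transition_pow_apply hθ 0 j)).tendsto_atTop_zero) _
  filter_upwards [tendstoInMeasure_ae_unique hlim1 hlim2, hsum] with ω h1 h2
  rw [sub_eq_zero] at h1
  rw [h1]
  exact h2.of_abs.hasSum

theorem IsStationaryAR.ae_tendsto (hy : IsStationaryAR μ θ σ e y) (hθ : IsSchur θ) :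
    ∀ᵐ ω ∂μ, ∀ t, Filter.Tendsto (fun K : ℕ => ∑ j ∈ Finset.Icc (-K : ℤ) K,
      impulse θ (t - j) * e j ω) Filter.atTop (nhds (y t ω)) := by
  rw [ae_all_iff]
  intro t
  filter_upwards [hy.ae_hasSum hθ t] with ω hω
  exact hω.comp Finset.tendsto_Icc_neg

/-- The noise at time `r` is independent of noises and outputs before time `r`. -/
theorem IsStationaryAR.indepFun_past (hy : IsStationaryAR μ θ σ e y) (hθ : IsSchur θ) (r : ℤ) :
    IndepFun (fun ω (j : Set.Iio r) => (e j ω, y j ω)) (e r) μ := by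
  -- `limsup` is a measurable stand-in for the limit, defined at every point; it equals `y_t`
  -- wherever the partial sums converge to it.
  set G : (Set.Iio r → ℝ) → Set.Iio r → ℝ × ℝ := fun x t =>
    (x t, Filter.limsup (fun K : ℕ => ∑ j ∈ Finset.Icc (-K : ℤ) K,
      impulse θ (t - j) * if h : j < r then x ⟨j, h⟩ else 0) Filter.atTop) with hG
  have hGm : Measurable G := by
    refine measurable_pi_lambda _ fun t => (measurable_pi_apply t).prodMk
      (Measurable.limsup fun K => Finset.measurable_sum _ fun j _ => ?_)
    by_cases h : j < r
    · simp only [h, dite_true]; fun_prop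
    · simp only [h, dite_false]; fun_prop
  have h1 := (hy.indepFun_noise_past r).comp hGm measurable_id
  refine h1.congr ?_ (ae_of_all _ fun _ => rfl)
  filter_upwards [hy.ae_tendsto hθ] with ω hω
  funext t
  simp only [Function.comp_apply, hG, Prod.mk.injEq, true_and]
  refine Filter.Tendsto.limsup_eq ((hω t).congr fun K => Finset.sum_congr rfl fun j _ => ?_)
  by_cases h : j < r
  · simp [h]
  · have : (t : ℤ) < r := t.2
    -- Noises from time `r` on carry coefficient `0` by causality, so zeroing them in `G` is
    -- harmless.
    rw [impulse_of_neg θ (by omega)]; simp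

end ARProcess

/-! ### Second moments and exponential moments of the outputs and the noise. -/

namespace ARProcess

/-- Transposed form of `sum_sq_impulse_conv_le`, by duality: `‖Tx‖² = ⟨x, TᵀTx⟩ ≤ ‖x‖ √M ‖Tx‖`. -/
theorem sum_sq_conv_impulse_le {n : ℕ} {θ : EuclideanSpace ℝ (Fin n)} (hθ : IsSchur θ)
    (S J : Finset ℤ) (x : ℤ → ℝ) :
    ∑ s ∈ S, (∑ j ∈ J, impulse θ (s - j) * x j) ^ 2 ≤ MPhi θ * ∑ j ∈ J, x j ^ 2 := by
  set c : ℤ → ℝ := fun s => ∑ j ∈ J, impulse θ (s - j) * x j with hc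
  set Q := ∑ s ∈ S, c s ^ 2 with hQ
  have h1 : Q = ∑ j ∈ J, x j * ∑ s ∈ S, c s * impulse θ (s - j) := by
    have : ∀ s ∈ S, c s ^ 2 = ∑ j ∈ J, x j * (c s * impulse θ (s - j)) := fun s _ => by
      rw [sq]
      nth_rewrite 2 [hc]
      simp only [Finset.mul_sum]
      exact Finset.sum_congr rfl fun j _ => by ring
    rw [hQ, Finset.sum_congr rfl this, Finset.sum_comm]
    simp only [Finset.mul_sum]
  have h2 := Finset.sum_mul_sq_le_sq_mul_sq J x fun j => ∑ s ∈ S, c s * impulse θ (s - j)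
  rw [← h1] at h2
  have h3 := sum_sq_impulse_conv_le hθ S J c
  have hQ0 : 0 ≤ Q := Finset.sum_nonneg fun _ _ => sq_nonneg _
  have hx0 : 0 ≤ ∑ j ∈ J, x j ^ 2 := Finset.sum_nonneg fun _ _ => sq_nonneg _
  have hM0 : 0 ≤ MPhi θ := le_trans (by positivity) (norm_sq_tsum_impulse_le_MPhi hθ 0)
  rcases hQ0.eq_or_lt with h | h
  · rw [← h]; positivity
  · refine le_of_mul_le_mul_right ?_ h
    calc Q * Q = Q ^ 2 := (sq Q).symm
      _ ≤ (∑ j ∈ J, x j ^ 2) * (MPhi θ * Q) := h2.trans (by gcongr)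
      _ = _ := by ring

/-- The multiplier bound applied to a unit mass at `0` bounds every finite sum of squares. -/
theorem summable_impulse_sq {n : ℕ} {θ : EuclideanSpace ℝ (Fin n)} (hθ : IsSchur θ) :
    Summable fun k => impulse θ k ^ 2 := by
  refine summable_of_sum_le (c := MPhi θ) (fun _ => sq_nonneg _) fun J => ?_
  have h := sum_sq_impulse_conv_le hθ {0} (J.image Neg.neg) fun _ => 1
  simpa [Finset.sum_image] using h

theorem tsum_impulse_sq_le {n : ℕ} {θ : EuclideanSpace ℝ (Fin n)} (hθ : IsSchur θ) :
    ∑' k, impulse θ k ^ 2 ≤ MPhi θ := by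
  refine (summable_impulse_sq hθ).tsum_le_of_sum_le fun J => ?_
  have h := sum_sq_impulse_conv_le hθ {0} (J.image Neg.neg) fun _ => 1
  simpa [Finset.sum_image] using h

theorem one_le_tsum_impulse_sq {n : ℕ} {θ : EuclideanSpace ℝ (Fin n)} (hθ : IsSchur θ) :
    1 ≤ ∑' k, impulse θ k ^ 2 := by
  have h := (summable_impulse_sq hθ).le_tsum 0 fun _ _ => sq_nonneg _
  simpa [impulse_zero] using h

theorem sum_impulse_sub_sq_le {n : ℕ} {θ : EuclideanSpace ℝ (Fin n)} (hθ : IsSchur θ) (s : ℤ)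
    (J : Finset ℤ) : ∑ j ∈ J, impulse θ (s - j) ^ 2 ≤ ∑' k, impulse θ k ^ 2 := by
  rw [← (Equiv.subLeft s).tsum_eq fun k => impulse θ k ^ 2]
  exact ((Equiv.subLeft s).summable_iff.2 (summable_impulse_sq hθ)).sum_le_tsum J
    fun _ _ => sq_nonneg _

/-- Chernoff's bound. -/
theorem measure_lt_le_of_lintegral_exp {Ω : Type*} [MeasurableSpace Ω] {μ : Measure Ω} {Q : Ω → ℝ}
    (hQ : Measurable Q) {l c b : ℝ}
    (h : ∫⁻ ω, ENNReal.ofReal (Real.exp (l * Q ω)) ∂μ ≤ ENNReal.ofReal b) :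
    μ {ω | l * c ≤ l * Q ω} ≤ ENNReal.ofReal (b * Real.exp (-(l * c))) := by
  have h1 : {ω | l * c ≤ l * Q ω} ⊆
      {ω | ENNReal.ofReal (Real.exp (l * c)) ≤ ENNReal.ofReal (Real.exp (l * Q ω))} := fun ω hω =>
    ENNReal.ofReal_le_ofReal (Real.exp_le_exp.2 hω)
  have h2 := mul_meas_ge_le_lintegral (μ := μ)
    (f := fun ω => ENNReal.ofReal (Real.exp (l * Q ω))) (by fun_prop)
    (ENNReal.ofReal (Real.exp (l * c)))
  have h3 : 0 < Real.exp (l * c) := Real.exp_pos _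
  rw [mul_comm, ← ENNReal.le_div_iff_mul_le (by simp [h3]) (by simp)] at h2
  refine (measure_mono h1).trans (h2.trans ?_)
  rw [Real.exp_neg, ← div_eq_mul_inv, ENNReal.ofReal_div_of_pos h3]
  gcongr

variable {Ω : Type*} [MeasurableSpace Ω] {μ : Measure Ω}
  {n : ℕ} {θ : EuclideanSpace ℝ (Fin n)} {σ : ℝ} {e y : ℤ → Ω → ℝ}

theorem IsStationaryAR.memLp_noise (hy : IsStationaryAR μ θ σ e y) (t : ℤ) : MemLp (e t) 2 μ := by
  have h : MemLp id 2 (μ.map (e t)) := by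
    rw [hy.gaussian_noise]; exact memLp_id_gaussianReal 2
  exact (memLp_map_measure_iff (by fun_prop) (hy.measurable_noise t).aemeasurable).1 h

theorem IsStationaryAR.integral_noise (hy : IsStationaryAR μ θ σ e y) (t : ℤ) :
    ∫ ω, e t ω ∂μ = 0 := by
  have h := integral_map (μ := μ) (hy.measurable_noise t).aemeasurable (f := id)
    (by fun_prop)
  rw [hy.gaussian_noise] at h
  simpa using h.symm

theorem IsStationaryAR.variance_noise (hy : IsStationaryAR μ θ σ e y) (t : ℤ) :
    Var[e t; μ] = σ ^ 2 := by
  have h := variance_map (μ := μ) (Y := e t) (X := id) (by fun_prop)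
    (hy.measurable_noise t).aemeasurable
  rw [hy.gaussian_noise] at h
  simpa [sq_nonneg] using h.symm

variable [IsProbabilityMeasure μ]

theorem IsStationaryAR.map_noise (hy : IsStationaryAR μ θ σ e y) (J : Finset ℤ) :
    μ.map (fun ω (j : J) => e j ω) =
      (Measure.pi fun _ : J => gaussianReal 0 1).map fun x j => σ * x j := by
  have h1 := (iIndepFun_iff_map_fun_eq_pi_map (μ := μ) (f := fun (j : J) => e j)
    fun j => (hy.measurable_noise j).aemeasurable).1
    (hy.indep_noise.precomp Subtype.val_injective)
  rw [h1, Measure.pi_map_pi (f := fun _ x => σ * x) fun _ => by fun_prop]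
  congr 1
  funext j
  rw [hy.gaussian_noise, gaussianReal_map_const_mul]
  congr 1
  · simp
  · ext; simp [sq_nonneg]

theorem IsStationaryAR.lintegral_comp_noises (hy : IsStationaryAR μ θ σ e y) (J : Finset ℤ)
    {f : (J → ℝ) → ENNReal} (hf : Measurable f) :
    ∫⁻ ω, f (fun j => e j ω) ∂μ =
      ∫⁻ x, f (fun j => σ * x j) ∂(Measure.pi fun _ => gaussianReal 0 1) := by
  have hm : Measurable fun ω (j : J) => e j ω := measurable_pi_lambda _ fun j => hy.measurable_noise _
  rw [← lintegral_map hf hm, hy.map_noise, lintegral_map hf (by fun_prop)]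

theorem IsStationaryAR.integral_sum_noise_sq (hy : IsStationaryAR μ θ σ e y) (J : Finset ℤ)
    (c : ℤ → ℝ) : ∫ ω, (∑ j ∈ J, c j * e j ω) ^ 2 ∂μ = σ ^ 2 * ∑ j ∈ J, c j ^ 2 := by
  have hL : ∀ j, MemLp (fun ω => c j * e j ω) 2 μ := fun j => (hy.memLp_noise j).const_mul _
  have hind : Set.Pairwise (J : Set ℤ) fun i j =>
      IndepFun (fun ω => c i * e i ω) (fun ω => c j * e j ω) μ := fun i _ j _ hij =>
    (hy.indep_noise.indepFun hij).comp (measurable_const_mul (c i)) (measurable_const_mul (c j))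
  have h1 := IndepFun.variance_sum (fun j _ => hL j) hind
  have hmean : ∫ ω, ∑ j ∈ J, c j * e j ω ∂μ = 0 := by
    rw [integral_finsetSum _ fun j _ => (hL j).integrable (by norm_num)]
    simp [integral_const_mul, hy.integral_noise]
  have hfun : ∑ j ∈ J, (fun ω => c j * e j ω) = fun ω => ∑ j ∈ J, c j * e j ω := by
    ext ω; simp
  rw [hfun, variance_of_integral_eq_zero (by
    have := hy.measurable_noise
    fun_prop) hmean] at h1
  rw [h1, Finset.mul_sum]
  refine Finset.sum_congr rfl fun j _ => ?_
  rw [variance_const_mul, hy.variance_noise, mul_comm]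

theorem IsStationaryAR.integral_output_sq (hy : IsStationaryAR μ θ σ e y) (hθ : IsSchur θ)
    (t : ℤ) : ∫ ω, y t ω ^ 2 ∂μ = σ ^ 2 * ∑' k, impulse θ k ^ 2 := by
  have hcs : Summable fun j : ℤ => |impulse θ (t - j)| :=
    (Equiv.subLeft t).summable_iff.2 (summable_abs_impulse hθ)
  have hsq : ∫⁻ x, ‖x ^ 2‖ₑ ∂(gaussianReal 0 (Real.toNNReal (σ ^ 2))) ≠ ⊤ :=
    ((memLp_id_gaussianReal (μ := 0) (v := Real.toNNReal (σ ^ 2)) 2).integrable_sq).2.ne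
  obtain ⟨hs1, hs2⟩ := ae_summable_mul (μ := μ) hcs (f := fun j ω => e j ω ^ 2)
    (fun j => (hy.measurable_noise j).pow_const 2) hsq fun j =>
      (hy.lintegral_comp_noise j (f := fun x => ‖x ^ 2‖ₑ) (by fun_prop)).le
  have h1 : Filter.Tendsto (fun K : ℕ => ∫ ω, (∑ j ∈ Finset.Icc (-K : ℤ) K,
      impulse θ (t - j) * e j ω) ^ 2 ∂μ) Filter.atTop (nhds (∫ ω, y t ω ^ 2 ∂μ)) := by
    -- The dominating function is Cauchy-Schwarz with weights: `(∑ h_j e_j)² ≤ (∑ |h_j|) (∑ |h_j|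
    -- e_j²)`.
    refine tendsto_integral_of_dominated_convergence
      (fun ω => (∑' j, |impulse θ (t - j)|) * ∑' j, |impulse θ (t - j) * e j ω ^ 2|)
      (fun K => ?_) (hs2.const_mul _) (fun K => ?_) ?_
    · have := hy.measurable_noise
      exact Measurable.aestronglyMeasurable (by fun_prop)
    · filter_upwards [hs1] with ω hω
      rw [Real.norm_of_nonneg (sq_nonneg _)]
      refine (Finset.sum_sq_le_sum_mul_sum_of_sq_le_mul _ (f := fun j => |impulse θ (t - j)|)
        (g := fun j => |impulse θ (t - j) * e j ω ^ 2|) (fun _ _ => abs_nonneg _)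
        (fun _ _ => abs_nonneg _) fun j _ => ?_).trans ?_
      · rw [abs_mul, abs_of_nonneg (sq_nonneg (e j ω)), ← mul_assoc, abs_mul_abs_self]
        exact le_of_eq (by ring)
      · refine mul_le_mul (hcs.sum_le_tsum _ fun _ _ => abs_nonneg _)
          (hω.sum_le_tsum _ fun _ _ => abs_nonneg _) (Finset.sum_nonneg fun _ _ => abs_nonneg _)
          (tsum_nonneg fun _ => abs_nonneg _)
    · filter_upwards [hy.ae_tendsto hθ] with ω hω
      exact (hω t).pow 2
  simp_rw [hy.integral_sum_noise_sq] at h1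
  refine tendsto_nhds_unique h1 (Filter.Tendsto.const_mul _ ?_)
  rw [← (Equiv.subLeft t).tsum_eq fun k => impulse θ k ^ 2]
  exact ((Equiv.subLeft t).summable_iff.2 (summable_impulse_sq hθ)).hasSum.comp
    Finset.tendsto_Icc_neg

/-- Fatou's lemma reduces the outputs to moving averages over finite noise windows, where the law is
an explicit Gaussian; the bound must only be uniform in the window. -/
theorem IsStationaryAR.lintegral_exp_sum_output_sq_le_of_forall (hy : IsStationaryAR μ θ σ e y)
    (hθ : IsSchur θ) (S : Finset ℤ) (l : ℝ) {B : ENNReal}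
    (h : ∀ J : Finset ℤ, ∫⁻ x : J → ℝ, ENNReal.ofReal (Real.exp (l * ∑ s : S,
      (Matrix.of fun (s : S) (j : J) => σ * impulse θ (s - j)).mulVec x s ^ 2))
        ∂(Measure.pi fun _ => gaussianReal 0 1) ≤ B) :
    ∫⁻ ω, ENNReal.ofReal (Real.exp (l * ∑ s ∈ S, y s ω ^ 2)) ∂μ ≤ B := by
  set F : ℕ → Ω → ENNReal := fun K ω => ENNReal.ofReal (Real.exp (l * ∑ s ∈ S,
    (∑ j ∈ Finset.Icc (-K : ℤ) K, impulse θ (s - j) * e j ω) ^ 2)) with hF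
  have hFm : ∀ K, Measurable (F K) := fun K => by
    have := hy.measurable_noise
    simp only [hF]; fun_prop
  have hFB : ∀ K, ∫⁻ ω, F K ω ∂μ ≤ B := fun K => by
    refine le_trans (le_of_eq ?_) (h (Finset.Icc (-K : ℤ) K))
    have h1 := hy.lintegral_comp_noises (Finset.Icc (-K : ℤ) K)
      (f := fun x => ENNReal.ofReal (Real.exp (l * ∑ s ∈ S,
        (∑ j : Finset.Icc (-K : ℤ) K, impulse θ (s - j) * x j) ^ 2))) (by fun_prop)
    have h2 : ∀ ω s, ∑ j : Finset.Icc (-K : ℤ) K, impulse θ (s - j) * e j ω =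
        ∑ j ∈ Finset.Icc (-K : ℤ) K, impulse θ (s - j) * e j ω := fun ω s =>
      Finset.sum_coe_sort (Finset.Icc (-K : ℤ) K) fun j => impulse θ (s - j) * e j ω
    simp only [h2] at h1
    refine h1.trans (lintegral_congr fun x => ?_)
    congr 3
    rw [← Finset.sum_coe_sort]
    refine Finset.sum_congr rfl fun s _ => ?_
    simp only [Matrix.mulVec, dotProduct, Matrix.of_apply]
    congr 1
    exact Finset.sum_congr rfl fun j _ => by ring
  have hlim : ∀ᵐ ω ∂μ, Filter.Tendsto (fun K => F K ω) Filter.atTop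
      (nhds (ENNReal.ofReal (Real.exp (l * ∑ s ∈ S, y s ω ^ 2)))) := by
    filter_upwards [hy.ae_tendsto hθ] with ω hω
    refine ENNReal.tendsto_ofReal ((Real.continuous_exp.tendsto _).comp ?_)
    exact (tendsto_finsetSum _ fun s _ => (hω s).pow 2).const_mul l
  calc ∫⁻ ω, ENNReal.ofReal (Real.exp (l * ∑ s ∈ S, y s ω ^ 2)) ∂μ
      = ∫⁻ ω, Filter.liminf (fun K => F K ω) Filter.atTop ∂μ :=
        lintegral_congr_ae (hlim.mono fun ω hω => hω.liminf_eq.symm)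
    _ ≤ Filter.liminf (fun K => ∫⁻ ω, F K ω ∂μ) Filter.atTop := lintegral_liminf_le hFm
    _ ≤ B := by
        refine (Filter.liminf_le_liminf (Filter.Eventually.of_forall hFB)).trans ?_
        simp

/-- Trace input for the exponential moments: each row has squared length at most the output variance
`E y²`. -/
theorem sum_sq_impulse_matrix_le (hθ : IsSchur θ) (S J : Finset ℤ) :
    ∑ s : S, ∑ j : J, (Matrix.of fun (s : S) (j : J) => σ * impulse θ (s - j)) s j ^ 2 ≤
      S.card * (σ ^ 2 * ∑' k, impulse θ k ^ 2) := by
  refine (Finset.sum_le_card_nsmul _ _ (σ ^ 2 * ∑' k, impulse θ k ^ 2) fun s _ => ?_).trans ?_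
  · simp only [Matrix.of_apply, mul_pow]
    rw [← Finset.mul_sum, Finset.sum_coe_sort J fun j => impulse θ (s - j) ^ 2]
    gcongr
    exact sum_impulse_sub_sq_le hθ s J
  · simp

/-- Operator-norm input for the exponential moments, uniform in the window `J`. Extending `x` by
zero turns the matrix into a convolution. -/
theorem sum_sq_impulse_matrix_mulVec_le (hθ : IsSchur θ) (S J : Finset ℤ) (x : J → ℝ) :
    ∑ s : S, (Matrix.of fun (s : S) (j : J) => σ * impulse θ (s - j)).mulVec x s ^ 2 ≤
      σ ^ 2 * MPhi θ * ∑ j, x j ^ 2 := by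
  set x' : ℤ → ℝ := fun j => if h : j ∈ J then x ⟨j, h⟩ else 0 with hx'
  have h1 : ∀ j : J, x j = x' j := fun j => by simp [hx']
  have h2 := sum_sq_conv_impulse_le hθ S J x'
  rw [← Finset.sum_coe_sort S, ← Finset.sum_coe_sort J fun j => x' j ^ 2] at h2
  simp only [h1, Matrix.mulVec, dotProduct, Matrix.of_apply]
  have h3 : ∀ s : S, (∑ j : J, σ * impulse θ (s - j) * x' j) ^ 2 =
      σ ^ 2 * (∑ j ∈ J, impulse θ (s - j) * x' j) ^ 2 := fun s => by
    rw [← mul_pow, Finset.mul_sum, ← Finset.sum_coe_sort J]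
    simp only [mul_assoc]
  simp only [h3]
  rw [← Finset.mul_sum, mul_assoc]
  gcongr

theorem IsStationaryAR.lintegral_exp_sum_output_sq_le_of_trace (hy : IsStationaryAR μ θ σ e y)
    (hθ : IsSchur θ) (S : Finset ℤ) {l v : ℝ} (hv : v = ∫ ω, y 1 ω ^ 2 ∂μ) (hl : 0 ≤ l)
    (h : 2 * (l * (S.card * v)) < 1) :
    ∫⁻ ω, ENNReal.ofReal (Real.exp (l * ∑ s ∈ S, y s ω ^ 2)) ∂μ ≤
      ENNReal.ofReal (Real.sqrt (1 - 2 * (l * (S.card * v))))⁻¹ := by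
  rw [hy.integral_output_sq hθ] at hv
  refine hy.lintegral_exp_sum_output_sq_le_of_forall hθ S l fun J => ?_
  subst hv
  exact lintegral_exp_sum_sq_le_of_trace _ (sum_sq_impulse_matrix_le hθ S J) hl h

theorem IsStationaryAR.lintegral_exp_sum_output_sq_le_of_norm (hy : IsStationaryAR μ θ σ e y)
    (hθ : IsSchur θ) (S : Finset ℤ) {l v p : ℝ} (hv : v = ∫ ω, y 1 ω ^ 2 ∂μ)
    (hp : p = σ ^ 2 * MPhi θ) (hl : 0 ≤ l) (h : 2 * (l * p) < 1) :
    ∫⁻ ω, ENNReal.ofReal (Real.exp (l * ∑ s ∈ S, y s ω ^ 2)) ∂μ ≤ ENNReal.ofReal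
      (Real.exp (l * (S.card * v) + l ^ 2 * p * (S.card * v) / (1 - 2 * (l * p)))) := by
  rw [hy.integral_output_sq hθ] at hv
  refine hy.lintegral_exp_sum_output_sq_le_of_forall hθ S l fun J => ?_
  have hM0 : 0 ≤ MPhi θ := le_trans (by positivity) (norm_sq_tsum_impulse_le_MPhi hθ 0)
  subst hv hp
  exact lintegral_exp_sum_sq_le_of_norm _ (sum_sq_impulse_matrix_le hθ S J)
    (sum_sq_impulse_matrix_mulVec_le hθ S J) (by positivity) hl h

theorem IsStationaryAR.lintegral_exp_sum_noise_sq_le (hy : IsStationaryAR μ θ σ e y)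
    (T : Finset ℤ) {l : ℝ} (hl : 0 ≤ l) (h : 2 * (l * σ ^ 2) < 1) :
    ∫⁻ ω, ENNReal.ofReal (Real.exp (l * ∑ t ∈ T, e t ω ^ 2)) ∂μ ≤ ENNReal.ofReal
      (Real.exp (l * (T.card * σ ^ 2) + l ^ 2 * σ ^ 2 * (T.card * σ ^ 2) / (1 - 2 * (l * σ ^ 2)))) := by
  have h1 := hy.lintegral_comp_noises T
    (f := fun x => ENNReal.ofReal (Real.exp (l * ∑ j, x j ^ 2))) (by fun_prop)
  have hc : ∀ ω, ∑ j : T, e j ω ^ 2 = ∑ t ∈ T, e t ω ^ 2 := fun ω =>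
    Finset.sum_coe_sort T fun t => e t ω ^ 2
  simp only [hc] at h1
  rw [h1]
  have h2 : ∀ x : T → ℝ, ∀ j, (σ • (1 : Matrix T T ℝ)).mulVec x j = σ * x j := fun x j => by
    simp [Matrix.smul_mulVec]
  have h3 := lintegral_exp_sum_sq_le_of_norm (σ • (1 : Matrix T T ℝ)) (T := T.card * σ ^ 2)
    (p := σ ^ 2) (l := l) (by simp [Matrix.one_apply]) (fun x => by
      simp only [h2, mul_pow, ← Finset.mul_sum]; rfl) (sq_nonneg σ) hl h
  simpa only [h2] using h3

theorem IsStationaryAR.lintegral_exp_neg_sum_noise_sq_le (hy : IsStationaryAR μ θ σ e y)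
    (T : Finset ℤ) {l : ℝ} (hl : 0 ≤ l) :
    ∫⁻ ω, ENNReal.ofReal (Real.exp (-l * ∑ t ∈ T, e t ω ^ 2)) ∂μ ≤ ENNReal.ofReal
      (Real.exp ((-(l * σ ^ 2) + (l * σ ^ 2) ^ 2) * T.card)) := by
  have h1 := hy.lintegral_comp_noises T
    (f := fun x => ENNReal.ofReal (Real.exp (-l * ∑ j, x j ^ 2))) (by fun_prop)
  have hc : ∀ ω, ∑ j : T, e j ω ^ 2 = ∑ t ∈ T, e t ω ^ 2 := fun ω =>
    Finset.sum_coe_sort T fun t => e t ω ^ 2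
  simp only [hc] at h1
  rw [h1]
  have h3 := lintegral_exp_neg_sum_sq_le (J := T) (l := l * σ ^ 2) (by positivity)
  rw [Fintype.card_coe] at h3
  refine le_trans (le_of_eq ?_) h3
  refine lintegral_congr fun x => ?_
  simp only [mul_pow, ← Finset.mul_sum]
  congr 2
  ring

end ARProcess

/-! ### Tail bounds for output energies and noise energies. -/

namespace ARProcess

variable {Ω : Type*} [MeasurableSpace Ω] {μ : Measure Ω}
  {n : ℕ} {θ : EuclideanSpace ℝ (Fin n)} {σ : ℝ} {e y : ℤ → Ω → ℝ}

/-- Upper tail of a variable with the moment generating function of a Gaussian quadratic form. -/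
theorem measure_subgamma_tail_le {Q : Ω → ℝ} (hQ : Measurable Q) {p T x : ℝ} (hp : 0 < p)
    (hT : 0 < T) (hx : 0 < x)
    (h : ∀ l : ℝ, 0 ≤ l → 2 * (l * p) < 1 →
      ∫⁻ ω, ENNReal.ofReal (Real.exp (l * Q ω)) ∂μ ≤
        ENNReal.ofReal (Real.exp (l * T + l ^ 2 * p * T / (1 - 2 * (l * p))))) :
    μ {ω | T + 2 * Real.sqrt (p * T * x) + 2 * p * x < Q ω} ≤ ENNReal.ofReal (Real.exp (-x)) := by
  set a := Real.sqrt (p * T) with ha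
  set r := Real.sqrt x with hr
  have ha0 : 0 < a := Real.sqrt_pos.2 (by positivity)
  have hr0 : 0 < r := Real.sqrt_pos.2 hx
  have ha2 : p * T = a ^ 2 := (Real.sq_sqrt (by positivity)).symm
  have hr2 : x = r ^ 2 := (Real.sq_sqrt hx.le).symm
  have har : Real.sqrt (p * T * x) = a * r := by rw [Real.sqrt_mul (by positivity)]
  -- The minimiser of the Chernoff exponent. It gives `1 - 2lp = a/(a + 2pr)`, and the exponent
  -- collapses to `-r² = -x`.
  set l := r / (a + 2 * p * r) with hl
  have hd : 0 < a + 2 * p * r := by positivity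
  have hl0 : 0 < l := by positivity
  have hq : 1 - 2 * (l * p) = a / (a + 2 * p * r) := by
    rw [hl]; field_simp; ring
  have hlp : 2 * (l * p) < 1 := by
    have : 0 < 1 - 2 * (l * p) := by rw [hq]; positivity
    linarith
  have h1 := measure_lt_le_of_lintegral_exp hQ (c := T + 2 * Real.sqrt (p * T * x) + 2 * p * x)
    (h l hl0.le hlp)
  refine (measure_mono fun ω (hω : _ < Q ω) => ?_).trans (h1.trans (le_of_eq ?_))
  · exact mul_le_mul_of_nonneg_left hω.le hl0.le
  · rw [← Real.exp_add]
    congr 2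
    have h3 : l ^ 2 * p * T / (1 - 2 * (l * p)) = l * (a * r) := by
      rw [hq, mul_assoc, ha2, hl]; field_simp
    rw [h3, har, hr2]
    have h4 : l * (a + 2 * p * r) = r := by rw [hl]; field_simp
    linear_combination (-r) * h4

variable [IsProbabilityMeasure μ]

theorem IsStationaryAR.integral_output_sq_pos (hy : IsStationaryAR μ θ σ e y) (hθ : IsSchur θ)
    (hσ : 0 < σ) : 0 < ∫ ω, y 1 ω ^ 2 ∂μ := by
  rw [hy.integral_output_sq hθ]
  have := one_le_tsum_impulse_sq hθ
  positivity

theorem IsStationaryAR.measure_sum_output_sq_le (hy : IsStationaryAR μ θ σ e y) (hθ : IsSchur θ)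
    (hσ : 0 < σ) {S : Finset ℤ} (hS : S.Nonempty) {v : ℝ} (hv : v = ∫ ω, y 1 ω ^ 2 ∂μ) (c : ℝ) :
    μ {ω | c < ∑ s ∈ S, y s ω ^ 2} ≤
      ENNReal.ofReal (Real.sqrt 2 * Real.exp (-(c / (4 * (S.card * v))))) := by
  have hv0 : 0 < v := hv ▸ hy.integral_output_sq_pos hθ hσ
  have hc0 : (0 : ℝ) < S.card := by exact_mod_cast hS.card_pos
  have hm : Measurable fun ω => ∑ s ∈ S, y s ω ^ 2 := by
    have := hy.measurable_output
    fun_prop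
  -- With this `l` the moment bound is `(1 - 1/2)^(-1/2)`, whence the factor `√2`.
  have hl : 2 * ((4 * (S.card * v))⁻¹ * (S.card * v)) = 1 / 2 := by field_simp; norm_num
  have h1 := hy.lintegral_exp_sum_output_sq_le_of_trace hθ S (l := (4 * (S.card * v))⁻¹) hv
    (by positivity) (by rw [hl]; norm_num)
  have h2 := measure_lt_le_of_lintegral_exp hm (c := c) h1
  refine (measure_mono fun ω (hω : c < _) => ?_).trans (h2.trans (le_of_eq ?_))
  · exact mul_le_mul_of_nonneg_left hω.le (by positivity)
  · rw [hl, show (1 : ℝ) - 1 / 2 = 2⁻¹ by norm_num, Real.sqrt_inv, inv_inv, div_eq_inv_mul]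

/-- Inverts the sub-gamma threshold: for `k` squared noises at level `x = ku²` the relative
deviation is `2u + 2u²`. Equating it to `ε/3` produces the square root in `delta`. -/
theorem noise_exponent_eq {k ε : ℝ} (hε : 0 ≤ ε) :
    ∃ u : ℝ, k / 2 * (1 + ε / 3 - Real.sqrt (1 + 2 * ε / 3)) = k * u ^ 2 ∧ ε / 3 = 2 * u + 2 * u ^ 2
      ∧ 0 ≤ u := by
  refine ⟨(Real.sqrt (1 + 2 * ε / 3) - 1) / 2, ?_, ?_, ?_⟩
  · have h := Real.sq_sqrt (show 0 ≤ 1 + 2 * ε / 3 by positivity)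
    linear_combination (-k / 4) * h
  · have h := Real.sq_sqrt (show 0 ≤ 1 + 2 * ε / 3 by positivity)
    linear_combination (-1 / 2) * h
  · have : 1 ≤ Real.sqrt (1 + 2 * ε / 3) := Real.one_le_sqrt.2 (by linarith [show 0 ≤ 2 * ε / 3 by positivity])
    linarith

theorem IsStationaryAR.measure_noise_upper_le (hy : IsStationaryAR μ θ σ e y) (hσ : 0 < σ)
    {T : Finset ℤ} (hT : T.Nonempty) {ε : ℝ} (hε : 0 < ε) :
    μ {ω | T.card * σ ^ 2 + T.card * σ ^ 2 * ε / 3 < ∑ t ∈ T, e t ω ^ 2} ≤ ENNReal.ofReal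
      (Real.exp (-((T.card : ℝ) / 2 * (1 + ε / 3 - Real.sqrt (1 + 2 * ε / 3))))) := by
  have hc0 : (0 : ℝ) < T.card := by exact_mod_cast hT.card_pos
  obtain ⟨u, hu1, hu2, hu0⟩ := noise_exponent_eq (k := T.card) hε.le
  have hu : 0 < u := by
    rcases hu0.eq_or_lt with h | h
    · rw [← h] at hu2; norm_num at hu2; linarith
    · exact h
  have hm : Measurable fun ω => ∑ t ∈ T, e t ω ^ 2 := by
    have := hy.measurable_noise
    fun_prop
  have h1 := measure_subgamma_tail_le (μ := μ) hm (p := σ ^ 2) (T := T.card * σ ^ 2)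
    (x := T.card * u ^ 2) (by positivity) (by positivity) (by positivity)
    fun l hl0 hl => hy.lintegral_exp_sum_noise_sq_le T hl0 hl
  have h2 : Real.sqrt (σ ^ 2 * (T.card * σ ^ 2) * (T.card * u ^ 2)) = T.card * σ ^ 2 * u := by
    rw [show σ ^ 2 * (T.card * σ ^ 2) * (T.card * u ^ 2) = (T.card * σ ^ 2 * u) ^ 2 by ring,
      Real.sqrt_sq (by positivity)]
  rw [hu1]
  refine (measure_mono fun ω (hω : _ < ∑ t ∈ T, e t ω ^ 2) => ?_).trans h1
  refine lt_of_le_of_lt (le_of_eq ?_) hω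
  rw [h2]
  linear_combination (-T.card * σ ^ 2) * hu2

theorem IsStationaryAR.measure_noise_lower_le (hy : IsStationaryAR μ θ σ e y) (hσ : 0 < σ)
    {T : Finset ℤ} (hT : T.Nonempty) {ε : ℝ} (hε : 0 < ε) :
    μ {ω | ∑ t ∈ T, e t ω ^ 2 < T.card * σ ^ 2 - T.card * σ ^ 2 * ε / 3} ≤ ENNReal.ofReal
      (Real.exp (-((T.card : ℝ) / 2 * (1 + ε / 3 - Real.sqrt (1 + 2 * ε / 3))))) := by
  have hc0 : (0 : ℝ) < T.card := by exact_mod_cast hT.card_pos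
  obtain ⟨u, hu1, hu2, hu0⟩ := noise_exponent_eq (k := T.card) hε.le
  have hm : Measurable fun ω => ∑ t ∈ T, e t ω ^ 2 := by
    have := hy.measurable_noise
    fun_prop
  -- `lσ² = ε/6` minimises `s² - sε/3`. The resulting rate `(ε/6)²` is at least the `u²` of the
  -- upper tail, so both tails share one bound.
  set l := ε / (6 * σ ^ 2) with hl
  have hl0 : 0 < l := by positivity
  have h1 := measure_lt_le_of_lintegral_exp (μ := μ) hm (l := -l)
    (c := T.card * σ ^ 2 - T.card * σ ^ 2 * ε / 3) (hy.lintegral_exp_neg_sum_noise_sq_le T hl0.le)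
  refine (measure_mono fun ω (hω : ∑ t ∈ T, e t ω ^ 2 < _) => ?_).trans (h1.trans ?_)
  · exact mul_le_mul_of_nonpos_left hω.le (by linarith)
  · rw [← Real.exp_add, hu1]
    refine ENNReal.ofReal_le_ofReal (Real.exp_le_exp.2 ?_)
    have hlσ : l * σ ^ 2 = ε / 6 := by rw [hl]; field_simp
    rw [show (-(l * σ ^ 2) + (l * σ ^ 2) ^ 2) * (T.card : ℝ) +
      -(-l * (T.card * σ ^ 2 - T.card * σ ^ 2 * ε / 3)) =
      (T.card : ℝ) * ((l * σ ^ 2) ^ 2 - l * σ ^ 2 * ε / 3) by ring, hlσ]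
    have h3 : u ≤ ε / 6 := by nlinarith
    have h4 : u ^ 2 ≤ (ε / 6) ^ 2 := by gcongr
    nlinarith

theorem MPhi_nonneg (hθ : IsSchur θ) : 0 ≤ MPhi θ :=
  le_trans (by positivity) (norm_sq_tsum_impulse_le_MPhi hθ 0)

/-- The sub-gamma tail at `x = ε√N` with `p = σ² MPhi`. Since `v ≤ p`, the deviation terms are at
most `2p√ε N^(3/4)` and `2pε N^(3/4)`; `betaTilde` is defined so that the threshold is exactly `Nv`
plus these. -/
theorem IsStationaryAR.measure_sum_output_sq_le_betaTilde (hy : IsStationaryAR μ θ σ e y)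
    (hθ : IsSchur θ) (hσ : 0 < σ) {v : ℝ} (hv : v = ∫ ω, y 1 ω ^ 2 ∂μ) {N : ℕ} (hN : n < N) {ε : ℝ}
    (hε : 0 < ε) {S : Finset ℤ} (hS : S.card = N) :
    μ {ω | ((N : ℝ) - n) * σ ^ 2 * ε * betaTilde θ σ v ε N / (n + 1) < ∑ s ∈ S, y s ω ^ 2} ≤
      ENNReal.ofReal (Real.exp (-(ε * Real.sqrt N))) := by
  have hv0 : 0 < v := hv ▸ hy.integral_output_sq_pos hθ hσ
  have hNn : (0 : ℝ) < (N : ℝ) - n := by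
    have : (n : ℝ) < N := by exact_mod_cast hN
    linarith
  have hN1 : (1 : ℝ) ≤ N := by exact_mod_cast (by omega : 1 ≤ N)
  have hN0 : (0 : ℝ) < N := by linarith
  set p := σ ^ 2 * MPhi θ with hp
  have hvp : v ≤ p := by
    rw [hv, hy.integral_output_sq hθ, hp]
    gcongr
    exact tsum_impulse_sq_le hθ
  have hp0 : 0 < p := hv0.trans_le hvp
  -- In terms of `b = N^(1/4)` and `g = √ε` all fractional powers become polynomial.
  set b := (N : ℝ) ^ (1 / 4 : ℝ) with hb
  have hb1 : 1 ≤ b := Real.one_le_rpow hN1 (by norm_num)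
  have hb4 : (N : ℝ) = b ^ 4 := by
    rw [hb, ← Real.rpow_natCast, ← Real.rpow_mul hN0.le]; norm_num
  have hb2 : Real.sqrt N = b ^ 2 := by
    rw [hb4, show b ^ 4 = (b ^ 2) ^ 2 by ring, Real.sqrt_sq (by positivity)]
  set g := Real.sqrt ε with hg
  have hg0 : 0 < g := Real.sqrt_pos.2 hε
  have hg2 : ε = g ^ 2 := (Real.sq_sqrt hε.le).symm
  have hεg : ε ^ (-(1 / 2) : ℝ) = g⁻¹ := by
    rw [Real.rpow_neg hε.le, ← Real.sqrt_eq_rpow]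
  have hm : Measurable fun ω => ∑ s ∈ S, y s ω ^ 2 := by
    have := hy.measurable_output
    fun_prop
  have h1 := measure_subgamma_tail_le (μ := μ) hm (p := p) (T := S.card * v)
    (x := ε * Real.sqrt N) hp0 (by rw [hS]; positivity) (by positivity)
    fun l hl0 hl => hy.lintegral_exp_sum_output_sq_le_of_norm hθ S hv hp hl0 hl
  refine (measure_mono fun ω (hω : _ < ∑ s ∈ S, y s ω ^ 2) => ?_).trans h1
  refine lt_of_le_of_lt ?_ hω
  have hK : ((N : ℝ) - n) * σ ^ 2 * ε * betaTilde θ σ v ε N / (n + 1) =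
      N * v + 2 * p * (g ^ 2 + g) * b ^ 3 := by
    rw [betaTilde, ← hb, hεg, hp]
    have hn1 : (n : ℝ) + 1 ≠ 0 := by positivity
    have hNn' := hNn.ne'
    have hb0 : b ≠ 0 := by positivity
    have : ((N : ℝ) - n) * σ ^ 2 * ε * (((n : ℝ) + 1) * N / ((N : ℝ) - n) *
        (v / (ε * σ ^ 2) + 2 * MPhi θ * (1 + g⁻¹) / b)) / (n + 1) =
        N * (v + 2 * σ ^ 2 * MPhi θ * (ε * (1 + g⁻¹)) / b) := by
      field_simp
    rw [this, hg2, mul_add, hb4]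
    field_simp
  rw [hK, hS]
  have h2 : Real.sqrt (p * (N * v) * (ε * Real.sqrt N)) ≤ p * g * b ^ 3 := by
    refine Real.sqrt_le_iff.2 ⟨by positivity, ?_⟩
    rw [hb2, hg2, hb4]
    calc p * (b ^ 4 * v) * (g ^ 2 * b ^ 2) ≤ p * (b ^ 4 * p) * (g ^ 2 * b ^ 2) := by gcongr
      _ = _ := by ring
  have h3 : p * (ε * Real.sqrt N) ≤ p * g ^ 2 * b ^ 3 := by
    rw [hb2, hg2, ← mul_assoc]
    exact mul_le_mul_of_nonneg_left (pow_le_pow_right₀ hb1 (by norm_num)) (by positivity)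
  nlinarith

end ARProcess

/-! ### Supermartingales built from the score and the information matrix. -/

namespace ARProcess

/-- The score `∑ e_t Y_{t-1}` of the least squares problem. -/
def score (n N : ℕ) (e y : ℤ → ℝ) : Fin n → ℝ :=
  ∑ t ∈ Finset.Icc (n + 1) N, e t • regressor n y ((t : ℤ) - 1)

/-- The information matrix `∑ Y_{t-1} Y_{t-1}ᵀ` of the least squares problem. -/
def information (n N : ℕ) (y : ℤ → ℝ) : Matrix (Fin n) (Fin n) ℝ :=
  ∑ t ∈ Finset.Icc (n + 1) N,
    Matrix.vecMulVec (regressor n y ((t : ℤ) - 1)) (regressor n y ((t : ℤ) - 1))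

theorem measurable_regressor (n : ℕ) (t : ℤ) : Measurable fun y : ℤ → ℝ => regressor n y t := by
  unfold regressor
  fun_prop

theorem measurable_score (n N : ℕ) :
    Measurable fun x : (ℤ → ℝ) × (ℤ → ℝ) => score n N x.1 x.2 := by
  unfold score regressor
  fun_prop

theorem measurable_information (n N : ℕ) :
    Measurable (β := Fin n → Fin n → ℝ) fun y : ℤ → ℝ => information n N y := by
  refine measurable_pi_lambda _ fun i => measurable_pi_lambda _ fun j => ?_
  simp only [information, Matrix.sum_apply, Matrix.vecMulVec_apply, regressor]
  fun_prop

/-- The sequence `x` restricted to indices below `r`. -/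
def truncateBelow (r : ℤ) (x : ℤ → ℝ) (j : ℤ) : ℝ := if j < r then x j else 0

theorem truncateBelow_of_lt {r j : ℤ} (h : j < r) (x : ℤ → ℝ) : truncateBelow r x j = x j :=
  if_pos h

theorem regressor_truncateBelow {n : ℕ} {r t : ℤ} (h : t < r) (y : ℤ → ℝ) :
    regressor n (truncateBelow r y) t = regressor n y t := by
  funext k
  exact truncateBelow_of_lt (by omega) y

theorem score_truncateBelow (n N : ℕ) (e y : ℤ → ℝ) :
    score n N (truncateBelow (N + 1) e) (truncateBelow (N + 1) y) = score n N e y := by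
  refine Finset.sum_congr rfl fun t ht => ?_
  have := (Finset.mem_Icc.1 ht).2
  rw [truncateBelow_of_lt (by omega), regressor_truncateBelow (by omega)]

theorem information_truncateBelow (n N : ℕ) (y : ℤ → ℝ) :
    information n N (truncateBelow (N + 1) y) = information n N y := by
  refine Finset.sum_congr rfl fun t ht => ?_
  have := (Finset.mem_Icc.1 ht).2
  rw [regressor_truncateBelow (by omega)]

theorem score_succ {n N : ℕ} (h : n ≤ N) (e y : ℤ → ℝ) :
    score n (N + 1) e y = score n N e y + e (N + 1) • regressor n y N := by
  rw [score, Finset.sum_Icc_succ_top (by omega)]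
  simp [score]

theorem information_succ {n N : ℕ} (h : n ≤ N) (y : ℤ → ℝ) :
    information n (N + 1) y =
      information n N y + Matrix.vecMulVec (regressor n y N) (regressor n y N) := by
  rw [information, Finset.sum_Icc_succ_top (by omega)]
  simp [information]

variable {Ω : Type*} [MeasurableSpace Ω] {μ : Measure Ω} [IsProbabilityMeasure μ]
  {n : ℕ} {θ : EuclideanSpace ℝ (Fin n)} {σ : ℝ} {e y : ℤ → Ω → ℝ}

/-- Adaptedness expressed without filtrations: a functional unchanged by truncation below `r` is a
function of the past, hence independent of `e r`. -/
theorem IsStationaryAR.indepFun_of_truncateBelow (hy : IsStationaryAR μ θ σ e y) (hθ : IsSchur θ)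
    (r : ℤ) {β : Type*} [MeasurableSpace β] {V : (ℤ → ℝ) × (ℤ → ℝ) → β} (hV : Measurable V)
    (hdep : ∀ a b, V (truncateBelow r a, truncateBelow r b) = V (a, b)) :
    IndepFun (fun ω => V (fun t => e t ω, fun t => y t ω)) (e r) μ := by
  set G : (Set.Iio r → ℝ × ℝ) → (ℤ → ℝ) × (ℤ → ℝ) := fun x =>
    (fun j => if h : j < r then (x ⟨j, h⟩).1 else 0,
      fun j => if h : j < r then (x ⟨j, h⟩).2 else 0) with hG
  have hGm : Measurable G := by
    refine (measurable_pi_lambda _ fun j => ?_).prodMk (measurable_pi_lambda _ fun j => ?_) <;>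
    · by_cases h : j < r
      · simp only [h, dite_true]; fun_prop
      · simp only [h, dite_false]; fun_prop
  have h1 := (hy.indepFun_past hθ r).comp (hV.comp hGm) measurable_id
  refine h1.congr (ae_of_all _ fun ω => ?_) (ae_of_all _ fun _ => rfl)
  simp only [Function.comp_apply]
  rw [← hdep (fun t => e t ω)]
  congr 1

theorem lintegral_comp_of_indepFun {β : Type*} [MeasurableSpace β] {V : Ω → β} {X : Ω → ℝ}
    (h : IndepFun V X μ) (hV : Measurable V) (hX : Measurable X) {ν : Measure ℝ} [SFinite ν]
    (hν : μ.map X = ν) {f : β × ℝ → ENNReal} (hf : Measurable f) :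
    ∫⁻ ω, f (V ω, X ω) ∂μ = ∫⁻ ω, ∫⁻ x, f (V ω, x) ∂ν ∂μ := by
  have h1 := (indepFun_iff_map_prod_eq_prod_map_map hV.aemeasurable hX.aemeasurable).1 h
  rw [← lintegral_map (f := f) hf (hV.prodMk hX), h1, hν, lintegral_prod _ hf.aemeasurable,
    lintegral_map (f := fun b => ∫⁻ x, f (b, x) ∂ν) hf.lintegral_prod_right' hV]

/-- A functional of score and information that is a supermartingale in each single step has
expectation at most its initial value. -/
theorem IsStationaryAR.lintegral_score_information_le (hy : IsStationaryAR μ θ σ e y)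
    (hθ : IsSchur θ) {Φ : (Fin n → ℝ) × (Fin n → Fin n → ℝ) → ENNReal} (hΦ : Measurable Φ)
    (hstep : ∀ (S : Fin n → ℝ) (V : Matrix (Fin n) (Fin n) ℝ) (u : Fin n → ℝ),
      ∫⁻ x, Φ (S + x • u, V + Matrix.vecMulVec u u) ∂(gaussianReal 0 (Real.toNNReal (σ ^ 2))) ≤
        Φ (S, V)) {N : ℕ} (hN : n ≤ N) :
    ∫⁻ ω, Φ (score n N (fun t => e t ω) (fun t => y t ω), information n N fun t => y t ω) ∂μ ≤
      Φ (0, (0 : Matrix (Fin n) (Fin n) ℝ)) := by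
  induction N, hN using Nat.le_induction with
  | base => simp [score, information]
  | succ N hN ih =>
    refine le_trans ?_ ih
    set V : (ℤ → ℝ) × (ℤ → ℝ) → (Fin n → ℝ) × (Fin n → Fin n → ℝ) × (Fin n → ℝ) := fun x =>
      (score n N x.1 x.2, information n N x.2, regressor n x.2 N) with hV
    have hVm : Measurable V := (measurable_score n N).prodMk
      (((measurable_information n N).comp measurable_snd).prodMk
        ((measurable_regressor n N).comp measurable_snd))
    have hem : Measurable fun ω => ((fun t => e t ω, fun t => y t ω) : (ℤ → ℝ) × (ℤ → ℝ)) :=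
      (measurable_pi_lambda _ hy.measurable_noise).prodMk
        (measurable_pi_lambda _ hy.measurable_output)
    have hind := hy.indepFun_of_truncateBelow hθ (N + 1) hVm fun a b => by
      simp only [hV, score_truncateBelow, information_truncateBelow,
        regressor_truncateBelow (show (N : ℤ) < N + 1 by omega)]
    set f : ((Fin n → ℝ) × (Fin n → Fin n → ℝ) × (Fin n → ℝ)) × ℝ → ENNReal := fun z =>
      Φ (z.1.1 + z.2 • z.1.2.2, fun i j => z.1.2.1 i j + z.1.2.2 i * z.1.2.2 j) with hf
    have hfm : Measurable f := by
      refine hΦ.comp (Measurable.prodMk (by fun_prop) ?_)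
      fun_prop
    have h1 := lintegral_comp_of_indepFun hind (hVm.comp hem) (hy.measurable_noise _)
      (hy.gaussian_noise _) hfm
    calc _ = ∫⁻ ω, f (V (fun t => e t ω, fun t => y t ω), e (N + 1) ω) ∂μ := by
          refine lintegral_congr fun ω => ?_
          rw [score_succ hN, information_succ hN]
          rfl
      _ ≤ _ := by
          rw [h1]
          exact lintegral_mono fun ω => hstep _ _ _

theorem lintegral_exp_mul_gaussianReal (σ t : ℝ) :
    ∫⁻ x, ENNReal.ofReal (Real.exp (t * x)) ∂(gaussianReal 0 (Real.toNNReal (σ ^ 2))) =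
      ENNReal.ofReal (Real.exp (σ ^ 2 * t ^ 2 / 2)) := by
  rw [← ofReal_integral_eq_lintegral_ofReal (integrable_exp_mul_gaussianReal t)
    (ae_of_all _ fun _ => by positivity)]
  have h := congrFun (mgf_id_gaussianReal (μ := 0) (v := Real.toNNReal (σ ^ 2))) t
  simp only [mgf, id_eq] at h
  rw [h]
  simp [sq_nonneg]

/-- The exponential martingale of the score. -/
theorem IsStationaryAR.lintegral_exp_score_le (hy : IsStationaryAR μ θ σ e y) (hθ : IsSchur θ)
    (hσ : 0 < σ) {N : ℕ} (hN : n ≤ N) (a : Fin n → ℝ) :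
    ∫⁻ ω, ENNReal.ofReal (Real.exp ((a ⬝ᵥ score n N (fun t => e t ω) fun t => y t ω) / σ -
      (a ⬝ᵥ (information n N fun t => y t ω).mulVec a) / 2)) ∂μ ≤ 1 := by
  have h := hy.lintegral_score_information_le hθ (N := N) (Φ := fun z =>
    ENNReal.ofReal (Real.exp ((a ⬝ᵥ z.1) / σ -
      (a ⬝ᵥ (Matrix.of z.2).mulVec a) / 2))) (by
        simp only [dotProduct, Matrix.mulVec, Matrix.of_apply]
        fun_prop) (fun S V u => ?_) hN
  · refine h.trans (le_of_eq ?_)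
    have : (Matrix.of ((0 : Matrix (Fin n) (Fin n) ℝ) : Fin n → Fin n → ℝ)).mulVec a = 0 :=
      Matrix.zero_mulVec a
    simp [this]
  · have h1 : ∀ x : ℝ, ENNReal.ofReal (Real.exp ((a ⬝ᵥ (S + x • u)) / σ -
        (a ⬝ᵥ (V + Matrix.vecMulVec u u).mulVec a) / 2)) =
        ENNReal.ofReal (Real.exp ((a ⬝ᵥ S) / σ - (a ⬝ᵥ V.mulVec a) / 2 - (a ⬝ᵥ u) ^ 2 / 2)) *
        ENNReal.ofReal (Real.exp ((a ⬝ᵥ u) / σ * x)) := fun x => by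
      rw [← ENNReal.ofReal_mul (by positivity), ← Real.exp_add]
      congr 2
      rw [dotProduct_add, dotProduct_smul, Matrix.add_mulVec, dotProduct_add,
        Matrix.vecMulVec_mulVec, dotProduct_comm u a]
      simp only [smul_eq_mul, op_smul_eq_smul, dotProduct_smul]
      ring
    refine le_of_eq ((lintegral_congr h1).trans ?_)
    rw [lintegral_const_mul _ (by fun_prop), lintegral_exp_mul_gaussianReal,
      ← ENNReal.ofReal_mul (by positivity), ← Real.exp_add]
    congr 2
    field_simp
    change _ = a ⬝ᵥ S * 2 - σ * a ⬝ᵥ V.mulVec a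
    ring

/-- By convexity of the power on `[0, ∞)`: `p ± r` are the two mirror-image convex combinations of
`p + R` and `p - R`. -/
theorem add_pow_add_sub_pow_le {p r R : ℝ} (hr : |r| ≤ R) (hR : R ≤ p) (k : ℕ) :
    (p + r) ^ k + (p - r) ^ k ≤ (p + R) ^ k + (p - R) ^ k := by
  rcases (abs_nonneg r |>.trans hr).eq_or_lt with h | h
  · have : r = 0 := abs_nonpos_iff.1 (h ▸ hr)
    simp [this, ← h]
  obtain ⟨h1, h2⟩ := abs_le.1 hr
  have hc := convexOn_pow (𝕜 := ℝ) k
  have ha : 0 ≤ (R + r) / (2 * R) := div_nonneg (by linarith) (by linarith)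
  have hb : 0 ≤ (R - r) / (2 * R) := div_nonneg (by linarith) (by linarith)
  have hab : (R + r) / (2 * R) + (R - r) / (2 * R) = 1 := by field_simp; ring
  have m1 : p + R ∈ Set.Ici (0 : ℝ) := by simp; linarith
  have m2 : p - R ∈ Set.Ici (0 : ℝ) := by simp; linarith
  have e1 := hc.2 m1 m2 ha hb hab
  have e2 := hc.2 m1 m2 hb ha (by rw [add_comm]; exact hab)
  simp only [smul_eq_mul] at e1 e2
  have f1 : (R + r) / (2 * R) * (p + R) + (R - r) / (2 * R) * (p - R) = p + r := by
    field_simp; ring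
  have f2 : (R - r) / (2 * R) * (p + R) + (R + r) / (2 * R) * (p - R) = p - r := by
    field_simp; ring
  rw [f1] at e1
  rw [f2] at e2
  have := add_le_add e1 e2
  refine this.trans (le_of_eq ?_)
  linear_combination ((p + R) ^ k + (p - R) ^ k) * hab

/-- The Hilbert space form of `cosh (x + y) + cosh (x - y) = 2 cosh x cosh y`. -/
theorem cosh_norm_add_add_cosh_norm_sub_le {E : Type*} [NormedAddCommGroup E]
    [InnerProductSpace ℝ E] (a b : E) :
    Real.cosh ‖a + b‖ + Real.cosh ‖a - b‖ ≤ 2 * (Real.cosh ‖a‖ * Real.cosh ‖b‖) := by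
  have h1 : 2 * (Real.cosh ‖a‖ * Real.cosh ‖b‖) =
      Real.cosh (‖a‖ + ‖b‖) + Real.cosh (‖a‖ - ‖b‖) := by
    rw [Real.cosh_add, Real.cosh_sub]; ring
  rw [h1]
  -- Term by term in the power series of `cosh`: the squared norms are `p ± r` on the left and `p ±
  -- R` on the right, with `|r| ≤ R` by Cauchy-Schwarz.
  refine hasSum_le (fun k => ?_) ((Real.hasSum_cosh _).add (Real.hasSum_cosh _))
    ((Real.hasSum_cosh _).add (Real.hasSum_cosh _))
  rw [← add_div, ← add_div]
  refine div_le_div_of_nonneg_right ?_ (by positivity)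
  simp only [pow_mul]
  have h2 := add_pow_add_sub_pow_le (p := ‖a‖ ^ 2 + ‖b‖ ^ 2) (r := 2 * inner ℝ a b)
    (R := 2 * (‖a‖ * ‖b‖)) (by
      rw [abs_mul, abs_two]
      have := abs_real_inner_le_norm a b
      linarith) (by nlinarith [sq_nonneg (‖a‖ - ‖b‖)]) k
  rw [norm_add_sq_real, norm_sub_sq_real]
  refine le_trans (le_of_eq ?_) (h2.trans (le_of_eq ?_))
  · congr 2 <;> ring
  · congr 2 <;> ring

/-- The one-step supermartingale bound behind Pinelis' inequality. Averaging over `x` and `-x`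
brings in the `cosh` inequality and leaves the mean of `cosh (‖u‖x)`; no factor depends on the
dimension. -/
theorem lintegral_cosh_norm_add_smul_le {E : Type*} [NormedAddCommGroup E]
    [InnerProductSpace ℝ E] (a u : E) (σ : ℝ) :
    ∫⁻ x : ℝ, ENNReal.ofReal (Real.cosh ‖a + x • u‖)
        ∂(gaussianReal 0 (Real.toNNReal (σ ^ 2))) ≤
      ENNReal.ofReal (Real.cosh ‖a‖ * Real.exp (σ ^ 2 * ‖u‖ ^ 2 / 2)) := by
  set ν := gaussianReal 0 (Real.toNNReal (σ ^ 2)) with hν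
  have hsymm : ν.map (fun x => -x) = ν := by rw [hν, gaussianReal_map_neg, neg_zero]
  have hcont : Continuous fun x : ℝ => Real.cosh ‖a + x • u‖ :=
    Real.continuous_cosh.comp (by fun_prop)
  have hneg : ∫⁻ x : ℝ, ENNReal.ofReal (Real.cosh ‖a + x • u‖) ∂ν =
      ∫⁻ x : ℝ, ENNReal.ofReal (Real.cosh ‖a - x • u‖) ∂ν := by
    conv_lhs => rw [← hsymm]
    rw [lintegral_map hcont.measurable.ennreal_ofReal measurable_neg]
    simp [sub_eq_add_neg]
  have hsum : 2 * ∫⁻ x : ℝ, ENNReal.ofReal (Real.cosh ‖a + x • u‖) ∂ν ≤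
      2 * ENNReal.ofReal (Real.cosh ‖a‖ * Real.exp (σ ^ 2 * ‖u‖ ^ 2 / 2)) := by
    rw [two_mul]
    nth_rewrite 2 [hneg]
    rw [← lintegral_add_left hcont.measurable.ennreal_ofReal]
    have hb : ∀ x : ℝ, ENNReal.ofReal (Real.cosh ‖a + x • u‖) +
        ENNReal.ofReal (Real.cosh ‖a - x • u‖) ≤ ENNReal.ofReal (Real.cosh ‖a‖) *
          (ENNReal.ofReal (Real.exp (‖u‖ * x)) + ENNReal.ofReal (Real.exp (-‖u‖ * x))) := fun x => by
      have hc := fun t => (Real.cosh_pos t).le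
      rw [← ENNReal.ofReal_add (hc _) (hc _), ← ENNReal.ofReal_add (by positivity) (by positivity),
        ← ENNReal.ofReal_mul (hc _)]
      refine ENNReal.ofReal_le_ofReal ((cosh_norm_add_add_cosh_norm_sub_le a (x • u)).trans
        (le_of_eq ?_))
      have h3 : Real.cosh ‖x • u‖ = Real.cosh (‖u‖ * x) := by
        rw [norm_smul, Real.norm_eq_abs, ← Real.cosh_abs (‖u‖ * x), abs_mul, abs_norm, mul_comm]
      rw [h3, Real.cosh_eq (‖u‖ * x), neg_mul]
      ring
    refine (lintegral_mono hb).trans (le_of_eq ?_)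
    rw [lintegral_const_mul _ (by fun_prop), lintegral_add_left (by fun_prop), hν,
      lintegral_exp_mul_gaussianReal, lintegral_exp_mul_gaussianReal, neg_sq, ← two_mul,
      ENNReal.ofReal_mul (Real.cosh_pos _).le]
    ring
  exact (ENNReal.mul_le_mul_iff_right (by norm_num) (by norm_num)).1 hsum

/-- Pinelis' inequality for the score: it is large only if the regressors are. -/
theorem IsStationaryAR.measure_score_le (hy : IsStationaryAR μ θ σ e y) (hθ : IsSchur θ)
    (hσ : 0 < σ) {N : ℕ} (hN : n ≤ N) {q K : ℝ} (hq : 0 ≤ q) (hK : 0 < K) :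
    μ {ω | q < ‖WithLp.toLp 2 (score n N (fun t => e t ω) fun t => y t ω)‖ ∧
        (information n N fun t => y t ω).trace ≤ K} ≤
      ENNReal.ofReal (2 * Real.exp (-(q ^ 2 / (2 * σ ^ 2 * K)))) := by
  -- Maximises `lq - σ²l²K/2`, with value `q²/(2σ²K)`.
  set l := q / (σ ^ 2 * K) with hl
  have hl0 : 0 ≤ l := by positivity
  set F : (Fin n → ℝ) × (Fin n → Fin n → ℝ) → ENNReal := fun z =>
    ENNReal.ofReal (Real.cosh ‖l • WithLp.toLp 2 z.1‖) *
      ENNReal.ofReal (Real.exp (-(σ ^ 2 * l ^ 2 * (Matrix.of z.2).trace / 2))) with hF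
  have hFm : Measurable F := by
    have hcont : Continuous fun z : (Fin n → ℝ) × (Fin n → Fin n → ℝ) =>
        Real.cosh ‖l • WithLp.toLp 2 z.1‖ := Real.continuous_cosh.comp (by fun_prop)
    refine Measurable.mul hcont.measurable.ennreal_ofReal ?_
    · simp only [Matrix.trace, Matrix.diag_apply, Matrix.of_apply]
      fun_prop
  have h := hy.lintegral_score_information_le hθ hFm (fun S V u => ?_) hN
  · have h0 : F (0, (0 : Matrix (Fin n) (Fin n) ℝ)) = 1 := by
      have : (Matrix.of ((0 : Matrix (Fin n) (Fin n) ℝ) : Fin n → Fin n → ℝ)).trace = 0 :=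
        Matrix.trace_zero _ _
      simp [hF, this]
    rw [h0] at h
    set Z : Ω → ENNReal := fun ω =>
      F (score n N (fun t => e t ω) (fun t => y t ω), information n N fun t => y t ω) with hZ
    have hZm : Measurable Z := by
      have hem : Measurable fun ω => ((fun t => e t ω, fun t => y t ω) : (ℤ → ℝ) × (ℤ → ℝ)) :=
        (measurable_pi_lambda _ hy.measurable_noise).prodMk
          (measurable_pi_lambda _ hy.measurable_output)
      exact hFm.comp (((measurable_score n N).comp hem).prodMk
        (((measurable_information n N).comp measurable_snd).comp hem))
    -- The halving comes from `cosh x ≥ exp x / 2`, and it becomes the factor `2` in the bound.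
    set c := Real.exp (q ^ 2 / (2 * σ ^ 2 * K)) / 2 with hc
    have hc0 : 0 < c := by positivity
    have h2 := mul_meas_ge_le_lintegral (μ := μ) hZm (ENNReal.ofReal c)
    have h3 := h2.trans h
    rw [mul_comm, ← ENNReal.le_div_iff_mul_le (by simp [hc0]) (by simp)] at h3
    refine (measure_mono fun ω hω => ?_).trans (h3.trans (le_of_eq ?_))
    · change ENNReal.ofReal c ≤ _
      obtain ⟨hω1, hω2⟩ := hω
      simp only [hZ, hF]
      rw [← ENNReal.ofReal_mul (Real.cosh_pos _).le]
      refine ENNReal.ofReal_le_ofReal ?_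
      have h4 : Real.exp (l * q) / 2 ≤
          Real.cosh ‖l • WithLp.toLp 2 (score n N (fun t => e t ω) fun t => y t ω)‖ := by
        rw [norm_smul, Real.norm_of_nonneg hl0, Real.cosh_eq]
        have : Real.exp (l * q) ≤
            Real.exp (l * ‖WithLp.toLp 2 (score n N (fun t => e t ω) fun t => y t ω)‖) := by
          gcongr
        have := Real.exp_pos (-(l * ‖WithLp.toLp 2 (score n N (fun t => e t ω) fun t => y t ω)‖))
        linarith
      have h5 : Real.exp (-(σ ^ 2 * l ^ 2 * K / 2)) ≤ Real.exp (-(σ ^ 2 * l ^ 2 *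
          (information n N fun t => y t ω).trace / 2)) := by
        gcongr
      calc c = Real.exp (l * q) / 2 * Real.exp (-(σ ^ 2 * l ^ 2 * K / 2)) := by
            rw [hc, div_mul_eq_mul_div, ← Real.exp_add]
            congr 2
            rw [hl]
            field_simp
            ring
        _ ≤ _ := mul_le_mul h4 h5 (by positivity) (Real.cosh_pos _).le
    · rw [← ENNReal.ofReal_one, ← ENNReal.ofReal_div_of_pos hc0]
      congr 1
      rw [hc, Real.exp_neg]
      field_simp
  · have h1 : ∀ x : ℝ, F (S + x • u, V + Matrix.vecMulVec u u) =
        ENNReal.ofReal (Real.cosh ‖l • WithLp.toLp 2 S + x • l • WithLp.toLp 2 u‖) *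
          ENNReal.ofReal (Real.exp (-(σ ^ 2 * l ^ 2 * (V.trace + u ⬝ᵥ u) / 2))) := fun x => by
      have e1 : (Matrix.of (V + Matrix.vecMulVec u u : Fin n → Fin n → ℝ)).trace =
          V.trace + u ⬝ᵥ u := by
        rw [← Matrix.trace_vecMulVec, ← Matrix.trace_add]; rfl
      have e2 : l • WithLp.toLp 2 (S + x • u) =
          l • WithLp.toLp 2 S + x • l • WithLp.toLp 2 u := by
        rw [WithLp.toLp_add, WithLp.toLp_smul, smul_add, smul_comm]
      simp only [hF]
      rw [← e1, ← e2]
    have hcont : Continuous fun x : ℝ =>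
        Real.cosh ‖l • WithLp.toLp 2 S + x • l • WithLp.toLp 2 u‖ :=
      Real.continuous_cosh.comp (by fun_prop)
    rw [lintegral_congr h1, lintegral_mul_const _ hcont.measurable.ennreal_ofReal]
    refine (mul_le_mul_left (lintegral_cosh_norm_add_smul_le (l • WithLp.toLp 2 S)
      (l • WithLp.toLp 2 u) σ) _).trans (le_of_eq ?_)
    rw [ENNReal.ofReal_mul (Real.cosh_pos _).le, mul_assoc,
      ← ENNReal.ofReal_mul (Real.exp_pos _).le, ← Real.exp_add]
    have e3 : ‖l • (WithLp.toLp 2 u : EuclideanSpace ℝ (Fin n))‖ ^ 2 = l ^ 2 * (u ⬝ᵥ u) := by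
      rw [norm_smul, mul_pow, EuclideanSpace.real_norm_sq_eq]
      simp [dotProduct, sq]
    rw [e3]
    simp only [hF]
    congr 3
    change _ = -(σ ^ 2 * l ^ 2 * V.trace / 2)
    ring

end ARProcess

/-! ### The Lyapunov identity and the sandwich for the information matrix. -/

namespace ARProcess

section gramian
variable {n : ℕ} {θ : EuclideanSpace ℝ (Fin n)}

theorem summable_transition_pow_mul_apply (hθ : IsSchur θ) (a b c d : Fin (n + 1)) :
    Summable fun i => (transition θ ^ i) a b * (transition θ ^ i) c d := by
  obtain ⟨C, ρ, hC, h0, h1, hb⟩ := exists_abs_transition_pow_le hθ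
  have hρ : ρ * ρ < 1 := by nlinarith
  refine Summable.of_norm_bounded
    ((summable_geometric_of_lt_one (by positivity) hρ).mul_left (C * C)) fun i => ?_
  rw [norm_mul, mul_pow, show C * C * (ρ ^ i * ρ ^ i) = (C * ρ ^ i) * (C * ρ ^ i) by ring]
  exact mul_le_mul (hb i a b) (hb i c d) (abs_nonneg _) (by positivity)

theorem summable_transition_conj (hθ : IsSchur θ) (P : Matrix (Fin (n + 1)) (Fin (n + 1)) ℝ) :
    Summable fun i => transition θ ^ i * P * (transition θ).transpose ^ i := by
  refine Pi.summable.2 fun a => Pi.summable.2 fun b => ?_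
  have h : ∀ i, (transition θ ^ i * P * (transition θ).transpose ^ i) a b =
      ∑ d, ∑ c, (transition θ ^ i) a c * (transition θ ^ i) b d * P c d := fun i => by
    rw [← Matrix.transpose_pow]
    simp only [Matrix.mul_apply, Matrix.transpose_apply, Finset.sum_mul]
    exact Finset.sum_congr rfl fun d _ => Finset.sum_congr rfl fun c _ => by ring
  simp only [h]
  exact summable_sum fun d _ => summable_sum fun c _ =>
    (summable_transition_pow_mul_apply hθ a c b d).mul_right _

theorem hasSum_quadratic_conj (hθ : IsSchur θ) (P : Matrix (Fin (n + 1)) (Fin (n + 1)) ℝ)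
    (u : Fin (n + 1) → ℝ) :
    HasSum (fun i => ((transition θ).transpose ^ i).mulVec u ⬝ᵥ
        P.mulVec (((transition θ).transpose ^ i).mulVec u))
      (u ⬝ᵥ (∑' i, transition θ ^ i * P * (transition θ).transpose ^ i).mulVec u) := by
  let φ : Matrix (Fin (n + 1)) (Fin (n + 1)) ℝ →+ ℝ :=
    { toFun := fun M => u ⬝ᵥ M.mulVec u
      map_zero' := by simp
      map_add' := fun M M' => by rw [Matrix.add_mulVec, dotProduct_add] }
  have hφ : Continuous φ := by
    change Continuous fun M : Matrix (Fin (n + 1)) (Fin (n + 1)) ℝ => u ⬝ᵥ M.mulVec u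
    fun_prop
  have h := (summable_transition_conj hθ P).hasSum.map φ hφ
  convert! h using 2 with i
  change _ = u ⬝ᵥ (transition θ ^ i * P * (transition θ).transpose ^ i).mulVec u
  rw [← Matrix.mulVec_mulVec, ← Matrix.mulVec_mulVec, Matrix.dotProduct_mulVec u,
    ← Matrix.mulVec_transpose, Matrix.transpose_pow]

theorem hasSum_gramian (hθ : IsSchur θ) (u : Fin (n + 1) → ℝ) :
    HasSum (fun i => ((transition θ).transpose ^ i).mulVec u ⬝ᵥ
      ((transition θ).transpose ^ i).mulVec u) (u ⬝ᵥ (gramian θ).mulVec u) := by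
  simpa [gramian] using hasSum_quadratic_conj hθ 1 u

theorem hasSum_Vbar (hθ : IsSchur θ) (σ : ℝ) (u : Fin (n + 1) → ℝ) :
    HasSum (fun i => σ ^ 2 * ((transition θ).transpose ^ i).mulVec u 0 ^ 2)
      (u ⬝ᵥ (Vbar θ σ).mulVec u) := by
  rw [Vbar, Matrix.smul_mulVec, dotProduct_smul, smul_eq_mul]
  refine HasSum.mul_left _ ?_
  convert! hasSum_quadratic_conj hθ (Matrix.vecMulVec (input n) (input n)) u using 2 with i
  rw [Matrix.vecMulVec_mulVec]
  simp [input, sq]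

theorem tendsto_transpose_pow_mulVec (hθ : IsSchur θ) (u : Fin (n + 1) → ℝ) :
    Filter.Tendsto (fun i => ((transition θ).transpose ^ i).mulVec u) Filter.atTop (nhds 0) := by
  rw [tendsto_pi_nhds]
  intro a
  simp only [← Matrix.transpose_pow, Matrix.mulVec, dotProduct, Matrix.transpose_apply,
    Pi.zero_apply]
  rw [show (0 : ℝ) = ∑ b : Fin (n + 1), 0 * u b by simp]
  exact tendsto_finsetSum _ fun b _ =>
    (summable_abs_iff.1 (summable_transition_pow_apply hθ b a)).tendsto_atTop_zero.mul_const _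

end gramian

theorem dotProduct_sq_le {ι : Type*} [Fintype ι] (a b : ι → ℝ) :
    (a ⬝ᵥ b) ^ 2 ≤ (a ⬝ᵥ a) * (b ⬝ᵥ b) := by
  have h := Finset.sum_mul_sq_le_sq_mul_sq Finset.univ a b
  simpa [dotProduct, sq] using h

theorem norm_toLp_sq {ι : Type*} [Fintype ι] (a : ι → ℝ) : ‖WithLp.toLp 2 a‖ ^ 2 = a ⬝ᵥ a := by
  rw [EuclideanSpace.real_norm_sq_eq]
  simp [dotProduct, sq]

theorem abs_dotProduct_le {ι : Type*} [Fintype ι] (a b : ι → ℝ) :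
    |a ⬝ᵥ b| ≤ ‖WithLp.toLp 2 a‖ * ‖WithLp.toLp 2 b‖ := by
  refine abs_le_of_sq_le_sq ?_ (by positivity)
  rw [mul_pow, norm_toLp_sq, norm_toLp_sq]
  exact dotProduct_sq_le a b

section path
variable {n : ℕ} {θ : EuclideanSpace ℝ (Fin n)} {y e : ℤ → ℝ}

/-- The energy `∑ (u · X_{t-1})²` of the `(n+1)`-dimensional state in direction `u`. -/
def stateEnergy (n N : ℕ) (y : ℤ → ℝ) (u : Fin (n + 1) → ℝ) : ℝ :=
  ∑ t ∈ Finset.Icc (n + 1) N, (u ⬝ᵥ regressor (n + 1) y ((t : ℤ) - 1)) ^ 2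

/-- The defect of the energy in the discrete Lyapunov equation. -/
noncomputable def lyapunovDefect (θ : EuclideanSpace ℝ (Fin n)) (N : ℕ) (y e : ℤ → ℝ)
    (u : Fin (n + 1) → ℝ) : ℝ :=
  (u ⬝ᵥ regressor (n + 1) y n) ^ 2 - (u ⬝ᵥ regressor (n + 1) y N) ^ 2 +
    2 * u 0 * (u ⬝ᵥ Fin.cons (θ.ofLp ⬝ᵥ score n N e y) (score n N e y)) +
    u 0 ^ 2 * ∑ t ∈ Finset.Icc (n + 1) N, e t ^ 2

theorem transition_mulVec_regressor (θ : EuclideanSpace ℝ (Fin n)) (y : ℤ → ℝ) (t : ℤ) :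
    (transition θ).mulVec (regressor (n + 1) y t) =
      Fin.cons (θ.ofLp ⬝ᵥ regressor n y t) (regressor n y t) := by
  funext k
  induction k using Fin.cases with
  | zero => rw [transition_mulVec_zero]; simp [regressor, dotProduct]
  | succ k => rw [transition_mulVec_succ]; simp [regressor]

/-- Squares and sums `u·X_t = (Aᵀu)·X_{t-1} + u₀e_t`; shifting the time window leaves the two
boundary squares. The vector `Fin.cons (θ·S) S` is `∑ e_t A X_{t-1}`. -/
theorem stateEnergy_eq (h : ∀ t, y t = (∑ k : Fin n, regressor n y (t - 1) k * θ k) + e t) {N : ℕ}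
    (hN : n ≤ N) (u : Fin (n + 1) → ℝ) :
    stateEnergy n N y u =
      stateEnergy n N y ((transition θ).transpose.mulVec u) + lyapunovDefect θ N y e u := by
  induction N, hN using Nat.le_induction with
  | base =>
    have : (Fin.cons 0 0 : Fin (n + 1) → ℝ) = 0 := by
      funext k; induction k using Fin.cases <;> simp
    simp [stateEnergy, lyapunovDefect, score, this]
  | succ N hN ih =>
    have hsum : ∀ v, stateEnergy n (N + 1) y v =
        stateEnergy n N y v + (v ⬝ᵥ regressor (n + 1) y N) ^ 2 := fun v => by
      rw [stateEnergy, Finset.sum_Icc_succ_top (by omega)]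
      simp [stateEnergy]
    have hcons : ∀ (S w : Fin n → ℝ) (c : ℝ), (Fin.cons (θ.ofLp ⬝ᵥ (S + c • w)) (S + c • w) :
        Fin (n + 1) → ℝ) = Fin.cons (θ.ofLp ⬝ᵥ S) S + c • Fin.cons (θ.ofLp ⬝ᵥ w) w := by
      intro S w c
      funext k
      induction k using Fin.cases with
      | zero => simp [dotProduct_add]
      | succ k => simp
    have hA : (transition θ).transpose.mulVec u ⬝ᵥ regressor (n + 1) y N =
        u ⬝ᵥ Fin.cons (θ.ofLp ⬝ᵥ regressor n y N) (regressor n y N) := by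
      rw [← transition_mulVec_regressor, Matrix.mulVec_transpose, Matrix.dotProduct_mulVec]
    have hnext : u ⬝ᵥ regressor (n + 1) y ((N + 1 : ℕ) : ℤ) =
        u ⬝ᵥ Fin.cons (θ.ofLp ⬝ᵥ regressor n y N) (regressor n y N) + e (N + 1) * u 0 := by
      have h1 := regressor_succ_eq θ (h ((N + 1 : ℕ) : ℤ))
      rw [h1, show ((N + 1 : ℕ) : ℤ) - 1 = N by push_cast; ring, transition_mulVec_regressor,
        dotProduct_add, dotProduct_smul]
      simp [input]
    rw [hsum, hsum, ih, lyapunovDefect, lyapunovDefect, score_succ hN, hcons,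
      Finset.sum_Icc_succ_top (by omega), dotProduct_add, dotProduct_smul, hA, hnext]
    push_cast
    simp only [smul_eq_mul]
    ring

/-- Each error is at most `c|u|²`. The two boundary squares have opposite signs, so together they
cost one `c`; hence `3c` and not `4c`. -/
theorem abs_lyapunovDefect_sub_le {N : ℕ} {c V : ℝ}
    (hfirst : regressor (n + 1) y n ⬝ᵥ regressor (n + 1) y n ≤ c)
    (hlast : regressor (n + 1) y N ⬝ᵥ regressor (n + 1) y N ≤ c)
    (hnoise : |∑ t ∈ Finset.Icc (n + 1) N, e t ^ 2 - V| ≤ c)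
    (hscore : 2 * ((‖θ‖ + 1) * ‖WithLp.toLp 2 (score n N e y)‖) ≤ c) (u : Fin (n + 1) → ℝ) :
    |lyapunovDefect θ N y e u - V * u 0 ^ 2| ≤ 3 * c * (u ⬝ᵥ u) := by
  have hu0 : 0 ≤ u ⬝ᵥ u := by rw [← norm_toLp_sq]; positivity
  have hu00 : u 0 ^ 2 ≤ u ⬝ᵥ u := by
    have := Finset.single_le_sum (f := fun i => u i * u i) (fun i _ => mul_self_nonneg _)
      (Finset.mem_univ 0)
    simpa [dotProduct, sq] using this
  have h1 : (u ⬝ᵥ regressor (n + 1) y n) ^ 2 ≤ c * (u ⬝ᵥ u) :=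
    (dotProduct_sq_le _ _).trans (by rw [mul_comm]; gcongr)
  have h2 : (u ⬝ᵥ regressor (n + 1) y N) ^ 2 ≤ c * (u ⬝ᵥ u) :=
    (dotProduct_sq_le _ _).trans (by rw [mul_comm]; gcongr)
  have h3 : |u 0 ^ 2 * (∑ t ∈ Finset.Icc (n + 1) N, e t ^ 2 - V)| ≤ c * (u ⬝ᵥ u) := by
    rw [abs_mul, abs_of_nonneg (sq_nonneg (u 0)), mul_comm]
    exact mul_le_mul hnoise hu00 (sq_nonneg _) ((abs_nonneg _).trans hnoise)
  have h4 : |2 * u 0 * (u ⬝ᵥ Fin.cons (θ.ofLp ⬝ᵥ score n N e y) (score n N e y))| ≤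
      c * (u ⬝ᵥ u) := by
    set S := score n N e y
    set U := ‖WithLp.toLp 2 u‖
    have hU : U ^ 2 = u ⬝ᵥ u := norm_toLp_sq u
    have hU0 : |u 0| ≤ U := abs_le_of_sq_le_sq (by rw [hU]; exact hu00) (norm_nonneg _)
    have htail : ‖WithLp.toLp 2 (fun k : Fin n => u k.succ)‖ ≤ U := by
      refine le_of_sq_le_sq ?_ (norm_nonneg _)
      rw [hU, norm_toLp_sq]
      simp only [dotProduct, Fin.sum_univ_succ]
      linarith [mul_self_nonneg (u 0)]
    have hsplit : u ⬝ᵥ Fin.cons (θ.ofLp ⬝ᵥ S) S =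
        u 0 * (θ.ofLp ⬝ᵥ S) + (fun k : Fin n => u k.succ) ⬝ᵥ S := by
      simp [dotProduct, Fin.sum_univ_succ]
    have hg : |u ⬝ᵥ Fin.cons (θ.ofLp ⬝ᵥ S) S| ≤ U * ((‖θ‖ + 1) * ‖WithLp.toLp 2 S‖) := by
      rw [hsplit]
      refine (abs_add_le _ _).trans ?_
      rw [abs_mul]
      have e1 : |θ.ofLp ⬝ᵥ S| ≤ ‖θ‖ * ‖WithLp.toLp 2 S‖ := abs_dotProduct_le θ.ofLp S
      have e2 := abs_dotProduct_le (fun k : Fin n => u k.succ) S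
      calc _ ≤ U * (‖θ‖ * ‖WithLp.toLp 2 S‖) + U * ‖WithLp.toLp 2 S‖ := by
            refine add_le_add (mul_le_mul hU0 e1 (abs_nonneg _) (norm_nonneg _)) (e2.trans ?_)
            gcongr
        _ = _ := by ring
    rw [abs_mul, abs_mul, abs_two, ← hU]
    calc 2 * |u 0| * |u ⬝ᵥ Fin.cons (θ.ofLp ⬝ᵥ S) S|
        ≤ 2 * U * (U * ((‖θ‖ + 1) * ‖WithLp.toLp 2 S‖)) := by gcongr
      _ = 2 * ((‖θ‖ + 1) * ‖WithLp.toLp 2 S‖) * U ^ 2 := by ring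
      _ ≤ c * U ^ 2 := by gcongr
  have e0 := sq_nonneg (u ⬝ᵥ regressor (n + 1) y n)
  have e1 := sq_nonneg (u ⬝ᵥ regressor (n + 1) y N)
  have e3 := abs_le.1 h3
  have e4 := abs_le.1 h4
  rw [lyapunovDefect, abs_le]
  constructor <;> nlinarith

theorem stateEnergy_eq_add_sum
    (h : ∀ t, y t = (∑ k : Fin n, regressor n y (t - 1) k * θ k) + e t) {N : ℕ}
    (hN : n ≤ N) (u : Fin (n + 1) → ℝ) (k : ℕ) :
    stateEnergy n N y u = stateEnergy n N y (((transition θ).transpose ^ k).mulVec u) +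
      ∑ i ∈ Finset.range k, lyapunovDefect θ N y e (((transition θ).transpose ^ i).mulVec u) := by
  induction k with
  | zero => simp
  | succ k ih =>
    rw [ih, stateEnergy_eq h hN (((transition θ).transpose ^ k).mulVec u), Matrix.mulVec_mulVec,
      ← pow_succ', Finset.sum_range_succ]
    ring

/-- Iterating the identity leaves the energy in direction `(Aᵀ)ᵏu`, which vanishes in the limit by
stability. This holds path by path. -/
theorem tendsto_sum_lyapunovDefect (hθ : IsSchur θ)
    (h : ∀ t, y t = (∑ k : Fin n, regressor n y (t - 1) k * θ k) + e t) {N : ℕ}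
    (hN : n ≤ N) (u : Fin (n + 1) → ℝ) :
    Filter.Tendsto (fun k => ∑ i ∈ Finset.range k,
      lyapunovDefect θ N y e (((transition θ).transpose ^ i).mulVec u)) Filter.atTop
      (nhds (stateEnergy n N y u)) := by
  have hc : Continuous fun v => stateEnergy n N y v := by
    unfold stateEnergy; fun_prop
  have h1 := (hc.tendsto 0).comp (tendsto_transpose_pow_mulVec hθ u)
  have h2 := h1.const_sub (stateEnergy n N y u)
  have h0 : stateEnergy n N y 0 = 0 := by simp [stateEnergy]
  rw [h0, sub_zero] at h2
  refine h2.congr fun k => ?_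
  rw [Function.comp_apply, sub_eq_iff_eq_add, add_comm]
  exact stateEnergy_eq_add_sum h hN u k

/-- A vanishing last coordinate ignores the extra lag of the state. This is why `Vdn` and `Vup` are
leading blocks. -/
theorem stateEnergy_snoc_zero (N : ℕ) (y : ℤ → ℝ) (x : Fin n → ℝ) :
    stateEnergy n N y (Fin.snoc x 0 : Fin (n + 1) → ℝ) = x ⬝ᵥ (information n N y).mulVec x := by
  rw [information, Matrix.sum_mulVec, dotProduct_sum]
  refine Finset.sum_congr rfl fun t _ => ?_
  have h : (Fin.snoc x 0 : Fin (n + 1) → ℝ) ⬝ᵥ regressor (n + 1) y ((t : ℤ) - 1) =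
      x ⬝ᵥ regressor n y ((t : ℤ) - 1) := by
    simp [dotProduct, Fin.sum_univ_castSucc, regressor]
  rw [h, Matrix.vecMulVec_mulVec, op_smul_eq_smul, dotProduct_smul, smul_eq_mul,
    dotProduct_comm _ x, sq]

theorem dotProduct_topBlock_mulVec (M : Matrix (Fin (n + 1)) (Fin (n + 1)) ℝ) (x : Fin n → ℝ) :
    x ⬝ᵥ (topBlock M).mulVec x =
      (Fin.snoc x 0 : Fin (n + 1) → ℝ) ⬝ᵥ M.mulVec (Fin.snoc x 0 : Fin (n + 1) → ℝ) := by
  simp [dotProduct, Fin.sum_univ_castSucc, Matrix.mulVec, topBlock]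

theorem dotProduct_Vdn_mulVec (θ : EuclideanSpace ℝ (Fin n)) (σ ε : ℝ) (N : ℕ) (x : Fin n → ℝ) :
    x ⬝ᵥ (Vdn θ σ ε N).mulVec x =
      ((N : ℝ) - n) * ((Fin.snoc x 0 : Fin (n + 1) → ℝ) ⬝ᵥ (Vbar θ σ).mulVec (Fin.snoc x 0)) -
      ((N : ℝ) - n) * σ ^ 2 * ε *
        ((Fin.snoc x 0 : Fin (n + 1) → ℝ) ⬝ᵥ (gramian θ).mulVec (Fin.snoc x 0)) := by
  rw [Vdn, Matrix.smul_mulVec, dotProduct_smul, dotProduct_topBlock_mulVec, Matrix.sub_mulVec,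
    dotProduct_sub, Matrix.smul_mulVec, dotProduct_smul]
  simp only [smul_eq_mul]
  ring

theorem dotProduct_Vup_mulVec (θ : EuclideanSpace ℝ (Fin n)) (σ ε : ℝ) (N : ℕ) (x : Fin n → ℝ) :
    x ⬝ᵥ (Vup θ σ ε N).mulVec x =
      ((N : ℝ) - n) * ((Fin.snoc x 0 : Fin (n + 1) → ℝ) ⬝ᵥ (Vbar θ σ).mulVec (Fin.snoc x 0)) +
      ((N : ℝ) - n) * σ ^ 2 * ε *
        ((Fin.snoc x 0 : Fin (n + 1) → ℝ) ⬝ᵥ (gramian θ).mulVec (Fin.snoc x 0)) := by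
  rw [Vup, Matrix.smul_mulVec, dotProduct_smul, dotProduct_topBlock_mulVec, Matrix.add_mulVec,
    dotProduct_add, Matrix.smul_mulVec, dotProduct_smul]
  simp only [smul_eq_mul]
  ring

/-- The information matrix lies between `Vdn` and `Vup` on the good event. -/
theorem information_between (hθ : IsSchur θ)
    (h : ∀ t, y t = (∑ k : Fin n, regressor n y (t - 1) k * θ k) + e t) {N : ℕ} (hN : n < N)
    {σ ε c : ℝ} (hc : 3 * c = ((N : ℝ) - n) * σ ^ 2 * ε)
    (hfirst : regressor (n + 1) y n ⬝ᵥ regressor (n + 1) y n ≤ c)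
    (hlast : regressor (n + 1) y N ⬝ᵥ regressor (n + 1) y N ≤ c)
    (hnoise : |∑ t ∈ Finset.Icc (n + 1) N, e t ^ 2 - ((N : ℝ) - n) * σ ^ 2| ≤ c)
    (hscore : 2 * ((‖θ‖ + 1) * ‖WithLp.toLp 2 (score n N e y)‖) ≤ c) (x : Fin n → ℝ) :
    x ⬝ᵥ (Vdn θ σ ε N).mulVec x ≤ x ⬝ᵥ (information n N y).mulVec x ∧
      x ⬝ᵥ (information n N y).mulVec x ≤ x ⬝ᵥ (Vup θ σ ε N).mulVec x := by
  set u : Fin (n + 1) → ℝ := Fin.snoc x 0 with hu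
  have hd := abs_lyapunovDefect_sub_le hfirst hlast hnoise hscore
  have hlim := tendsto_sum_lyapunovDefect hθ h hN.le u
  have hV := ((hasSum_Vbar hθ σ u).mul_left ((N : ℝ) - n)).tendsto_sum_nat
  have hG := ((hasSum_gramian hθ u).mul_left (((N : ℝ) - n) * σ ^ 2 * ε)).tendsto_sum_nat
  rw [← stateEnergy_snoc_zero, dotProduct_Vdn_mulVec, dotProduct_Vup_mulVec]
  refine ⟨le_of_tendsto_of_tendsto' (hV.sub hG) hlim fun k => ?_,
    le_of_tendsto_of_tendsto' hlim (hV.add hG) fun k => ?_⟩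
  · rw [← Finset.sum_sub_distrib]
    refine Finset.sum_le_sum fun i _ => ?_
    have := (abs_le.1 (hd (((transition θ).transpose ^ i).mulVec u))).1
    rw [hc] at this
    linarith
  · rw [← Finset.sum_add_distrib]
    refine Finset.sum_le_sum fun i _ => ?_
    have := (abs_le.1 (hd (((transition θ).transpose ^ i).mulVec u))).2
    rw [hc] at this
    linarith

end path
end ARProcess

/-! ### Gaussian masses and the mixture of exponential martingales. -/

namespace ARProcess

section gaussian
variable {n : ℕ}

/-- The unnormalised Gaussian integral `∫ exp(-aᵀ W a / 2) da`. -/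
noncomputable def gaussianMass (W : Matrix (Fin n) (Fin n) ℝ) : ENNReal :=
  ∫⁻ a : Fin n → ℝ, ENNReal.ofReal (Real.exp (-(a ⬝ᵥ W.mulVec a) / 2))

theorem measurable_quadratic (W : Matrix (Fin n) (Fin n) ℝ) :
    Measurable fun a : Fin n → ℝ => a ⬝ᵥ W.mulVec a := by
  simp only [dotProduct, Matrix.mulVec]
  fun_prop

theorem gaussianMass_one_ne_top : gaussianMass (1 : Matrix (Fin n) (Fin n) ℝ) ≠ ⊤ := by
  have h : Integrable (fun a : Fin n → ℝ => ∏ i, Real.exp (-(1 / 2) * a i ^ 2)) :=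
    Integrable.fintype_prod (f := fun _ t => Real.exp (-(1 / 2) * t ^ 2))
      fun _ => integrable_exp_neg_mul_sq (by norm_num)
  refine ne_of_lt (lt_of_eq_of_lt (lintegral_congr fun a => ?_) h.lintegral_lt_top)
  rw [← Real.exp_sum, ← Finset.mul_sum, Matrix.one_mulVec]
  simp only [dotProduct, ← sq]
  congr 2
  ring

theorem gaussianMass_ne_zero (W : Matrix (Fin n) (Fin n) ℝ) : gaussianMass W ≠ 0 := by
  have hm := measurable_quadratic W
  rw [gaussianMass, ne_eq, lintegral_eq_zero_iff (by fun_prop)]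
  intro h
  obtain ⟨a, ha⟩ := h.exists
  simp only [Pi.zero_apply, ENNReal.ofReal_eq_zero] at ha
  exact absurd ha (not_le.2 (Real.exp_pos _))

/-- Linear change of variables by `C` with `W = CᵀC`. The mass of the identity stays unevaluated, as
only ratios are used. -/
theorem gaussianMass_eq {W : Matrix (Fin n) (Fin n) ℝ} (hW : W.PosDef) :
    gaussianMass W = ENNReal.ofReal (Real.sqrt W.det)⁻¹ *
      gaussianMass (1 : Matrix (Fin n) (Fin n) ℝ) := by
  obtain ⟨C, hC⟩ := CStarAlgebra.nonneg_iff_eq_star_mul_self.1 hW.posSemidef.nonneg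
  rw [Matrix.star_eq_conjTranspose, Matrix.conjTranspose_eq_transpose_of_trivial] at hC
  have hdet : W.det = C.det ^ 2 := by
    rw [hC, Matrix.det_mul, Matrix.det_transpose, sq]
  have hC0 : C.det ≠ 0 := by
    intro h
    have := hW.det_pos
    rw [hdet, h] at this
    simp at this
  have hm := measurable_quadratic (1 : Matrix (Fin n) (Fin n) ℝ)
  have h1 : ∀ a : Fin n → ℝ, a ⬝ᵥ W.mulVec a =
      Matrix.toLin' C a ⬝ᵥ (1 : Matrix (Fin n) (Fin n) ℝ).mulVec (Matrix.toLin' C a) := fun a => by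
    rw [hC, Matrix.one_mulVec, dotProduct_transpose_mul_mulVec, Matrix.toLin'_apply]
    simp [dotProduct, sq]
  have hf : Measurable fun a : Fin n → ℝ => ENNReal.ofReal
      (Real.exp (-(a ⬝ᵥ (1 : Matrix (Fin n) (Fin n) ℝ).mulVec a) / 2)) := by fun_prop
  have hlin : Measurable (Matrix.toLin' C) := (LinearMap.continuous_of_finiteDimensional _).measurable
  simp only [gaussianMass]
  simp_rw [h1]
  rw [← lintegral_map hf hlin, Real.map_matrix_volume_pi_eq_smul_volume_pi hC0,
    lintegral_smul_measure, hdet, Real.sqrt_sq_eq_abs, abs_inv]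
  rfl

theorem gaussianMass_anti {W W' : Matrix (Fin n) (Fin n) ℝ}
    (h : ∀ a : Fin n → ℝ, a ⬝ᵥ W.mulVec a ≤ a ⬝ᵥ W'.mulVec a) :
    gaussianMass W' ≤ gaussianMass W := by
  refine lintegral_mono fun a => ENNReal.ofReal_le_ofReal (Real.exp_le_exp.2 ?_)
  linarith [h a]

/-- Monotonicity of the determinant read off from the integrals: a larger form has a smaller
Gaussian mass. -/
theorem det_le_det_of_quadratic_le {W W' : Matrix (Fin n) (Fin n) ℝ} (hW : W.PosDef)
    (hW' : W'.PosDef) (h : ∀ a : Fin n → ℝ, a ⬝ᵥ W.mulVec a ≤ a ⬝ᵥ W'.mulVec a) :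
    W.det ≤ W'.det := by
  have h1 := gaussianMass_anti h
  rw [gaussianMass_eq hW, gaussianMass_eq hW', ENNReal.mul_le_mul_iff_left (gaussianMass_ne_zero 1)
    gaussianMass_one_ne_top, ENNReal.ofReal_le_ofReal_iff (by positivity),
    inv_le_inv₀ (Real.sqrt_pos.2 hW'.det_pos) (Real.sqrt_pos.2 hW.det_pos)] at h1
  exact (Real.sqrt_le_sqrt_iff hW'.det_pos.le).1 h1

/-- A Gaussian integral with linear term is at least the value of its exponent at any point, times
the integral without linear term. -/
theorem exp_mul_gaussianMass_le {W : Matrix (Fin n) (Fin n) ℝ} (hW : W.IsSymm) (b a₀ : Fin n → ℝ) :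
    ENNReal.ofReal (Real.exp (a₀ ⬝ᵥ b - (a₀ ⬝ᵥ W.mulVec a₀) / 2)) * gaussianMass W ≤
      ∫⁻ a : Fin n → ℝ, ENNReal.ofReal (Real.exp (a ⬝ᵥ b - (a ⬝ᵥ W.mulVec a) / 2)) := by
  have hm := measurable_quadratic W
  have hd : ∀ c : Fin n → ℝ, Measurable fun a : Fin n → ℝ => a ⬝ᵥ c := fun c => by
    simp only [dotProduct]; fun_prop
  set c := b - W.mulVec a₀ with hc
  set F : (Fin n → ℝ) → ENNReal := fun a =>
    ENNReal.ofReal (Real.exp (a ⬝ᵥ c - (a ⬝ᵥ W.mulVec a) / 2)) with hF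
  have hFm : Measurable F := by
    have := hd c
    simp only [hF]; fun_prop
  -- Translating by `a₀` pulls out the value of the exponent there and leaves a linear term `a·c`,
  -- which is zero only if `a₀` is a critical point.
  have hshift : ∫⁻ a : Fin n → ℝ, ENNReal.ofReal (Real.exp (a ⬝ᵥ b - (a ⬝ᵥ W.mulVec a) / 2)) =
      ENNReal.ofReal (Real.exp (a₀ ⬝ᵥ b - (a₀ ⬝ᵥ W.mulVec a₀) / 2)) * ∫⁻ a, F a := by
    rw [← lintegral_add_right_eq_self _ a₀, ← lintegral_const_mul _ hFm]
    refine lintegral_congr fun a => ?_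
    simp only [hF]
    rw [← ENNReal.ofReal_mul (by positivity), ← Real.exp_add]
    congr 2
    have hs : a₀ ⬝ᵥ W.mulVec a = a ⬝ᵥ W.mulVec a₀ := by
      rw [Matrix.dotProduct_mulVec, ← Matrix.mulVec_transpose, hW.eq, dotProduct_comm]
    rw [hc, Matrix.mulVec_add, add_dotProduct, add_dotProduct, dotProduct_add, dotProduct_add,
      dotProduct_sub, hs]
    ring
  rw [hshift]
  gcongr
  -- Averaging over `a` and `-a` turns the leftover linear term into `cosh (a·c) ≥ 1`.
  have hsymm : ∫⁻ a, F a = ∫⁻ a, F (-a) := (lintegral_neg_eq_self F).symm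
  have h2 : 2 * gaussianMass W ≤ 2 * ∫⁻ a, F a := by
    rw [two_mul (∫⁻ a, F a)]
    nth_rewrite 2 [hsymm]
    rw [← lintegral_add_left hFm, gaussianMass, ← lintegral_const_mul _ (by fun_prop)]
    refine lintegral_mono fun a => ?_
    simp only [hF]
    rw [← ENNReal.ofReal_add (by positivity) (by positivity), ← ENNReal.ofReal_ofNat 2,
      ← ENNReal.ofReal_mul (by norm_num)]
    refine ENNReal.ofReal_le_ofReal ?_
    rw [neg_dotProduct, Matrix.mulVec_neg, dotProduct_neg, neg_dotProduct, neg_neg, sub_eq_add_neg,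
      Real.exp_add, sub_eq_add_neg (-(a ⬝ᵥ c)), Real.exp_add, ← add_mul, neg_div]
    gcongr
    have := Real.one_le_cosh (a ⬝ᵥ c)
    rw [Real.cosh_eq] at this
    linarith
  exact (ENNReal.mul_le_mul_iff_right (by norm_num) (by norm_num)).1 h2

end gaussian

variable {Ω : Type*} [MeasurableSpace Ω] {μ : Measure Ω}
  {n : ℕ} {θ : EuclideanSpace ℝ (Fin n)} {σ : ℝ} {e y : ℤ → Ω → ℝ}

theorem isSymm_information (n N : ℕ) (y : ℤ → ℝ) : (information n N y).IsSymm := by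
  rw [Matrix.IsSymm, information, Matrix.transpose_sum]
  simp

/-- The Gaussian mixture of the exponential martingales of the score. -/
noncomputable def mixture (V : Matrix (Fin n) (Fin n) ℝ) (σ : ℝ) (N : ℕ) (e y : ℤ → ℝ) : ENNReal :=
  ∫⁻ a : Fin n → ℝ, ENNReal.ofReal (Real.exp (a ⬝ᵥ (σ⁻¹ • score n N e y) -
    (a ⬝ᵥ (information n N y + V).mulVec a) / 2))

theorem IsStationaryAR.measurable_mixture_integrand (hy : IsStationaryAR μ θ σ e y) (N : ℕ)
    (V : Matrix (Fin n) (Fin n) ℝ) :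
    Measurable (Function.uncurry fun (ω : Ω) (a : Fin n → ℝ) =>
      ENNReal.ofReal (Real.exp (a ⬝ᵥ (σ⁻¹ • score n N (fun t => e t ω) fun t => y t ω) -
      (a ⬝ᵥ (information n N (fun t => y t ω) + V).mulVec a) / 2))) := by
  have hem : Measurable fun ω => ((fun t => e t ω, fun t => y t ω) : (ℤ → ℝ) × (ℤ → ℝ)) :=
    (measurable_pi_lambda _ hy.measurable_noise).prodMk
      (measurable_pi_lambda _ hy.measurable_output)
  have hS : ∀ i, Measurable fun ω => score n N (fun t => e t ω) (fun t => y t ω) i := fun i =>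
    (measurable_pi_apply i).comp ((measurable_score n N).comp hem)
  have hI : ∀ i j, Measurable fun ω => information n N (fun t => y t ω) i j := fun i j =>
    (measurable_pi_apply j).comp ((measurable_pi_apply i).comp
      (((measurable_information n N).comp measurable_snd).comp hem))
  have hS' : ∀ i, Measurable fun p : Ω × (Fin n → ℝ) =>
      score n N (fun t => e t p.1) (fun t => y t p.1) i := fun i => (hS i).comp measurable_fst
  have hI' : ∀ i j, Measurable fun p : Ω × (Fin n → ℝ) =>
      information n N (fun t => y t p.1) i j := fun i j => (hI i j).comp measurable_fst
  simp only [Function.uncurry_def, dotProduct, Matrix.mulVec, Matrix.add_apply, Pi.smul_apply,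
    smul_eq_mul]
  fun_prop

variable [IsProbabilityMeasure μ]

theorem IsStationaryAR.lintegral_mixture_le (hy : IsStationaryAR μ θ σ e y) (hθ : IsSchur θ)
    (hσ : 0 < σ) {N : ℕ} (hN : n ≤ N) (V : Matrix (Fin n) (Fin n) ℝ) :
    ∫⁻ ω, mixture V σ N (fun t => e t ω) (fun t => y t ω) ∂μ ≤ gaussianMass V := by
  have hem : Measurable fun ω => ((fun t => e t ω, fun t => y t ω) : (ℤ → ℝ) × (ℤ → ℝ)) :=
    (measurable_pi_lambda _ hy.measurable_noise).prodMk
      (measurable_pi_lambda _ hy.measurable_output)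
  have hS : ∀ i, Measurable fun ω => score n N (fun t => e t ω) (fun t => y t ω) i := fun i =>
    (measurable_pi_apply i).comp ((measurable_score n N).comp hem)
  have hI : ∀ i j, Measurable fun ω => information n N (fun t => y t ω) i j := fun i j =>
    (measurable_pi_apply j).comp ((measurable_pi_apply i).comp
      (((measurable_information n N).comp measurable_snd).comp hem))
  have hm := hy.measurable_mixture_integrand N V
  simp only [mixture]
  rw [lintegral_lintegral_swap hm.aemeasurable]
  refine lintegral_mono fun a => ?_
  have h1 : ∀ ω, ENNReal.ofReal (Real.exp (a ⬝ᵥ (σ⁻¹ • score n N (fun t => e t ω) fun t => y t ω) -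
      (a ⬝ᵥ (information n N (fun t => y t ω) + V).mulVec a) / 2)) =
      ENNReal.ofReal (Real.exp (-(a ⬝ᵥ V.mulVec a) / 2)) *
      ENNReal.ofReal (Real.exp ((a ⬝ᵥ score n N (fun t => e t ω) fun t => y t ω) / σ -
      (a ⬝ᵥ (information n N fun t => y t ω).mulVec a) / 2)) := fun ω => by
    rw [← ENNReal.ofReal_mul (by positivity), ← Real.exp_add]
    congr 2
    rw [Matrix.add_mulVec, dotProduct_add, dotProduct_smul, smul_eq_mul]
    ring
  rw [lintegral_congr h1, lintegral_const_mul _ (by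
    simp only [dotProduct, Matrix.mulVec]; fun_prop)]
  exact mul_le_of_le_one_right' (hy.lintegral_exp_score_le hθ hσ hN a)

/-- Markov's inequality; the common mass of the identity cancels and the determinants remain. -/
theorem IsStationaryAR.measure_mixture_ge_le (hy : IsStationaryAR μ θ σ e y) (hθ : IsSchur θ)
    (hσ : 0 < σ) {N : ℕ} (hN : n ≤ N) {V U : Matrix (Fin n) (Fin n) ℝ} (hV : V.PosDef)
    (hU : U.PosDef) {r : ℝ} (hr : 0 < r) :
    μ {ω | ENNReal.ofReal r * gaussianMass U ≤
        mixture V σ N (fun t => e t ω) (fun t => y t ω)} ≤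
      ENNReal.ofReal (Real.sqrt U.det / Real.sqrt V.det / r) := by
  have hU0 : 0 < Real.sqrt U.det := Real.sqrt_pos.2 hU.det_pos
  have hV0 : 0 < Real.sqrt V.det := Real.sqrt_pos.2 hV.det_pos
  have hG0 := gaussianMass_ne_zero (1 : Matrix (Fin n) (Fin n) ℝ)
  have hG1 := gaussianMass_one_ne_top (n := n)
  have h1 := meas_ge_le_lintegral_div (μ := μ)
    (f := fun ω => mixture V σ N (fun t => e t ω) (fun t => y t ω))
    (ε := ENNReal.ofReal r * gaussianMass U) (hy.measurable_mixture_integrand N V).lintegral_prod_right'.aemeasurable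
    (mul_ne_zero (by simp [hr]) (gaussianMass_ne_zero U)) (by
      rw [gaussianMass_eq hU]
      exact ENNReal.mul_ne_top (by simp) (ENNReal.mul_ne_top (by simp) hG1))
  refine h1.trans ((ENNReal.div_le_div_right (hy.lintegral_mixture_le hθ hσ hN V) _).trans
    (le_of_eq ?_))
  rw [gaussianMass_eq hU, gaussianMass_eq hV, ← mul_assoc,
    ENNReal.mul_div_mul_right _ _ hG0 hG1, ← ENNReal.ofReal_mul hr.le,
    ← ENNReal.ofReal_div_of_pos (by positivity)]
  congr 1
  field_simp

end ARProcess

/-! ### Least squares, the threshold for the error, and the good event. -/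

namespace ARProcess

section deterministic
variable {n : ℕ} {θ : EuclideanSpace ℝ (Fin n)}

/-- Cauchy-Schwarz after writing `w·d = (wᵀR⁻¹)·(Rd)` with `R = V^(1/2)`. -/
theorem dotProduct_sq_le_weightNorm {V : Matrix (Fin n) (Fin n) ℝ} (hV : V.PosDef)
    (w : EuclideanSpace ℝ (Fin n)) (d : Fin n → ℝ) :
    (w.ofLp ⬝ᵥ d) ^ 2 ≤ weightNorm w V ^ 2 * (d ⬝ᵥ V.mulVec d) := by
  set R := CFC.sqrt V with hR
  have hRR : R * R = V := CFC.sqrt_mul_sqrt_self V hV.posSemidef.nonneg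
  have hRt : R.transpose = R := by
    have h : R.PosSemidef := Matrix.nonneg_iff_posSemidef.1 (CFC.sqrt_nonneg V)
    simpa using h.isHermitian.eq
  have hdet : IsUnit R.det := by
    refine isUnit_iff_ne_zero.2 fun h => ?_
    have := hV.det_pos
    rw [← hRR, Matrix.det_mul, h] at this
    simp at this
  have h1 : w.ofLp ⬝ᵥ d = Matrix.vecMul w.ofLp R⁻¹ ⬝ᵥ R.mulVec d := by
    rw [Matrix.dotProduct_mulVec, Matrix.vecMul_vecMul, Matrix.nonsing_inv_mul _ hdet,
      Matrix.vecMul_one]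
  have h2 : R.mulVec d ⬝ᵥ R.mulVec d = d ⬝ᵥ V.mulVec d := by
    rw [← hRR, ← Matrix.mulVec_mulVec, Matrix.dotProduct_mulVec d, ← Matrix.mulVec_transpose, hRt]
  rw [h1, ← h2, weightNorm, norm_toLp_sq]
  exact dotProduct_sq_le _ _

theorem isSymm_tsum_conj (θ : EuclideanSpace ℝ (Fin n))
    {P : Matrix (Fin (n + 1)) (Fin (n + 1)) ℝ} (hP : P.IsSymm) :
    (∑' i, transition θ ^ i * P * (transition θ).transpose ^ i).IsSymm := by
  rw [Matrix.IsSymm, Matrix.transpose_tsum]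
  refine tsum_congr fun i => ?_
  rw [Matrix.transpose_mul, Matrix.transpose_mul, hP.eq, Matrix.transpose_pow,
    Matrix.transpose_pow, Matrix.transpose_transpose, mul_assoc]

theorem isSymm_Vup (θ : EuclideanSpace ℝ (Fin n)) (σ ε : ℝ) (N : ℕ) : (Vup θ σ ε N).IsSymm := by
  have h1 : (Vbar θ σ).IsSymm := (isSymm_tsum_conj θ (by
    rw [Matrix.IsSymm, Matrix.transpose_vecMulVec])).smul _
  have h2 : (gramian θ).IsSymm := by
    simpa [gramian] using isSymm_tsum_conj θ (P := 1) Matrix.isSymm_one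
  exact ((h1.add (h2.smul _)).submatrix _).smul _

theorem Vdn_le_Vup (hθ : IsSchur θ) {σ ε : ℝ} (hε : 0 ≤ ε) {N : ℕ} (hN : n ≤ N) (x : Fin n → ℝ) :
    x ⬝ᵥ (Vdn θ σ ε N).mulVec x ≤ x ⬝ᵥ (Vup θ σ ε N).mulVec x := by
  rw [dotProduct_Vdn_mulVec, dotProduct_Vup_mulVec]
  have hN' : (0 : ℝ) ≤ (N : ℝ) - n := by
    have : (n : ℝ) ≤ N := by exact_mod_cast hN
    linarith
  have h := (hasSum_gramian hθ (Fin.snoc x 0 : Fin (n + 1) → ℝ)).nonneg fun i => by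
    rw [← norm_toLp_sq]; positivity
  have := mul_nonneg (mul_nonneg (mul_nonneg hN' (sq_nonneg σ)) hε) h
  linarith

theorem posDef_of_quadratic_le {V U : Matrix (Fin n) (Fin n) ℝ} (hV : V.PosDef) (hU : U.IsSymm)
    (h : ∀ x : Fin n → ℝ, x ⬝ᵥ V.mulVec x ≤ x ⬝ᵥ U.mulVec x) : U.PosDef := by
  refine Matrix.PosDef.of_dotProduct_mulVec_pos (by
    rw [Matrix.IsHermitian, Matrix.conjTranspose_eq_transpose_of_trivial, hU.eq]) fun x hx => ?_
  have h1 := hV.dotProduct_mulVec_pos hx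
  rw [star_trivial] at h1 ⊢
  exact h1.trans_le (h x)

theorem det_mul_inv_add_one {U V : Matrix (Fin n) (Fin n) ℝ} (hV : V.det ≠ 0) :
    (U * V⁻¹ + 1).det = (U + V).det / V.det := by
  rw [eq_div_iff hV, ← Matrix.det_mul, add_mul, one_mul, mul_assoc,
    Matrix.nonsing_inv_mul _ (isUnit_iff_ne_zero.2 hV), mul_one]

/-- The first order optimality condition of a least squares estimate, along the estimation error. -/
theorem IsLeastSquares.dotProduct_score_ge {y e : ℤ → ℝ} {N : ℕ} {ϑ : EuclideanSpace ℝ (Fin n)}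
    (hϑ : IsLeastSquares n N y ϑ)
    (h : ∀ t, y t = (∑ k : Fin n, regressor n y (t - 1) k * θ k) + e t) :
    (ϑ - θ).ofLp ⬝ᵥ (information n N y).mulVec (ϑ - θ).ofLp ≤ (ϑ - θ).ofLp ⬝ᵥ score n N e y := by
  set d := ϑ - θ with hd
  set z : ℕ → ℝ := fun t => regressor n y ((t : ℤ) - 1) ⬝ᵥ d.ofLp with hz
  have hres : ∀ (t : ℕ) (s : ℝ), y t - ∑ k : Fin n, regressor n y ((t : ℤ) - 1) k * (ϑ - s • d) k =
      (e t - z t) + s * z t := fun t s => by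
    have h1 : ∑ k : Fin n, regressor n y ((t : ℤ) - 1) k * (ϑ - s • d) k =
        ∑ k : Fin n, regressor n y ((t : ℤ) - 1) k * θ k + (1 - s) * z t := by
      simp only [hz, dotProduct, Finset.mul_sum]
      rw [← Finset.sum_add_distrib]
      refine Finset.sum_congr rfl fun k _ => ?_
      simp only [hd, PiLp.sub_apply, PiLp.smul_apply, smul_eq_mul]
      ring
    rw [h1]
    nth_rewrite 1 [h t]
    ring
  have hinfo : d.ofLp ⬝ᵥ (information n N y).mulVec d.ofLp =
      ∑ t ∈ Finset.Icc (n + 1) N, z t ^ 2 := by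
    rw [information, Matrix.sum_mulVec, dotProduct_sum]
    refine Finset.sum_congr rfl fun t _ => ?_
    rw [Matrix.vecMulVec_mulVec, op_smul_eq_smul, dotProduct_smul, smul_eq_mul,
      dotProduct_comm d.ofLp, sq]
  have hscore : d.ofLp ⬝ᵥ score n N e y = ∑ t ∈ Finset.Icc (n + 1) N, e t * z t := by
    rw [score, dotProduct_sum]
    refine Finset.sum_congr rfl fun t _ => ?_
    rw [dotProduct_smul, smul_eq_mul, dotProduct_comm]
  set p := ∑ t ∈ Finset.Icc (n + 1) N, (e t - z t) * z t with hp
  set q := ∑ t ∈ Finset.Icc (n + 1) N, z t ^ 2 with hq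
  -- Moving the estimate by `-s d` changes the cost by this quadratic. It is nonnegative for all `s`
  -- without a constant term, so its discriminant forces `p = 0`.
  have hpq : ∀ s : ℝ, 0 ≤ q * (s * s) + 2 * p * s + 0 := fun s => by
    have h2 := hϑ (ϑ - s • d)
    have h3 : ∑ t ∈ Finset.Icc (n + 1) N,
        (y t - ∑ k : Fin n, regressor n y ((t : ℤ) - 1) k * ϑ k) ^ 2 =
        ∑ t ∈ Finset.Icc (n + 1) N, (e t - z t) ^ 2 := by
      refine Finset.sum_congr rfl fun t _ => ?_
      have := hres t 0
      rw [zero_smul, sub_zero, zero_mul, add_zero] at this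
      rw [this]
    have h4 : ∑ t ∈ Finset.Icc (n + 1) N,
        (y t - ∑ k : Fin n, regressor n y ((t : ℤ) - 1) k * (ϑ - s • d) k) ^ 2 =
        ∑ t ∈ Finset.Icc (n + 1) N, (e t - z t) ^ 2 + (q * (s * s) + 2 * p * s) := by
      rw [hp, hq, Finset.sum_mul, Finset.mul_sum, Finset.sum_mul, ← Finset.sum_add_distrib,
        ← Finset.sum_add_distrib]
      refine Finset.sum_congr rfl fun t _ => ?_
      rw [hres t s]
      ring
    rw [h3, h4] at h2
    linarith
  have hdisc := discrim_le_zero hpq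
  rw [discrim] at hdisc
  have hp0 : p = 0 := by
    have : (2 * p) ^ 2 ≤ 0 := by linarith
    nlinarith [sq_nonneg (2 * p)]
  rw [hinfo, hscore]
  have : p = ∑ t ∈ Finset.Icc (n + 1) N, e t * z t - q := by
    rw [hp, hq, ← Finset.sum_sub_distrib]
    exact Finset.sum_congr rfl fun t _ => by ring
  linarith

/-- A large weighted error makes the Gaussian mixture large. -/
theorem mixture_ge_of_weightNorm_lt {y e : ℤ → ℝ} {N : ℕ} {V U : Matrix (Fin n) (Fin n) ℝ}
    (hV : V.PosDef) {σ : ℝ} (hσ : 0 < σ) {d : Fin n → ℝ}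
    (hinfo : ∀ x : Fin n → ℝ, x ⬝ᵥ V.mulVec x ≤ x ⬝ᵥ (information n N y).mulVec x ∧
      x ⬝ᵥ (information n N y).mulVec x ≤ x ⬝ᵥ U.mulVec x)
    (hd : d ⬝ᵥ (information n N y).mulVec d ≤ d ⬝ᵥ score n N e y)
    (w : EuclideanSpace ℝ (Fin n)) {L : ℝ} (hL : 0 ≤ L)
    (h : 2 * σ * weightNorm w V * Real.sqrt L < |w.ofLp ⬝ᵥ d|) :
    ENNReal.ofReal (Real.exp L) * gaussianMass (U + V) ≤ mixture V σ N e y := by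
  have hρ : 0 ≤ weightNorm w V := norm_nonneg _
  have h1 : 4 * σ ^ 2 * L < d ⬝ᵥ V.mulVec d := by
    have h2 : (2 * σ * weightNorm w V * Real.sqrt L) ^ 2 < (w.ofLp ⬝ᵥ d) ^ 2 := by
      rw [← sq_abs (w.ofLp ⬝ᵥ d)]
      exact pow_lt_pow_left₀ h (by positivity) (by norm_num)
    have h3 := h2.trans_le (dotProduct_sq_le_weightNorm hV w d)
    rw [mul_pow, Real.sq_sqrt hL,
      show (2 * σ * weightNorm w V) ^ 2 * L = weightNorm w V ^ 2 * (4 * σ ^ 2 * L) by ring] at h3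
    exact lt_of_mul_lt_mul_left h3 (sq_nonneg _)
  have hVsymm : V.IsSymm := (by simpa using hV.isHermitian.eq : V.transpose = V)
  -- The test point `d/(2σ)` is the maximiser of the exponent when `V` equals the information
  -- matrix. Here the exponent is at least `(3dᵀId - dᵀVd)/(8σ²) ≥ dᵀVd/(4σ²) > L`.
  refine le_trans ?_ (exp_mul_gaussianMass_le ((isSymm_information n N y).add hVsymm)
    (σ⁻¹ • score n N e y) ((2 * σ)⁻¹ • d))
  refine mul_le_mul' (ENNReal.ofReal_le_ofReal (Real.exp_le_exp.2 ?_)) (gaussianMass_anti fun a => ?_)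
  · rw [smul_dotProduct, dotProduct_smul, smul_dotProduct, Matrix.mulVec_smul, dotProduct_smul,
      Matrix.add_mulVec, dotProduct_add]
    simp only [smul_eq_mul]
    have h4 := (hinfo d).1
    have h5 : (2 * σ)⁻¹ * (σ⁻¹ * (d ⬝ᵥ score n N e y)) -
        (2 * σ)⁻¹ * ((2 * σ)⁻¹ * (d ⬝ᵥ (information n N y).mulVec d + d ⬝ᵥ V.mulVec d)) / 2 =
        (4 * (d ⬝ᵥ score n N e y) - (d ⬝ᵥ (information n N y).mulVec d + d ⬝ᵥ V.mulVec d)) /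
          (8 * σ ^ 2) := by
      field_simp
      ring
    rw [h5, le_div_iff₀ (by positivity)]
    linarith
  · rw [Matrix.add_mulVec, Matrix.add_mulVec, dotProduct_add, dotProduct_add]
    linarith [(hinfo a).2]

theorem regressor_dotProduct_self (n : ℕ) (y : ℤ → ℝ) (t : ℤ) :
    regressor (n + 1) y t ⬝ᵥ regressor (n + 1) y t = ∑ s ∈ Finset.Icc (t - n) t, y s ^ 2 := by
  simp only [dotProduct, regressor]
  rw [Fin.sum_univ_eq_sum_range (fun k : ℕ => y (t - k) * y (t - k))]
  refine Finset.sum_nbij' (fun k : ℕ => t - k) (fun s => (t - s).toNat) ?_ ?_ ?_ ?_ ?_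
  · intro k hk; simp at hk ⊢; omega
  · intro s hs; simp at hs ⊢; omega
  · intro k hk; simp
  · intro s hs; simp at hs; simp; omega
  · intro k hk; ring

/-- Each diagonal entry is a sum of squares over a shifted window inside `1, …, N`. There are `n` of
them; `n + 1` matches `betaTilde`. -/
theorem trace_information_le (n N : ℕ) (y : ℤ → ℝ) :
    (information n N y).trace ≤ (n + 1) * ∑ s ∈ Finset.Icc 1 (N : ℤ), y s ^ 2 := by
  have h1 : (information n N y).trace =
      ∑ k : Fin n, ∑ t ∈ Finset.Icc (n + 1) N, y ((t : ℤ) - 1 - (k : ℕ)) ^ 2 := by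
    simp only [Matrix.trace, information, Matrix.diag_apply, Matrix.sum_apply,
      Matrix.vecMulVec_apply, regressor, sq]
  have h2 : ∀ k : Fin n, ∑ t ∈ Finset.Icc (n + 1) N, y ((t : ℤ) - 1 - (k : ℕ)) ^ 2 ≤
      ∑ s ∈ Finset.Icc 1 (N : ℤ), y s ^ 2 := fun k => by
    have hinj : Set.InjOn (fun t : ℕ => (t : ℤ) - 1 - (k : ℕ)) (Finset.Icc (n + 1) N) :=
      fun a _ b _ hab => by simp only at hab; omega
    rw [← Finset.sum_image (f := fun s => y s ^ 2) hinj]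
    refine Finset.sum_le_sum_of_subset_of_nonneg (fun s hs => ?_) fun _ _ _ => sq_nonneg _
    simp only [Finset.mem_image, Finset.mem_Icc] at hs ⊢
    have := k.2
    omega
  have h3 : 0 ≤ ∑ s ∈ Finset.Icc 1 (N : ℤ), y s ^ 2 := Finset.sum_nonneg fun _ _ => sq_nonneg _
  rw [h1]
  refine (Finset.sum_le_card_nsmul _ _ _ fun k _ => h2 k).trans ?_
  simp only [Finset.card_univ, Fintype.card_fin, nsmul_eq_mul]
  gcongr
  linarith

end deterministic

variable {Ω : Type*} [MeasurableSpace Ω] {μ : Measure Ω} [IsProbabilityMeasure μ]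
  {n : ℕ} {θ : EuclideanSpace ℝ (Fin n)} {σ : ℝ} {e y : ℤ → Ω → ℝ}

theorem IsStationaryAR.measure_state_gt_le (hy : IsStationaryAR μ θ σ e y) (hθ : IsSchur θ)
    (hσ : 0 < σ) (hn : 0 < n) {v : ℝ} (hv : v = ∫ ω, y 1 ω ^ 2 ∂μ) (t : ℤ) {c b : ℝ} (hb : 0 ≤ b)
    (hc : 3 * c = b) :
    μ {ω | c < regressor (n + 1) (fun s => y s ω) t ⬝ᵥ regressor (n + 1) (fun s => y s ω) t} ≤
      ENNReal.ofReal (Real.sqrt 2 * Real.exp (-b / (24 * n * v))) := by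
  have hv0 : 0 < v := hv ▸ hy.integral_output_sq_pos hθ hσ
  have h1 := hy.measure_sum_output_sq_le hθ hσ (S := Finset.Icc (t - n) t)
    ⟨t, by simp⟩ hv c
  simp only [regressor_dotProduct_self]
  refine h1.trans (ENNReal.ofReal_le_ofReal ?_)
  gcongr
  have hcard : ((Finset.Icc (t - n) t).card : ℝ) = n + 1 := by
    rw [Int.card_Icc]
    have : (t + 1 - (t - n)).toNat = n + 1 := by omega
    rw [this]; push_cast; ring
  -- The state has `n + 1 ≤ 2n` entries, so `4(n+1)v` with `c = b/3` gives the constant `24n`.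
  have hn1 : (1 : ℝ) ≤ n := by exact_mod_cast hn
  rw [hcard, neg_div, neg_le_neg_iff, ← hc, show 24 * (n : ℝ) * v = 3 * (4 * ((2 * n) * v)) by ring,
    mul_div_mul_left _ _ (by norm_num : (3 : ℝ) ≠ 0)]
  have hc0 : 0 ≤ c := by linarith
  gcongr
  linarith

theorem betaTilde_pos (hθ : IsSchur θ) {v ε : ℝ} (hv : 0 < v) (hσ : 0 < σ) (hε : 0 < ε) {N : ℕ}
    (hN : n < N) : 0 < betaTilde θ σ v ε N := by
  have hNn : (0 : ℝ) < (N : ℝ) - n := by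
    have : (n : ℝ) < N := by exact_mod_cast hN
    linarith
  have hN0 : (0 : ℝ) < N := by exact_mod_cast (by omega : 0 < N)
  have hM := MPhi_nonneg hθ
  unfold betaTilde
  positivity

/-- The event on which the information matrix is controlled has large probability. -/
theorem IsStationaryAR.measure_not_between_le (hy : IsStationaryAR μ θ σ e y) (hθ : IsSchur θ)
    (hσ : 0 < σ) (hn : 0 < n) {N : ℕ} (hN : n < N) {ε : ℝ} (hε : 0 < ε) :
    μ {ω | ¬ ∀ x : Fin n → ℝ,
      x ⬝ᵥ (Vdn θ σ ε N).mulVec x ≤ x ⬝ᵥ (information n N fun t => y t ω).mulVec x ∧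
      x ⬝ᵥ (information n N fun t => y t ω).mulVec x ≤ x ⬝ᵥ (Vup θ σ ε N).mulVec x} ≤
      ENNReal.ofReal (delta θ σ (∫ ω, y 1 ω ^ 2 ∂μ) ε N) := by
  set v := ∫ ω, y 1 ω ^ 2 ∂μ with hv
  have hv0 : 0 < v := hy.integral_output_sq_pos hθ hσ
  have hNn : (0 : ℝ) < (N : ℝ) - n := by
    have : (n : ℝ) < N := by exact_mod_cast hN
    linarith
  have hβ := betaTilde_pos hθ hv0 hσ hε hN
  set β := betaTilde θ σ v ε N with hβdef
  -- One third of the admissible error for each of the three error sources; `q` below is the score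
  -- norm that stays within this share.
  set c := ((N : ℝ) - n) * σ ^ 2 * ε / 3 with hc
  have h3c : 3 * c = ((N : ℝ) - n) * σ ^ 2 * ε := by rw [hc]; ring
  have hc0 : 0 < c := by positivity
  set K := ((N : ℝ) - n) * σ ^ 2 * ε * β with hK
  have hK0 : 0 < K := by positivity
  set q := c / (2 * (‖θ‖ + 1)) with hq
  have hθ1 : 0 < ‖θ‖ + 1 := by positivity
  have hq0 : 0 < q := by positivity
  set T : Finset ℤ := (Finset.Icc (n + 1) N).map Nat.castEmbedding with hT
  have hTcard : (T.card : ℝ) = (N : ℝ) - n := by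
    rw [hT, Finset.card_map, Nat.card_Icc, show N + 1 - (n + 1) = N - n by omega,
      Nat.cast_sub hN.le]
  have hTne : T.Nonempty := by
    rw [hT, Finset.map_nonempty]
    exact ⟨N, Finset.mem_Icc.2 ⟨hN, le_rfl⟩⟩
  have hTsum : ∀ ω, ∑ t ∈ T, e t ω ^ 2 = ∑ t ∈ Finset.Icc (n + 1) N, e t ω ^ 2 := fun ω => by
    rw [hT, Finset.sum_map]; rfl
  have b1 := hy.measure_state_gt_le hθ hσ hn hv n (c := c) (by positivity) h3c
  have b2 := hy.measure_state_gt_le hθ hσ hn hv N (c := c) (by positivity) h3c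
  have b3 := hy.measure_noise_upper_le hσ hTne hε
  have b4 := hy.measure_noise_lower_le hσ hTne hε
  have b5 := hy.measure_score_le hθ hσ hN.le hq0.le hK0
  have b6 := hy.measure_sum_output_sq_le_betaTilde hθ hσ hv hN hε (S := Finset.Icc 1 (N : ℤ))
    (by simp)
  rw [← hβdef, ← hK] at b6
  simp only [hTsum, hTcard] at b3 b4
  set E1 := {ω | c < regressor (n + 1) (fun s => y s ω) n ⬝ᵥ regressor (n + 1) (fun s => y s ω) n}
  set E2 := {ω | c < regressor (n + 1) (fun s => y s ω) N ⬝ᵥ regressor (n + 1) (fun s => y s ω) N}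
  set E3 := {ω | ((N : ℝ) - n) * σ ^ 2 + ((N : ℝ) - n) * σ ^ 2 * ε / 3 <
    ∑ t ∈ Finset.Icc (n + 1) N, e t ω ^ 2}
  set E4 := {ω | ∑ t ∈ Finset.Icc (n + 1) N, e t ω ^ 2 <
    ((N : ℝ) - n) * σ ^ 2 - ((N : ℝ) - n) * σ ^ 2 * ε / 3}
  set E5 := {ω | q < ‖WithLp.toLp 2 (score n N (fun t => e t ω) fun t => y t ω)‖ ∧
        (information n N fun t => y t ω).trace ≤ K}
  set E6 := {ω | K / (n + 1) < ∑ s ∈ Finset.Icc 1 (N : ℤ), y s ω ^ 2}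
  have hrec : ∀ᵐ ω ∂μ, ∀ t, y t ω =
      (∑ k : Fin n, regressor n (fun s => y s ω) (t - 1) k * θ k) + e t ω :=
    ae_all_iff.2 hy.recursion
  have hsub : {ω | ¬ ∀ x : Fin n → ℝ,
      x ⬝ᵥ (Vdn θ σ ε N).mulVec x ≤ x ⬝ᵥ (information n N fun t => y t ω).mulVec x ∧
      x ⬝ᵥ (information n N fun t => y t ω).mulVec x ≤ x ⬝ᵥ (Vup θ σ ε N).mulVec x} ≤ᵐ[μ]
      (E1 ∪ E2 ∪ E3 ∪ E4 ∪ E5 ∪ E6 : Set Ω) := by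
    filter_upwards [hrec] with ω hω hbad
    by_contra hgood
    have hgood' : ω ∉ E1 ∪ E2 ∪ E3 ∪ E4 ∪ E5 ∪ E6 := hgood
    simp only [Set.mem_union, not_or, E1, E2, E3, E4, E5, E6, Set.mem_ofPred_eq, not_lt] at hgood'
    obtain ⟨⟨⟨⟨⟨g1, g2⟩, g3⟩, g4⟩, g5⟩, g6⟩ := hgood'
    have htr : (information n N fun t => y t ω).trace ≤ K := by
      refine (trace_information_le n N fun t => y t ω).trans ?_
      rw [le_div_iff₀ (by positivity)] at g6
      linarith
    have g5' : ‖WithLp.toLp 2 (score n N (fun t => e t ω) fun t => y t ω)‖ ≤ q := by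
      by_contra hlt
      exact g5 ⟨not_le.1 hlt, htr⟩
    refine hbad (information_between hθ hω hN h3c g1 g2 ?_ ?_)
    · rw [abs_le]
      constructor <;> linarith
    · rw [hq, le_div_iff₀ (by positivity)] at g5'
      linarith
  refine (measure_mono_ae hsub).trans ?_
  set A := Real.sqrt 2 * Real.exp (-(((N : ℝ) - n) * σ ^ 2 * ε) / (24 * n * v)) with hA
  set B := Real.exp (-(((N : ℝ) - n) / 2 * (1 + ε / 3 - Real.sqrt (1 + 2 * ε / 3)))) with hB
  set C := Real.exp (-(((N : ℝ) - n) * ε / (72 * (‖θ‖ + 1) ^ 2 * β))) with hC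
  set D := Real.exp (-(ε * Real.sqrt N)) with hD
  have hA0 : 0 ≤ A := by positivity
  have hB0 : 0 ≤ B := (Real.exp_pos _).le
  have hC0 : 0 ≤ C := (Real.exp_pos _).le
  have hD0 : 0 ≤ D := (Real.exp_pos _).le
  -- The `72` is `2 · 6²`: the `2` from Pinelis, the `6` from `q = (N-n)σ²ε / (6(‖θ‖+1))`.
  have hCq : q ^ 2 / (2 * σ ^ 2 * K) = ((N : ℝ) - n) * ε / (72 * (‖θ‖ + 1) ^ 2 * β) := by
    rw [hq, hK, hc]
    field_simp
    norm_num
  rw [hCq, ← hC] at b5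
  calc μ (E1 ∪ E2 ∪ E3 ∪ E4 ∪ E5 ∪ E6)
      ≤ μ E1 + μ E2 + μ E3 + μ E4 + μ E5 + μ E6 := by
        refine (measure_union_le _ _).trans (add_le_add_left ?_ _)
        refine (measure_union_le _ _).trans (add_le_add_left ?_ _)
        refine (measure_union_le _ _).trans (add_le_add_left ?_ _)
        refine (measure_union_le _ _).trans (add_le_add_left ?_ _)
        exact measure_union_le _ _
    _ ≤ ENNReal.ofReal A + ENNReal.ofReal A + ENNReal.ofReal B + ENNReal.ofReal B +
        ENNReal.ofReal (2 * C) + ENNReal.ofReal D := by gcongr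
    _ = ENNReal.ofReal (A + A + B + B + 2 * C + D) := by
        rw [ENNReal.ofReal_add (by positivity) hD0, ENNReal.ofReal_add (by positivity) (by positivity),
          ENNReal.ofReal_add (by positivity) hB0, ENNReal.ofReal_add (by positivity) hB0,
          ENNReal.ofReal_add hA0 hA0]
    _ ≤ ENNReal.ofReal (delta θ σ v ε N) := by
        -- The states and the two noise tails use `A` and `B` twice, the score uses `2C`, and the
        -- output energy uses `D` once, half of what `delta` allows.
        refine ENNReal.ofReal_le_ofReal ?_
        rw [delta, ← hβdef, ← hA, ← hB, ← hC, ← hD]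
        linarith

end ARProcess

/-! ### The theorem: union of the two failure events. -/

theorem theorem2 {Ω : Type*} [MeasurableSpace Ω] (μ : Measure Ω) [IsProbabilityMeasure μ]
    (n N : ℕ) (hN : n < N) (θ : EuclideanSpace ℝ (Fin n)) (σ : ℝ) (hσ : 0 < σ)
    (e y : ℤ → Ω → ℝ) (hθ : ARProcess.IsSchur θ)
    (hy : ARProcess.IsStationaryAR μ θ σ e y)
    (θhat : Ω → EuclideanSpace ℝ (Fin n))
    (hθhat : ∀ᵐ ω ∂μ, ARProcess.IsLeastSquares n N (fun t => y t ω) (θhat ω))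
    (w : EuclideanSpace ℝ (Fin n)) (hw : ‖w‖ = 1)
    (ε : ℝ) (hε : 0 < ε) (hV : (ARProcess.Vdn θ σ ε N).PosDef)
    (δ : ℝ) (hδ : δ = ARProcess.delta θ σ (∫ ω, (y 1 ω) ^ 2 ∂μ) ε N) :
    μ.real {ω | 2 * σ * ARProcess.weightNorm w (ARProcess.Vdn θ σ ε N) *
        Real.sqrt (Real.log (Real.sqrt
          (ARProcess.Vup θ σ ε N * (ARProcess.Vdn θ σ ε N)⁻¹ + 1).det / δ)) <
        |inner ℝ w (θhat ω - θ)|} ≤ 2 * δ := by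
  -- In dimension `0` there is no unit vector.
  have hn : 0 < n := by
    rcases Nat.eq_zero_or_pos n with rfl | h
    · rw [Subsingleton.elim w 0, norm_zero] at hw
      norm_num at hw
    · exact h
  have hδ0 : 0 < δ := by
    rw [hδ, ARProcess.delta]; positivity
  -- For `δ ≥ 1` the bound is trivial. Otherwise `r ≥ 1`, so the logarithm is nonnegative and the
  -- square root takes its genuine value.
  rcases le_or_gt 1 δ with hδ1 | hδ1
  · exact measureReal_le_one.trans (by linarith)
  set V := ARProcess.Vdn θ σ ε N with hVdef
  set U := ARProcess.Vup θ σ ε N with hUdef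
  have hVU := ARProcess.Vdn_le_Vup (σ := σ) hθ hε.le hN.le
  have hU : U.PosDef := ARProcess.posDef_of_quadratic_le hV (ARProcess.isSymm_Vup θ σ ε N) hVU
  have hUV : (U + V).PosDef := hU.add hV
  have hdet : V.det ≤ (U + V).det := by
    refine ARProcess.det_le_det_of_quadratic_le hV hUV fun a => ?_
    rw [Matrix.add_mulVec, dotProduct_add]
    have := hU.posSemidef.dotProduct_mulVec_nonneg a
    rw [star_trivial] at this
    linarith
  have hV0 : 0 < V.det := hV.det_pos
  set r := Real.sqrt (U * V⁻¹ + 1).det / δ with hr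
  have hsqrt : Real.sqrt (U * V⁻¹ + 1).det = Real.sqrt (U + V).det / Real.sqrt V.det := by
    rw [ARProcess.det_mul_inv_add_one hV0.ne', Real.sqrt_div hUV.det_pos.le]
  have hsqrt1 : 1 ≤ Real.sqrt (U * V⁻¹ + 1).det := by
    rw [hsqrt, one_le_div (Real.sqrt_pos.2 hV0)]
    exact Real.sqrt_le_sqrt hdet
  have hr1 : 1 ≤ r := by
    rw [hr, one_le_div hδ0]; linarith
  have hr0 : 0 < r := by linarith
  have hmix := hy.measure_mixture_ge_le hθ hσ hN.le hV hUV hr0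
  -- The threshold `r` is chosen so that Markov's bound for the mixture is exactly `δ`.
  have hratio : Real.sqrt (U + V).det / Real.sqrt V.det / r = δ := by
    rw [← hsqrt, hr]; field_simp
  rw [hratio] at hmix
  have hgood := hy.measure_not_between_le hθ hσ hn hN hε
  rw [← hδ] at hgood
  have hrec : ∀ᵐ ω ∂μ, ∀ t, y t ω =
      (∑ k : Fin n, ARProcess.regressor n (fun s => y s ω) (t - 1) k * θ k) + e t ω :=
    ae_all_iff.2 hy.recursion
  have hsub : ({ω | 2 * σ * ARProcess.weightNorm w V * Real.sqrt (Real.log r) <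
      |inner ℝ w (θhat ω - θ)|} : Set Ω) ≤ᵐ[μ]
      ({ω | ¬ ∀ x : Fin n → ℝ,
        x ⬝ᵥ V.mulVec x ≤ x ⬝ᵥ (ARProcess.information n N fun t => y t ω).mulVec x ∧
        x ⬝ᵥ (ARProcess.information n N fun t => y t ω).mulVec x ≤ x ⬝ᵥ U.mulVec x} ∪
      {ω | ENNReal.ofReal r * ARProcess.gaussianMass (U + V) ≤
        ARProcess.mixture V σ N (fun t => e t ω) (fun t => y t ω)} : Set Ω) := by
    filter_upwards [hrec, hθhat] with ω hω hls hbad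
    by_cases hb : ∀ x : Fin n → ℝ,
        x ⬝ᵥ V.mulVec x ≤ x ⬝ᵥ (ARProcess.information n N fun t => y t ω).mulVec x ∧
        x ⬝ᵥ (ARProcess.information n N fun t => y t ω).mulVec x ≤ x ⬝ᵥ U.mulVec x
    · right
      have hinner : inner ℝ w (θhat ω - θ) = w.ofLp ⬝ᵥ (θhat ω - θ).ofLp := by
        rw [EuclideanSpace.inner_eq_star_dotProduct, star_trivial, dotProduct_comm]
      have h1 : 2 * σ * ARProcess.weightNorm w V * Real.sqrt (Real.log r) <
          |w.ofLp ⬝ᵥ (θhat ω - θ).ofLp| := hinner ▸ hbad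
      have h2 := ARProcess.mixture_ge_of_weightNorm_lt hV hσ hb (hls.dotProduct_score_ge hω) w
        (Real.log_nonneg hr1) h1
      rwa [Real.exp_log hr0] at h2
    · exact Or.inl hb
  have htotal := (measure_mono_ae hsub).trans ((measure_union_le _ _).trans (add_le_add hgood hmix))
  rw [← ENNReal.ofReal_add hδ0.le hδ0.le, ← two_mul] at htotal
  exact ENNReal.toReal_le_of_le_ofReal (by positivity) htotal
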